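/- **Setting.** Let $X\sim F$ be a random observation in a measurable space $\mathcal X$, let $\rho(x,\theta)$, $\theta\in\mathbb R^d$ ($d\ge 1$), be a loss that is measurable in $x$, twice continuously differentiable in $\theta$, with $L_0(\theta)=\mathbb E[\rho(X,\theta)]$ finite, and let $\theta_0$ be the unique global minimizer of $L_0$. All gradients and Hessians are in $\theta$; $\|\cdot\|$ is the Euclidean or operator norm. Let $\tau_1,\tau_2,W,C_1,C_2,C_B,D,c>0$ be constants such that 1. $\theta_0\in\Theta$ for a compact convex set $\Theta\subset\mathbb R^d$ with $\|\theta\|\le D\sqrt d$ for all $\theta\in\Theta$; 2. $\mathbb E[\nabla^2\rho(X,\theta)]\succeq\tau_1 I_d$ for all $\theta\in\mathbb R^d$; 3. for all $\theta\in\mathbb R^d$, all unit vectors $v$ and all $t\ge 0$, $\mathbb P\big(v^\top(\nabla\rho(X,\theta)-\mathbb E\nabla\rho(X,\theta))\ge t\big)\le e^{-t^2/C_1^2}$ and $\mathbb P\big(v^\top(\nabla^2\rho(X,\theta)-\mathbb E\nabla^2\rho(X,\theta))v\ge t\big)\le e^{-t^2/C_2^2}$; 4. $\|\nabla^2\rho(x,\theta)-\nabla^2\rho(x,\theta')\|\le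 W\|\theta-\theta'\|$ and $\|\nabla^2\rho(x,\theta)\|\le\tau_2$ for all $x\in\mathcal X$ and $\theta,\theta'\in\mathbb R^d$; 5. $\mathrm{tr}\,\Sigma\ge c\,d$, where $\Sigma=\mathrm{Var}(\nabla\rho(X,\theta_0))$. **Algorithm (private FedAvg).** Client $i\in\{1,\dots,m\}$, $m\ge1$, holds $n_i\ge1$ observations $x^{(i)}_j$; all $N=\sum_i n_i$ observations are i.i.d. with law $F$. Fix $R\ge1$ rounds, $K$ local steps per round, a privacy parameter $\mu>0$, a step size $\eta$ with $\frac1{2\tau_2}\le\eta\le\frac9{10\tau_2}$, $B=C_B\sqrt{d\vee\log N}$ and $\sigma_i=\frac{2B\eta\sqrt{RK}}{\mu n_i}$. Put $\theta^{(0)}=0$. In round $r=1,\dots,R$ every client starts at $\theta_i^{(0)}=\theta^{(r-1)}$ and computes $$\theta_i^{(t+1)}=\theta_i^{(t)}-\frac{\eta}{n_i}\sum_{j=1}^{n_i}\nabla\rho(x^{(i)}_j,\theta_i^{(t)})+\sigma_iZ_{r,i,t},\qquad t=0,\dots,K-1,$$ where the $Z_{r,i,t}\sim\mathcal N(0,I_d)$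 are independent of each other and of the data; then $\theta^{(r)}=\sum_{i=1}^m\frac{n_i}{N}\theta_i^{(K)}$. **Theorem (Error bound for FedAvg).** There is a constant $C>0$ that depends only on $\tau_1,\tau_2,W,C_1,C_2,C_B,D,c$ (and not on $d,m,n_i,R,K,\mu,\eta,F,\rho,\Theta$) such that, whenever $K\ge C\log(dN)/\log\!\big(3\tau_2/(3\tau_2-\tau_1)\big)$, the output $\theta^{(R)}$ has a finite mean squared error, and $$\mathbb E\big\|\theta^{(R)}-\theta_0\big\|^2\le\frac{16}{\tau_1^2}\left(\frac{\mathrm{tr}\,\Sigma}{N}+\frac{2m\,C\,R\,K\,d\,(d\vee\log N)}{\mu^2N^2}\right)+\frac{C}{N^2}\left(m\,\mathrm{tr}\,\Sigma+\sum_{i=1}^m\frac{R\,K\,d\,(d\vee\log N)}{\mu^2n_i}\right)^2 .$$ -/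

import Mathlib

open MeasureTheory ProbabilityTheory

open scoped RealInnerProductSpace

noncomputable section

namespace FedAvg

/-- `ℝᵈ` with the Euclidean norm. -/
abbrev Vec (d : ℕ) : Type := EuclideanSpace ℝ (Fin d)

section Loss

variable {d : ℕ} {𝒳 : Type*} [MeasurableSpace 𝒳]

/-- The gradient `∇ρ(x, θ)` of the loss in the parameter. -/
def grad (ρ : 𝒳 → Vec d → ℝ) (x : 𝒳) (θ : Vec d) : Vec d :=
  gradient (ρ x) θ

/-- The Hessian `∇²ρ(x, θ)` of the loss in the parameter, as a linear operator on `ℝᵈ`. -/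
def hess (ρ : 𝒳 → Vec d → ℝ) (x : 𝒳) (θ : Vec d) : Vec d →L[ℝ] Vec d :=
  fderiv ℝ (fun θ' => grad ρ x θ') θ

/-- The expected loss `L₀(θ) = 𝔼[ρ(X, θ)]`, where `X ∼ F`. -/
def popRisk (F : Measure 𝒳) (ρ : 𝒳 → Vec d → ℝ) (θ : Vec d) : ℝ :=
  ∫ x, ρ x θ ∂F

/-- The expected gradient `𝔼[∇ρ(X, θ)]`. -/
def popGrad (F : Measure 𝒳) (ρ : 𝒳 → Vec d → ℝ) (θ : Vec d) : Vec d :=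
  ∫ x, grad ρ x θ ∂F

/-- The expected Hessian `𝔼[∇²ρ(X, θ)]`. -/
def popHess (F : Measure 𝒳) (ρ : 𝒳 → Vec d → ℝ) (θ : Vec d) : Vec d →L[ℝ] Vec d :=
  ∫ x, hess ρ x θ ∂F

/-- The covariance matrix `Var(∇ρ(X, θ))`. -/
def gradCov (F : Measure 𝒳) (ρ : 𝒳 → Vec d → ℝ) (θ : Vec d) : Matrix (Fin d) (Fin d) ℝ :=
  Matrix.of fun a b => cov[fun x => grad ρ x θ a, fun x => grad ρ x θ b; F]

/-- The data law `F`, the loss `ρ`, the parameter space `Θ` and the target `θ₀` form a regular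
M-estimation problem with constants `τ₁, τ₂, W, C₁, C₂`. -/
structure RegularProblem (F : Measure 𝒳) (ρ : 𝒳 → Vec d → ℝ) (Θ : Set (Vec d)) (θ₀ : Vec d)
    (τ₁ τ₂ W C₁ C₂ : ℝ) : Prop where
  /-- The loss is measurable in the observation, twice continuously differentiable in the
  parameter, and its expectation exists. -/
  measurable_loss : ∀ θ, Measurable fun x => ρ x θ
  contDiff_loss : ∀ x, ContDiff ℝ 2 (ρ x)
  integrable_loss : ∀ θ, Integrable (fun x => ρ x θ) F
  /-- The parameter space is compact and convex. -/
  isCompact_param : IsCompact Θ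
  convex_param : Convex ℝ Θ
  /-- The target is the unique minimizer of the expected loss, and lies in the parameter space. -/
  target_mem : θ₀ ∈ Θ
  target_min : ∀ θ, θ ≠ θ₀ → popRisk F ρ θ₀ < popRisk F ρ θ
  /-- The expected loss is strongly convex: `𝔼[∇²ρ(X, θ)] ⪰ τ₁ I`. -/
  strongly_convex : ∀ θ v : Vec d, τ₁ * ‖v‖ ^ 2 ≤ ⟪v, popHess F ρ θ v⟫
  /-- The gradient is sub-Gaussian. -/
  subGaussian_grad : ∀ θ v : Vec d, ‖v‖ = 1 → ∀ t : ℝ, 0 ≤ t →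
    F.real {x | t ≤ ⟪v, grad ρ x θ - popGrad F ρ θ⟫} ≤ Real.exp (-(t ^ 2 / C₁ ^ 2))
  /-- The Hessian is sub-Gaussian. -/
  subGaussian_hess : ∀ θ v : Vec d, ‖v‖ = 1 → ∀ t : ℝ, 0 ≤ t →
    F.real {x | t ≤ ⟪v, (hess ρ x θ - popHess F ρ θ) v⟫} ≤ Real.exp (-(t ^ 2 / C₂ ^ 2))
  /-- The Hessian is Lipschitz in the parameter and bounded, in operator norm. -/
  lipschitz_hess : ∀ x, ∀ θ θ' : Vec d, ‖hess ρ x θ - hess ρ x θ'‖ ≤ W * ‖θ - θ'‖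
  bounded_hess : ∀ x, ∀ θ : Vec d, ‖hess ρ x θ‖ ≤ τ₂

end Loss

section Algorithm

variable {d m : ℕ} {𝒳 : Type*}

/-- The total sample size `N = ∑ᵢ nᵢ`. -/
def totalSize (n : Fin m → ℕ) : ℕ := ∑ i, n i

/-- `d ∨ log N`. -/
def dimLog (d : ℕ) (n : Fin m → ℕ) : ℝ := max (d : ℝ) (Real.log (totalSize n))

/-- The noise scale `2 B η √(RK) / (μ k)` of a client with `k` samples. -/
def noiseScale (B η μ : ℝ) (R K k : ℕ) : ℝ :=
  2 * B * η * Real.sqrt ((R : ℝ) * K) / (μ * k)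

/-- Noisy gradient descent of one client with data `x₁, …, x_k`, step size `η`, noise scale `σ`
and noise vectors `z₀, z₁, …`, started at `θ`: the iterate after `t` steps. -/
def localIter (ρ : 𝒳 → Vec d → ℝ) (η σ : ℝ) {k : ℕ} (x : Fin k → 𝒳) (z : ℕ → Vec d)
    (θ : Vec d) : ℕ → Vec d
  | 0 => θ
  | t + 1 =>
      localIter ρ η σ x z θ t
        - (η / k) • ∑ j, grad ρ (x j) (localIter ρ η σ x z θ t)
        + σ • z t

/-- The server's parameter after `r` rounds of federated averaging with `K` local steps per round,
started at `0`; client `i` has data `x i` and noise scale `σ i`, and uses the noise vector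
`z r i t` in local step `t` of the round that follows `r` complete rounds. -/
def fedAvg (ρ : 𝒳 → Vec d → ℝ) (η : ℝ) (K : ℕ) {n : Fin m → ℕ} (σ : Fin m → ℝ)
    (x : (i : Fin m) → Fin (n i) → 𝒳) (z : ℕ → Fin m → ℕ → Vec d) : ℕ → Vec d
  | 0 => 0
  | r + 1 => ∑ i, ((n i : ℝ) / totalSize n) •
      localIter ρ η (σ i) (x i) (z r i) (fedAvg ρ η K σ x z r) K

end Algorithm

section Randomness

variable {d m : ℕ} {𝒳 Ω : Type*} [MeasurableSpace 𝒳] [MeasurableSpace Ω]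

/-- On the probability space `(Ω, P)` the data `X i j` are i.i.d. with law `F`, the noise vectors
`Z r i t` are i.i.d. with law `N(0, I_d)`, and data and noise are independent. -/
structure IsSample (P : Measure Ω) (F : Measure 𝒳) {n : Fin m → ℕ}
    (X : (i : Fin m) → Fin (n i) → Ω → 𝒳) (Z : ℕ → Fin m → ℕ → Ω → Vec d) : Prop where
  measurable_data : ∀ i j, Measurable (X i j)
  law_data : ∀ i j, P.map (X i j) = F
  indep_data : iIndepFun (fun p : (i : Fin m) × Fin (n i) => X p.1 p.2) P
  measurable_noise : ∀ r i t, Measurable (Z r i t)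
  law_noise : ∀ r i t, P.map (Z r i t) = stdGaussian (Vec d)
  indep_noise : iIndepFun (fun q : ℕ × Fin m × ℕ => Z q.1 q.2.1 q.2.2) P
  indep_data_noise : IndepFun
    (fun ω (p : (i : Fin m) × Fin (n i)) => X p.1 p.2 ω)
    (fun ω (q : ℕ × Fin m × ℕ) => Z q.1 q.2.1 q.2.2 ω) P

/-- The output of `R` rounds of private federated averaging with gradient bound `B` and privacy
parameter `μ`, as a random vector. -/
def privateFedAvg (ρ : 𝒳 → Vec d → ℝ) (η B μ : ℝ) (R K : ℕ) {n : Fin m → ℕ}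
    (X : (i : Fin m) → Fin (n i) → Ω → 𝒳) (Z : ℕ → Fin m → ℕ → Ω → Vec d) (ω : Ω) : Vec d :=
  fedAvg ρ η K (fun i => noiseScale B η μ R K (n i))
    (fun i j => X i j ω) (fun r i t => Z r i t ω) R

end Randomness

end FedAvg

end

/-! A population gradient step contracts towards θ₀ by the factor 1 - ητ₁. A client follows its
empirical gradient instead, and the same data serve every local step and every round, so the
iterates depend on the data and deviation bounds at a fixed θ do not suffice. The decisive tool is
therefore uniform over all of ℝᵈ: `exists_grad_bound` bounds the deviation of a client's gradient by
(τ₁/2)‖θ - θ₀‖ + Ξ, where Ξ has L⁴ norm of order √(d/nᵢ). The slope τ₁/2 costs half of the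
contraction, so each local step still contracts by κ = 1 - ητ₁/2, up to ηΞ and the privacy noise.
The L⁴ errors of all iterates are thus bounded independently of the round (`lpLe_localIter`,
`lpLe_four_fedAvg`), and no independence between iterates and data is used.

The uniform bound (`exists_uniform_bound`) replaces a covering argument by an integral J = ∫
exp(ν‖ξ(θ)‖² - νβ‖θ - θ₀‖²) dθ. Its expectation is controlled pointwise in θ by sub-Gaussianity.
Conversely, if ‖ξ(θ)‖ exceeds τ‖θ - θ₀‖ at one point, the Lipschitz property keeps ξ large on a
ball, which makes J exponentially large.

Given fourth moments, the last round is linearized at θ₀ (`lpLe_two_fedAvg_succ`). All clients share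
the linear part A = I - η∇²L₀(θ₀), so their weighted mean error obeys U' = AU - ηS + noise - ηQ.
Here S is the pooled gradient at θ₀, with second moment tr Σ/N, and summing powers of A turns it
into at most ‖S‖/τ₁. The noise terms are independent, so their second moments add with geometric
weights. The remainder Q is quadratic in the client errors and Hessian deviations; its L² norm is
what needs L⁴ bounds, and the weights nᵢ/N turn squared errors of order d/nᵢ into m d/N in total.

The error inherited from earlier rounds is damped by κ^K ≤ 1/(dN), and tr Σ ≥ c d converts m d into
m tr Σ. Minkowski's inequality in L² and (x + y + z)² ≤ 3(x² + y² + z²) conclude, with 3 ≤ 16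
leaving slack. -/

noncomputable section

namespace FedAvg

/-! ### Gaussian tails and moment generating functions -/

section SubGaussian

/-- For |x| ≤ 1 this is the second-order Taylor bound; otherwise x² + 1 ≤ exp(x²) is enough. The
linear term stays separate because it is the one that centering removes. -/
theorem exp_le_add_exp_sq (x : ℝ) : Real.exp x ≤ x + Real.exp (x ^ 2) := by
  have h2 : x ^ 2 + 1 ≤ Real.exp (x ^ 2) := Real.add_one_le_exp _
  rcases le_total |x| 1 with h | h
  · have h1 := (abs_le.1 (Real.abs_exp_sub_one_sub_id_le h)).2
    linarith
  · rcases le_abs.1 h with h3 | h3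
    · have : Real.exp x ≤ Real.exp (x ^ 2) := Real.exp_le_exp.2 (by nlinarith)
      linarith
    · have : Real.exp x ≤ 1 := Real.exp_le_one_iff.2 (by linarith)
      nlinarith

theorem exp_mul_le_one_add {a : ℝ} (h0 : 0 ≤ a) (h1 : a ≤ 1) (b : ℝ) :
    Real.exp (a * b) ≤ 1 + a * (Real.exp b - 1) := by
  have := convexOn_exp.2 (Set.mem_univ b) (Set.mem_univ 0) h0 (sub_nonneg.2 h1) (by ring)
  simp only [smul_eq_mul, mul_zero, add_zero, Real.exp_zero, mul_one] at this
  linarith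

theorem hasDerivAt_exp_mul_sq (a t : ℝ) :
    HasDerivAt (fun t => Real.exp (a * t ^ 2)) (2 * a * t * Real.exp (a * t ^ 2)) t := by
  have h := ((hasDerivAt_pow 2 t).const_mul a).exp
  convert! h using 1
  simp
  ring

theorem lintegral_Ioi_mul_exp_neg_mul_sq {a : ℝ} (ha : 0 < a) :
    ∫⁻ t in Set.Ioi (0 : ℝ), ENNReal.ofReal (2 * a * t * Real.exp (-a * t ^ 2)) = 1 := by
  have hd : ∀ t ∈ Set.Ici (0 : ℝ), HasDerivAt (fun t => - Real.exp (-a * t ^ 2))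
      (2 * a * t * Real.exp (-a * t ^ 2)) t := by
    intro t _
    convert! (hasDerivAt_exp_mul_sq (-a) t).neg using 1
    ring
  have hnn : ∀ t ∈ Set.Ioi (0 : ℝ), 0 ≤ 2 * a * t * Real.exp (-a * t ^ 2) := by
    intro t ht
    have : 0 < t := ht
    positivity
  have hlim : Filter.Tendsto (fun t : ℝ => - Real.exp (-a * t ^ 2)) Filter.atTop (nhds (-0)) := by
    refine Filter.Tendsto.neg (Real.tendsto_exp_atBot.comp ?_)
    refine Filter.Tendsto.const_mul_atTop_of_neg (by linarith) ?_
    exact Filter.tendsto_pow_atTop (by norm_num)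
  have hi := integrableOn_Ioi_deriv_of_nonneg' hd hnn hlim
  rw [← ofReal_integral_eq_lintegral_ofReal hi
    ((ae_restrict_iff' measurableSet_Ioi).2 (Filter.Eventually.of_forall hnn)),
    integral_Ioi_of_hasDerivAt_of_nonneg' hd hnn hlim]
  simp

variable {Ω : Type*} [MeasurableSpace Ω] {P : Measure Ω} [IsProbabilityMeasure P]

/-- Layer-cake formula with a = 1/(2C²): the two tails 2exp(-2at²), weighted by the derivative
2at·exp(at²), leave twice an integral equal to 1. Hence 3 = 1 + 2. -/
theorem lintegral_exp_sq_le_of_tail {Y : Ω → ℝ} (hY : Measurable Y) {C : ℝ} (hC : 0 < C)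
    (h : ∀ t, 0 ≤ t → P.real {x | t ≤ Y x} ≤ Real.exp (-(t ^ 2 / C ^ 2)))
    (h' : ∀ t, 0 ≤ t → P.real {x | t ≤ -Y x} ≤ Real.exp (-(t ^ 2 / C ^ 2))) :
    ∫⁻ x, ENNReal.ofReal (Real.exp (1 / (2 * C ^ 2) * Y x ^ 2)) ∂P ≤ 3 := by
  set a : ℝ := 1 / (2 * C ^ 2) with ha
  have ha0 : 0 < a := by positivity
  have hcont : Continuous fun t : ℝ => 2 * a * t * Real.exp (a * t ^ 2) := by fun_prop
  have hint : ∀ x : ℝ, ∫ t in (0 : ℝ)..x, 2 * a * t * Real.exp (a * t ^ 2)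
      = Real.exp (a * x ^ 2) - 1 := by
    intro x
    rw [intervalIntegral.integral_eq_sub_of_hasDerivAt (fun t _ => hasDerivAt_exp_mul_sq a t)
      (hcont.intervalIntegrable _ _)]
    simp
  have hlc := lintegral_comp_eq_lintegral_meas_le_mul P (f := fun x => |Y x|)
    (g := fun t => 2 * a * t * Real.exp (a * t ^ 2))
    (Filter.Eventually.of_forall fun x => abs_nonneg _) hY.abs.aemeasurable
    (fun t _ => hcont.intervalIntegrable _ _)
    ((ae_restrict_iff' measurableSet_Ioi).2 (Filter.Eventually.of_forall fun t ht => by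
      have : (0 : ℝ) < t := ht
      positivity))
  have htail : ∀ t, 0 ≤ t → P {x | t ≤ |Y x|} ≤ 2 * ENNReal.ofReal (Real.exp (-(t ^ 2 / C ^ 2))) := by
    intro t ht
    have hsub : {x | t ≤ |Y x|} ⊆ {x | t ≤ Y x} ∪ {x | t ≤ -Y x} := fun x hx =>
      le_abs.1 (show t ≤ |Y x| from hx)
    refine (measure_mono hsub).trans ((measure_union_le _ _).trans ?_)
    rw [two_mul]
    refine add_le_add ?_ ?_
    · rw [← ofReal_measureReal]
      exact ENNReal.ofReal_le_ofReal (h t ht)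
    · rw [← ofReal_measureReal]
      exact ENNReal.ofReal_le_ofReal (h' t ht)
  calc ∫⁻ x, ENNReal.ofReal (Real.exp (a * Y x ^ 2)) ∂P
      = ∫⁻ x, (1 + ENNReal.ofReal (∫ t in (0 : ℝ)..|Y x|, 2 * a * t * Real.exp (a * t ^ 2))) ∂P := by
        refine lintegral_congr fun x => ?_
        rw [hint, sq_abs, ← ENNReal.ofReal_one, ← ENNReal.ofReal_add zero_le_one]
        · congr 1; ring
        · exact sub_nonneg.2 (Real.one_le_exp (by positivity))
    _ = 1 + ∫⁻ t in Set.Ioi (0 : ℝ), P {x | t ≤ |Y x|} *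
          ENNReal.ofReal (2 * a * t * Real.exp (a * t ^ 2)) := by
        rw [lintegral_add_left measurable_const, hlc]
        simp
    _ ≤ 1 + ∫⁻ t in Set.Ioi (0 : ℝ), 2 * ENNReal.ofReal (2 * a * t * Real.exp (-a * t ^ 2)) := by
        gcongr 1 + ?_
        refine setLIntegral_mono' measurableSet_Ioi fun t ht => ?_
        have ht0 : (0 : ℝ) < t := ht
        refine (mul_le_mul_left (htail t ht0.le) _).trans (le_of_eq ?_)
        rw [mul_assoc, ← ENNReal.ofReal_mul (Real.exp_nonneg _)]
        congr 2
        rw [mul_left_comm, ← Real.exp_add]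
        congr 2
        rw [ha]
        field_simp
        ring
    _ = 3 := by
        rw [lintegral_const_mul _ (by fun_prop), lintegral_Ioi_mul_exp_neg_mul_sq ha0]
        norm_num

/-- A centered random variable with two-sided Gaussian tails is sub-Gaussian. -/
theorem hasSubgaussianMGF_of_tail {Y : Ω → ℝ} (hY : Measurable Y) {C : ℝ} (hC : 0 < C)
    (h : ∀ t, 0 ≤ t → P.real {x | t ≤ Y x} ≤ Real.exp (-(t ^ 2 / C ^ 2)))
    (h' : ∀ t, 0 ≤ t → P.real {x | t ≤ -Y x} ≤ Real.exp (-(t ^ 2 / C ^ 2)))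
    (h0 : ∫ x, Y x ∂P = 0) :
    HasSubgaussianMGF Y (Real.toNNReal (8 * C ^ 2)) P := by
  set a : ℝ := 1 / (2 * C ^ 2) with ha
  have ha0 : 0 < a := by positivity
  have haC : a * C ^ 2 = 1 / 2 := by rw [ha]; field_simp
  have hl := lintegral_exp_sq_le_of_tail hY hC h h'
  rw [← ha] at hl
  have hE : Integrable (fun x => Real.exp (a * Y x ^ 2)) P := by
    refine ⟨by fun_prop, ?_⟩
    rw [hasFiniteIntegral_iff_ofReal (Filter.Eventually.of_forall fun x => Real.exp_nonneg _)]
    exact hl.trans_lt (by norm_num)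
  have hE3 : ∫ x, Real.exp (a * Y x ^ 2) ∂P ≤ 3 := by
    rw [integral_eq_lintegral_of_nonneg_ae
      (Filter.Eventually.of_forall fun x => Real.exp_nonneg _) (by fun_prop)]
    exact ENNReal.toReal_le_of_le_ofReal (by norm_num) (by simpa using hl)
  have hyoung : ∀ s y : ℝ, s * y ≤ s ^ 2 * C ^ 2 / 2 + a * y ^ 2 := by
    intro s y
    have h1 : 0 ≤ a * (s * C ^ 2 - y) ^ 2 := by positivity
    have h2 : a * (s * C ^ 2 - y) ^ 2
      = s ^ 2 * C ^ 2 * (a * C ^ 2) - 2 * s * y * (a * C ^ 2) + a * y ^ 2 := by ring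
    rw [h2, haC] at h1
    linarith
  have hexpb : ∀ s y : ℝ, Real.exp (s * y) ≤ Real.exp (s ^ 2 * C ^ 2 / 2) * Real.exp (a * y ^ 2) := by
    intro s y
    rw [← Real.exp_add]
    exact Real.exp_le_exp.2 (hyoung s y)
  have hint : ∀ s : ℝ, Integrable (fun x => Real.exp (s * Y x)) P := fun s =>
    (hE.const_mul (Real.exp (s ^ 2 * C ^ 2 / 2))).mono' (by fun_prop)
      (Filter.Eventually.of_forall fun x => by
        rw [Real.norm_of_nonneg (Real.exp_nonneg _)]
        exact hexpb s (Y x))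
  have hYint : Integrable Y P := by
    refine (hE.const_mul (1 / a + 1)).mono' (by fun_prop) (Filter.Eventually.of_forall fun x => ?_)
    have h1 := Real.add_one_le_exp (a * Y x ^ 2)
    have h2 : 0 ≤ 1 / a := by positivity
    have h3 : 1 / a * (a * Y x ^ 2) = Y x ^ 2 := by field_simp
    have h4 : 0 ≤ a * Y x ^ 2 := by positivity
    rw [Real.norm_eq_abs]
    have h5 : |Y x| ≤ Y x ^ 2 + 1 := by
      have := sq_abs (Y x)
      nlinarith [abs_nonneg (Y x)]
    nlinarith [mul_le_mul_of_nonneg_left h1 h2]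
  refine ⟨hint, fun s => ?_⟩
  have hc : ((Real.toNNReal (8 * C ^ 2) : NNReal) : ℝ) = 8 * C ^ 2 :=
    Real.coe_toNNReal _ (by positivity)
  rw [hc, mgf]
  -- For small s, (sY)² = 2C²s²·aY² with a factor at most 1, so convexity of exp bounds the moment
  -- generating function by 1 + 2C²s²(3 - 1). For large s, Young's inequality leaves the factor 3 ≤
  -- exp(7/4), and 7/4 ≤ (7/2)C²s² there.
  rcases le_total (2 * C ^ 2 * s ^ 2) 1 with hs | hs
  · have hb : ∀ x, Real.exp (s * Y x)
        ≤ s * Y x + (1 + 2 * C ^ 2 * s ^ 2 * (Real.exp (a * Y x ^ 2) - 1)) := by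
      intro x
      refine (exp_le_add_exp_sq _).trans ?_
      gcongr
      refine le_trans (le_of_eq ?_) (exp_mul_le_one_add (by positivity) hs (a * Y x ^ 2))
      congr 1
      have : 2 * C ^ 2 * s ^ 2 * (a * Y x ^ 2) = 2 * (a * C ^ 2) * (s * Y x) ^ 2 := by ring
      rw [this, haC]
      ring
    have hE1 : Integrable (fun x => Real.exp (a * Y x ^ 2) - 1) P := hE.sub (integrable_const _)
    have hint2 : Integrable (fun x => 1 + 2 * C ^ 2 * s ^ 2 * (Real.exp (a * Y x ^ 2) - 1)) P :=
      (integrable_const _).add (hE1.const_mul _)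
    have h1 := integral_mono (hint s) ((hYint.const_mul s).add hint2) hb
    have h2 : ∫ x, (s * Y x + (1 + 2 * C ^ 2 * s ^ 2 * (Real.exp (a * Y x ^ 2) - 1))) ∂P
        = 1 + 2 * C ^ 2 * s ^ 2 * (∫ x, Real.exp (a * Y x ^ 2) ∂P - 1) := by
      rw [integral_add (hYint.const_mul s) hint2, integral_const_mul, h0,
        integral_add (integrable_const _) (hE1.const_mul _),
        integral_const_mul, integral_sub hE (integrable_const _)]
      simp
    have h3 := Real.add_one_le_exp (8 * C ^ 2 * s ^ 2 / 2)
    have h4 : 0 ≤ 2 * C ^ 2 * s ^ 2 := by positivity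
    have h5 : ∫ x, Real.exp (s * Y x) ∂P ≤ 1 + 2 * C ^ 2 * s ^ 2 * (∫ x, Real.exp (a * Y x ^ 2) ∂P - 1) :=
      h1.trans (le_of_eq h2)
    nlinarith
  · have h1 := integral_mono (hint s) (hE.const_mul _) (fun x => hexpb s (Y x))
    rw [integral_const_mul] at h1
    refine h1.trans ?_
    calc Real.exp (s ^ 2 * C ^ 2 / 2) * ∫ x, Real.exp (a * Y x ^ 2) ∂P
        ≤ Real.exp (s ^ 2 * C ^ 2 / 2) * Real.exp (7 / 4) := by
          gcongr
          refine hE3.trans ?_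
          have := Real.quadratic_le_exp_of_nonneg (x := 7 / 4) (by norm_num)
          norm_num at this ⊢
          linarith
      _ ≤ Real.exp (8 * C ^ 2 * s ^ 2 / 2) := by
          rw [← Real.exp_add]
          exact Real.exp_le_exp.2 (by nlinarith)

end SubGaussian

/-! ### Norms of symmetric operators -/

section Operators

variable {E : Type*} [NormedAddCommGroup E] [InnerProductSpace ℝ E]

/-- A symmetric operator is bounded by the bound of its quadratic form. -/
theorem opNorm_le_of_abs_inner_le {T : E →L[ℝ] E} (hT : ∀ u v, ⟪T u, v⟫ = ⟪u, T v⟫) {c : ℝ}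
    (hc : 0 ≤ c) (h : ∀ v, |⟪T v, v⟫| ≤ c * ‖v‖ ^ 2) : ‖T‖ ≤ c := by
  have key : ∀ u w : E, 4 * ⟪T u, w⟫ ≤ 2 * c * (‖u‖ ^ 2 + ‖w‖ ^ 2) := by
    intro u w
    have h1 := (abs_le.1 (h (u + w))).2
    have h2 := (abs_le.1 (h (u - w))).1
    have h3 := parallelogram_law_with_norm ℝ u w
    have h4 : ⟪T w, u⟫ = ⟪T u, w⟫ := by rw [hT, real_inner_comm]
    simp only [map_add, map_sub, inner_add_left, inner_add_right, inner_sub_left,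
      inner_sub_right, h4] at h1 h2
    nlinarith
  refine T.opNorm_le_bound hc fun u => ?_
  rcases eq_or_ne (T u) 0 with h0 | h0
  · rw [h0, norm_zero]; positivity
  rcases eq_or_ne u 0 with hu | hu
  · simp [hu]
  have hTu : 0 < ‖T u‖ := norm_pos_iff.2 h0
  have hu' : 0 < ‖u‖ := norm_pos_iff.2 hu
  -- The test vector has the direction of T u and the length of u, which balances the two squares in
  -- `key`.
  have h1 := key u ((‖u‖ / ‖T u‖) • T u)
  rw [inner_smul_right, real_inner_self_eq_norm_sq, norm_smul, norm_div, norm_norm, norm_norm,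
    div_mul_cancel₀ _ hTu.ne'] at h1
  have h2 : ‖u‖ / ‖T u‖ * ‖T u‖ ^ 2 = ‖u‖ * ‖T u‖ := by field_simp
  rw [h2] at h1
  have : ‖u‖ * ‖T u‖ ≤ ‖u‖ * (c * ‖u‖) := by nlinarith
  exact le_of_mul_le_mul_left this hu'

end Operators

theorem inner_grad {d : ℕ} {𝒳 : Type*} {ρ : 𝒳 → Vec d → ℝ} (x : 𝒳) (θ v : Vec d) :
    ⟪grad ρ x θ, v⟫ = fderiv ℝ (ρ x) θ v := by
  rw [grad, inner_gradient_left]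

/-! ### Regularity of the loss and contraction of the population step -/

section Loss

variable {d : ℕ} {𝒳 : Type*} [MeasurableSpace 𝒳]

/-- A directional derivative is the limit of the measurable difference quotients n(f(θ + v/n) -
f(θ)). -/
theorem measurable_fderiv_apply {E G : Type*} [NormedAddCommGroup E] [NormedSpace ℝ E]
    [NormedAddCommGroup G] [NormedSpace ℝ G] [MeasurableSpace G] [BorelSpace G]
    [SecondCountableTopology G]
    {f : 𝒳 → E → G} (hf : ∀ θ, Measurable fun x => f x θ) {θ : E}
    (hd : ∀ x, DifferentiableAt ℝ (f x) θ) (v : E) :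
    Measurable fun x => fderiv ℝ (f x) θ v := by
  refine measurable_of_tendsto_metrizable
    (f := fun (n : ℕ) x => (n : ℝ) • (f x (θ + (n : ℝ)⁻¹ • v) - f x θ)) (fun n => ?_) ?_
  · exact ((hf _).sub (hf _)).const_smul _
  · rw [tendsto_pi_nhds]
    intro x
    exact ((hd x).hasFDerivAt.lim_real v).comp tendsto_natCast_atTop_atTop

theorem measurable_of_forall_inner {f : 𝒳 → Vec d} (h : ∀ v, Measurable fun x => ⟪f x, v⟫) :
    Measurable f := by
  have : f = fun x => WithLp.toLp 2 fun a => ⟪f x, EuclideanSpace.single a 1⟫ := by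
    ext x a
    simp [PiLp.inner_apply]
  rw [this]
  exact (WithLp.measurable_toLp 2 _).comp (measurable_pi_lambda _ fun a => h _)

variable {F : Measure 𝒳} {ρ : 𝒳 → Vec d → ℝ} {Θ : Set (Vec d)} {θ₀ : Vec d}
  {τ₁ τ₂ W C₁ C₂ : ℝ}

namespace RegularProblem

variable (h : RegularProblem F ρ Θ θ₀ τ₁ τ₂ W C₁ C₂)
include h

theorem differentiable_loss (x : 𝒳) : Differentiable ℝ (ρ x) :=
  (h.contDiff_loss x).differentiable (by norm_num)

theorem contDiff_grad (x : 𝒳) : ContDiff ℝ 1 (grad ρ x) := by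
  have h1 : ContDiff ℝ 1 (fderiv ℝ (ρ x)) := (h.contDiff_loss x).fderiv_right (by norm_num)
  exact (InnerProductSpace.toDual ℝ (Vec d)).symm.contDiff.comp h1

theorem hasFDerivAt_grad (x : 𝒳) (θ : Vec d) : HasFDerivAt (grad ρ x) (hess ρ x θ) θ :=
  ((h.contDiff_grad x).differentiable (by norm_num) θ).hasFDerivAt

theorem continuous_grad (x : 𝒳) : Continuous (grad ρ x) := (h.contDiff_grad x).continuous

theorem measurable_grad (θ : Vec d) : Measurable fun x => grad ρ x θ := by
  refine measurable_of_forall_inner fun v => ?_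
  simp only [inner_grad]
  exact measurable_fderiv_apply h.measurable_loss (fun x => h.differentiable_loss x θ) v

theorem measurable_hess_apply (θ v : Vec d) : Measurable fun x => hess ρ x θ v :=
  measurable_fderiv_apply (f := grad ρ) h.measurable_grad
    (fun x => (h.hasFDerivAt_grad x θ).differentiableAt) v

/-- Joint measurability is needed because the gradient is evaluated at random iterates; it holds
since the gradient is continuous in θ and measurable in x. -/
theorem measurable_uncurry_grad : Measurable fun p : 𝒳 × Vec d => grad ρ p.1 p.2 := by
  have := measurable_uncurry_of_continuous_of_measurable (u := fun θ x => grad ρ x θ)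
    (fun x => h.continuous_grad x) h.measurable_grad
  exact this.comp measurable_swap

theorem hess_symm (x : 𝒳) (θ u v : Vec d) : ⟪hess ρ x θ u, v⟫ = ⟪u, hess ρ x θ v⟫ := by
  have h1 : DifferentiableAt ℝ (fderiv ℝ (ρ x)) θ :=
    ((h.contDiff_loss x).fderiv_right (m := 1) (by norm_num)).differentiable (by norm_num) θ
  have h2 : ∀ u v, ⟪hess ρ x θ u, v⟫ = fderiv ℝ (fderiv ℝ (ρ x)) θ u v := by
    intro u v
    have h3 : HasFDerivAt (fun θ => ⟪grad ρ x θ, v⟫) ((innerSL ℝ v).comp (hess ρ x θ)) θ := by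
      simp only [real_inner_comm v]
      exact (innerSL ℝ v).hasFDerivAt.comp θ (h.hasFDerivAt_grad x θ)
    have h4 : HasFDerivAt (fun θ => fderiv ℝ (ρ x) θ v)
        ((fderiv ℝ (fderiv ℝ (ρ x)) θ).flip v) θ := by
      simpa using h1.hasFDerivAt.clm_apply (hasFDerivAt_const v θ)
    simp only [inner_grad] at h3
    have := congrArg (fun L => L u) (h3.unique h4)
    simpa [real_inner_comm] using this
  rw [real_inner_comm _ u, h2, h2]
  exact ((h.contDiff_loss x).contDiffAt.isSymmSndFDerivAt (by simp)) _ _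

theorem norm_grad_sub_le (x : 𝒳) (θ θ' : Vec d) :
    ‖grad ρ x θ - grad ρ x θ'‖ ≤ τ₂ * ‖θ - θ'‖ :=
  convex_univ.norm_image_sub_le_of_norm_hasFDerivWithin_le
    (fun y _ => (h.hasFDerivAt_grad x y).hasFDerivWithinAt) (fun y _ => h.bounded_hess x y)
    (Set.mem_univ _) (Set.mem_univ _)

theorem norm_grad_sub_hess_le (hW : 0 ≤ W) (x : 𝒳) (θ θ' : Vec d) :
    ‖grad ρ x θ - grad ρ x θ' - hess ρ x θ' (θ - θ')‖ ≤ W * ‖θ - θ'‖ ^ 2 := by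
  have := (convex_segment θ' θ).norm_image_sub_le_of_norm_hasFDerivWithin_le'
    (f := grad ρ x) (C := W * ‖θ - θ'‖) (φ := hess ρ x θ')
    (fun y _ => (h.hasFDerivAt_grad x y).hasFDerivWithinAt) (fun y hy => ?_)
    (left_mem_segment ℝ θ' θ) (right_mem_segment ℝ θ' θ)
  · calc _ ≤ _ := this
      _ = _ := by ring
  · refine (h.lipschitz_hess x y θ').trans ?_
    gcongr
    obtain ⟨t, ht, rfl⟩ := (segment_eq_image' ℝ θ' θ ▸ hy : y ∈ _)
    simp only [add_sub_cancel_left, norm_smul, Real.norm_of_nonneg ht.1]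
    exact mul_le_of_le_one_left (norm_nonneg _) ht.2

/-- Were the Hessian not integrable, its integral would be 0 by convention, contradicting strong
convexity on a unit vector; this is where d ≥ 1 enters. -/
theorem integrable_hess (hd : 1 ≤ d) (hτ₁ : 0 < τ₁) (θ : Vec d) :
    Integrable (fun x => hess ρ x θ) F := by
  by_contra hni
  have h1 := h.strongly_convex θ (EuclideanSpace.single ⟨0, hd⟩ 1)
  rw [popHess, integral_undef hni] at h1
  simp at h1
  linarith

theorem norm_popHess_le [IsProbabilityMeasure F] (θ : Vec d) : ‖popHess F ρ θ‖ ≤ τ₂ := by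
  refine (norm_integral_le_of_norm_le_const
    (Filter.Eventually.of_forall fun x => h.bounded_hess x θ)).trans ?_
  simp

theorem popHess_apply [IsProbabilityMeasure F] (hd : 1 ≤ d) (hτ₁ : 0 < τ₁) (θ v : Vec d) :
    popHess F ρ θ v = ∫ x, hess ρ x θ v ∂F :=
  (ContinuousLinearMap.integral_apply (h.integrable_hess hd hτ₁ θ) v)

theorem popHess_symm [IsProbabilityMeasure F] (hd : 1 ≤ d) (hτ₁ : 0 < τ₁) (θ u v : Vec d) :
    ⟪popHess F ρ θ u, v⟫ = ⟪u, popHess F ρ θ v⟫ := by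
  have hi := fun w => (h.integrable_hess hd hτ₁ θ).apply_continuousLinearMap w
  rw [h.popHess_apply hd hτ₁, h.popHess_apply hd hτ₁, real_inner_comm, ← integral_inner (hi u),
    ← integral_inner (hi v)]
  refine integral_congr_ae (Filter.Eventually.of_forall fun x => ?_)
  simp only
  rw [real_inner_comm, h.hess_symm]

theorem tau_le [IsProbabilityMeasure F] (hd : 1 ≤ d) : τ₁ ≤ τ₂ := by
  have h1 := h.strongly_convex θ₀ (EuclideanSpace.single ⟨0, hd⟩ 1)
  have h2 := real_inner_le_norm (EuclideanSpace.single ⟨0, hd⟩ 1)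
    (popHess F ρ θ₀ (EuclideanSpace.single ⟨0, hd⟩ 1))
  have h3 := (popHess F ρ θ₀).le_of_opNorm_le (h.norm_popHess_le θ₀)
    (EuclideanSpace.single ⟨0, hd⟩ 1)
  simp at h1 h2 h3
  linarith

/-- The deviation of the gradient from its mean, in any direction, is measurable. -/
theorem measurable_inner_dev (θ v : Vec d) :
    Measurable fun x => ⟪v, grad ρ x θ - popGrad F ρ θ⟫ :=
  measurable_const.inner ((h.measurable_grad θ).sub_const _)

theorem tail_dev [IsProbabilityMeasure F] (hC₁ : 0 < C₁) (θ : Vec d) {v : Vec d} (hv : ‖v‖ = 1) :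
    ∫⁻ x, ENNReal.ofReal
      (Real.exp (1 / (2 * C₁ ^ 2) * ⟪v, grad ρ x θ - popGrad F ρ θ⟫ ^ 2)) ∂F ≤ 3 := by
  refine lintegral_exp_sq_le_of_tail (h.measurable_inner_dev θ v) hC₁
    (h.subGaussian_grad θ v hv) fun t ht => ?_
  have := h.subGaussian_grad θ (-v) (by rwa [norm_neg]) t ht
  simpa only [inner_neg_left] using this

/-- Tails about any fixed vector give integrability, so the argument does not presuppose that
`popGrad` is a genuine mean rather than the default value 0. That it is one follows in
`integrable_grad`. -/
theorem integrable_inner_dev [IsProbabilityMeasure F] (hC₁ : 0 < C₁) (θ v : Vec d) :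
    Integrable (fun x => ⟪v, grad ρ x θ - popGrad F ρ θ⟫) F := by
  rcases eq_or_ne v 0 with rfl | hv
  · simp
  have hv' : 0 < ‖v‖ := norm_pos_iff.2 hv
  have h1 := h.tail_dev hC₁ θ (v := ‖v‖⁻¹ • v) (by
    rw [norm_smul, norm_inv, norm_norm, inv_mul_cancel₀ hv'.ne'])
  set a : ℝ := 1 / (2 * C₁ ^ 2) with ha
  have ha0 : 0 < a := by positivity
  have hm := h.measurable_inner_dev θ (‖v‖⁻¹ • v)
  set Y := fun x => ⟪‖v‖⁻¹ • v, grad ρ x θ - popGrad F ρ θ⟫ with hY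
  have hE : Integrable (fun x => Real.exp (a * Y x ^ 2)) F := by
    refine ⟨by fun_prop, ?_⟩
    rw [hasFiniteIntegral_iff_ofReal (Filter.Eventually.of_forall fun x => Real.exp_nonneg _)]
    exact h1.trans_lt (by norm_num)
  have hYi : Integrable Y F := by
    refine (hE.const_mul (1 / a + 1)).mono' (by fun_prop) (Filter.Eventually.of_forall fun x => ?_)
    have h1 := Real.add_one_le_exp (a * Y x ^ 2)
    have h2 : 0 ≤ 1 / a := by positivity
    have h3 : 1 / a * (a * Y x ^ 2) = Y x ^ 2 := by field_simp
    have h4 : 0 ≤ a * Y x ^ 2 := by positivity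
    rw [Real.norm_eq_abs]
    have h5 : |Y x| ≤ Y x ^ 2 + 1 := by
      have := sq_abs (Y x)
      nlinarith [abs_nonneg (Y x)]
    nlinarith [mul_le_mul_of_nonneg_left h1 h2]
  convert! hYi.const_mul ‖v‖ using 2 with x
  simp only [hY, inner_smul_left]
  simp [← mul_assoc, mul_inv_cancel₀ hv'.ne']

theorem integrable_grad [IsProbabilityMeasure F] (hC₁ : 0 < C₁) (θ : Vec d) : Integrable (fun x => grad ρ x θ) F := by
  have h1 : Integrable (fun x => grad ρ x θ - popGrad F ρ θ) F := by
    have : (fun x => grad ρ x θ - popGrad F ρ θ) = fun x =>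
        ∑ a, ⟪EuclideanSpace.single a (1 : ℝ), grad ρ x θ - popGrad F ρ θ⟫ •
          EuclideanSpace.single a (1 : ℝ) := by
      funext x
      have := (EuclideanSpace.basisFun (Fin d) ℝ).sum_repr' (grad ρ x θ - popGrad F ρ θ)
      simpa using this.symm
    rw [this]
    exact integrable_finsetSum _ fun a _ => (h.integrable_inner_dev hC₁ θ _).smul_const _
  convert! h1.add (integrable_const (popGrad F ρ θ)) using 2 with x
  simp

theorem integral_inner_dev [IsProbabilityMeasure F] (hC₁ : 0 < C₁) (θ v : Vec d) :
    ∫ x, ⟪v, grad ρ x θ - popGrad F ρ θ⟫ ∂F = 0 := by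
  have hi : Integrable (fun x => grad ρ x θ - popGrad F ρ θ) F :=
    (h.integrable_grad hC₁ θ).sub (integrable_const _)
  rw [integral_inner hi v,
    integral_sub (h.integrable_grad hC₁ θ) (integrable_const _)]
  simp [popGrad]

theorem hasSubgaussianMGF_dev [IsProbabilityMeasure F] (hC₁ : 0 < C₁) (θ : Vec d) {v : Vec d} (hv : ‖v‖ = 1) :
    HasSubgaussianMGF (fun x => ⟪v, grad ρ x θ - popGrad F ρ θ⟫) (Real.toNNReal (8 * C₁ ^ 2)) F := by
  refine hasSubgaussianMGF_of_tail (h.measurable_inner_dev θ v) hC₁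
    (h.subGaussian_grad θ v hv) (fun t ht => ?_) (h.integral_inner_dev hC₁ θ v)
  have := h.subGaussian_grad θ (-v) (by rwa [norm_neg]) t ht
  simpa only [inner_neg_left] using this

theorem norm_popGrad_sub_le [IsProbabilityMeasure F] (hC₁ : 0 < C₁) (θ θ' : Vec d) :
    ‖popGrad F ρ θ - popGrad F ρ θ'‖ ≤ τ₂ * ‖θ - θ'‖ := by
  rw [popGrad, popGrad, ← integral_sub (h.integrable_grad hC₁ θ) (h.integrable_grad hC₁ θ')]
  refine (norm_integral_le_of_norm_le_const
    (Filter.Eventually.of_forall fun x => h.norm_grad_sub_le x θ θ')).trans ?_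
  simp

theorem hasFDerivAt_popGrad [IsProbabilityMeasure F] (hd : 1 ≤ d) (hτ₁ : 0 < τ₁) (hC₁ : 0 < C₁) (θ : Vec d) :
    HasFDerivAt (popGrad F ρ) (popHess F ρ θ) θ :=
  hasFDerivAt_integral_of_dominated_of_fderiv_le (F := fun θ x => grad ρ x θ)
    (F' := fun θ x => hess ρ x θ) (bound := fun _ => τ₂) Filter.univ_mem
    (Filter.Eventually.of_forall fun θ => (h.measurable_grad θ).aestronglyMeasurable)
    (h.integrable_grad hC₁ θ) (h.integrable_hess hd hτ₁ θ).aestronglyMeasurable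
    (Filter.Eventually.of_forall fun x θ _ => h.bounded_hess x θ) (integrable_const _)
    (Filter.Eventually.of_forall fun x θ _ => h.hasFDerivAt_grad x θ)

/-- A quadratic upper bound that can be integrated directly, so that the first-order condition at θ₀
needs no derivative of the expected loss. -/
theorem loss_le (x : 𝒳) (θ v : Vec d) :
    ρ x (θ + v) ≤ ρ x θ + ⟪grad ρ x θ, v⟫ + τ₂ * ‖v‖ ^ 2 := by
  have h1 := (convex_segment θ (θ + v)).norm_image_sub_le_of_norm_hasFDerivWithin_le'
    (f := ρ x) (f' := fun y => fderiv ℝ (ρ x) y) (C := τ₂ * ‖v‖) (φ := fderiv ℝ (ρ x) θ)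
    (fun y _ => (h.differentiable_loss x y).hasFDerivAt.hasFDerivWithinAt) (fun y hy => ?_)
    (left_mem_segment ℝ θ (θ + v)) (right_mem_segment ℝ θ (θ + v))
  · rw [add_sub_cancel_left, Real.norm_eq_abs] at h1
    have h2 := (abs_le.1 h1).2
    rw [inner_grad]
    linarith
  · obtain ⟨t, ht, rfl⟩ := (segment_eq_image' ℝ θ (θ + v) ▸ hy : y ∈ _)
    have h2 : ∀ y, fderiv ℝ (ρ x) y = InnerProductSpace.toDual ℝ (Vec d) (grad ρ x y) := by
      intro y; rw [grad, toDual_gradient]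
    have hτ : 0 ≤ τ₂ := (norm_nonneg _).trans (h.bounded_hess x θ)
    simp only [h2, ← map_sub, LinearIsometryEquiv.norm_map]
    refine (h.norm_grad_sub_le x _ _).trans ?_
    simp only [add_sub_cancel_left, norm_smul, Real.norm_of_nonneg ht.1]
    gcongr
    exact mul_le_of_le_one_left (norm_nonneg _) ht.2

/-- First-order condition at the minimizer. -/
theorem popGrad_target [IsProbabilityMeasure F] (hC₁ : 0 < C₁) : popGrad F ρ θ₀ = 0 := by
  have h1 : ∀ v : Vec d, 0 ≤ ⟪v, popGrad F ρ θ₀⟫ + τ₂ * ‖v‖ ^ 2 := by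
    intro v
    have hi : Integrable (fun x => ⟪v, grad ρ x θ₀⟫) F := (h.integrable_grad hC₁ θ₀).const_inner v
    have hle : popRisk F ρ (θ₀ + v) ≤ popRisk F ρ θ₀ + ⟪v, popGrad F ρ θ₀⟫ + τ₂ * ‖v‖ ^ 2 := by
      have h2 := integral_mono (h.integrable_loss (θ₀ + v))
        (((h.integrable_loss θ₀).add hi).add (integrable_const (μ := F) (τ₂ * ‖v‖ ^ 2)))
        (fun x => by
          have := h.loss_le x θ₀ v
          rw [real_inner_comm] at this
          exact this)
      have h3 : ∫ x, ((((fun x => ρ x θ₀) + fun x => ⟪v, grad ρ x θ₀⟫) + fun _ => τ₂ * ‖v‖ ^ 2 : 𝒳 → ℝ)) x ∂F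
          = popRisk F ρ θ₀ + ⟪v, popGrad F ρ θ₀⟫ + τ₂ * ‖v‖ ^ 2 := by
        rw [integral_add' ((h.integrable_loss θ₀).add hi) (integrable_const _),
          integral_add' (h.integrable_loss θ₀) hi, integral_inner (h.integrable_grad hC₁ θ₀)]
        simp [popRisk, popGrad]
      exact h2.trans (le_of_eq h3)
    rcases eq_or_ne v 0 with rfl | hv
    · simp
    · have := h.target_min (θ₀ + v) (by simpa using hv)
      linarith
  set g := popGrad F ρ θ₀
  by_contra hg
  have hg' : 0 < ‖g‖ ^ 2 := by have := norm_pos_iff.2 hg; positivity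
  have hpos : 0 < |τ₂| + 1 := by positivity
  -- A short step along -g would make the right-hand side negative; |τ₂| + 1 is used because no sign
  -- of τ₂ is assumed here.
  have h2 := h1 (-(1 / (2 * (|τ₂| + 1))) • g)
  rw [inner_smul_left, real_inner_self_eq_norm_sq, norm_smul, mul_pow] at h2
  simp only [conj_trivial, Real.norm_eq_abs, sq_abs] at h2
  have h3 : -(1 / (2 * (|τ₂| + 1))) * ‖g‖ ^ 2 + τ₂ * ((-(1 / (2 * (|τ₂| + 1)))) ^ 2 * ‖g‖ ^ 2)
      = ‖g‖ ^ 2 / (4 * (|τ₂| + 1) ^ 2) * (τ₂ - 2 * (|τ₂| + 1)) := by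
    field_simp
    ring
  rw [h3] at h2
  have h4 : τ₂ - 2 * (|τ₂| + 1) < 0 := by linarith [le_abs_self τ₂, abs_nonneg τ₂]
  have : ‖g‖ ^ 2 / (4 * (|τ₂| + 1) ^ 2) * (τ₂ - 2 * (|τ₂| + 1)) < 0 :=
    mul_neg_of_pos_of_neg (by positivity) h4
  linarith

/-- The quadratic form of the expected Hessian lies between τ₁ and τ₂, so ητ₂ ≤ 1 keeps that of I -
ηH between 0 and 1 - ητ₁. -/
theorem norm_one_sub_popHess_le [IsProbabilityMeasure F] (hd : 1 ≤ d) (hτ₁ : 0 < τ₁) {η : ℝ} (hη : 0 ≤ η)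
    (hητ : η * τ₂ ≤ 1) (θ : Vec d) :
    ‖ContinuousLinearMap.id ℝ (Vec d) - η • popHess F ρ θ‖ ≤ 1 - η * τ₁ := by
  have hτ := h.tau_le hd
  refine opNorm_le_of_abs_inner_le (fun u v => ?_) (by nlinarith) fun v => ?_
  · simp [inner_sub_left, inner_sub_right, inner_smul_left, inner_smul_right,
      h.popHess_symm hd hτ₁]
  · have h1 := h.strongly_convex θ v
    have h2 : ⟪v, popHess F ρ θ v⟫ ≤ τ₂ * ‖v‖ ^ 2 := by
      refine (real_inner_le_norm _ _).trans ?_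
      have := (popHess F ρ θ).le_of_opNorm_le (h.norm_popHess_le θ) v
      nlinarith [norm_nonneg v]
    simp only [sub_apply, ContinuousLinearMap.id_apply,
      smul_apply, inner_sub_left, inner_smul_left, conj_trivial,
      real_inner_self_eq_norm_sq]
    rw [real_inner_comm]
    have h3 := mul_le_mul_of_nonneg_left h1 hη
    have h4 := mul_le_mul_of_nonneg_left h2 hη
    have h5 : 0 ≤ (1 - η * τ₂) * ‖v‖ ^ 2 := mul_nonneg (by linarith) (by positivity)
    have h6 : 0 ≤ (1 - η * τ₁) * ‖v‖ ^ 2 := mul_nonneg (by nlinarith) (by positivity)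
    rw [abs_le]
    constructor <;> nlinarith

/-- A population gradient step contracts towards the minimizer. -/
theorem norm_step_sub_target_le [IsProbabilityMeasure F] (hd : 1 ≤ d) (hτ₁ : 0 < τ₁) (hC₁ : 0 < C₁) {η : ℝ} (hη : 0 ≤ η)
    (hητ : η * τ₂ ≤ 1) (θ : Vec d) :
    ‖θ - η • popGrad F ρ θ - θ₀‖ ≤ (1 - η * τ₁) * ‖θ - θ₀‖ := by
  have h1 := convex_univ.norm_image_sub_le_of_norm_hasFDerivWithin_le
    (f := fun θ => θ - η • popGrad F ρ θ)
    (f' := fun θ => ContinuousLinearMap.id ℝ (Vec d) - η • popHess F ρ θ) (C := 1 - η * τ₁)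
    (fun y _ => ((hasFDerivAt_id y).sub
      ((h.hasFDerivAt_popGrad hd hτ₁ hC₁ y).const_smul η)).hasFDerivWithinAt)
    (fun y _ => h.norm_one_sub_popHess_le hd hτ₁ hη hητ y)
    (Set.mem_univ θ₀) (Set.mem_univ θ)
  simpa [h.popGrad_target hC₁] using h1

end RegularProblem

end Loss

/-! ### Gaussian integrals, ball volumes and exponential moments of squared norms -/

section GaussianIntegrals

variable {d : ℕ}

theorem lintegral_exp_neg_mul_sq_norm {b : ℝ} (hb : 0 < b) (x : Vec d) :
    ∫⁻ v : Vec d, ENNReal.ofReal (Real.exp (-b * ‖v - x‖ ^ 2))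
      = ENNReal.ofReal ((Real.pi / b) ^ ((d : ℝ) / 2)) := by
  rw [lintegral_sub_right_eq_self (fun v : Vec d => ENNReal.ofReal (Real.exp (-b * ‖v‖ ^ 2))) x]
  have h1 := GaussianFourier.integral_rexp_neg_mul_sq_norm (V := Vec d) hb
  have hpos : 0 < (Real.pi / b) ^ ((d : ℝ) / 2) := by positivity
  rw [finrank_euclideanSpace_fin] at h1
  rw [← h1, ofReal_integral_eq_lintegral_ofReal _
    (Filter.Eventually.of_forall fun v => Real.exp_nonneg _)]
  by_contra hni
  rw [integral_undef hni] at h1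
  exact hpos.ne h1

theorem two_rpow_half_mul_exp_neg_le (hd : 1 ≤ d) :
    (2 : ℝ) ^ ((d : ℝ) / 2) * Real.exp (-d) ≤ 3 / 4 := by
  have hd' : (1 : ℝ) ≤ d := by exact_mod_cast hd
  rw [Real.rpow_def_of_pos two_pos, ← Real.exp_add]
  have h1 : Real.log 2 * ((d : ℝ) / 2) + -d ≤ -(1 / 2) := by
    have := Real.log_two_lt_d9
    nlinarith
  refine (Real.exp_le_exp.2 h1).trans ?_
  rw [Real.exp_neg, inv_le_comm₀ (Real.exp_pos _) (by norm_num)]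
  have := Real.add_one_le_exp (1 / 2 : ℝ)
  norm_num at this ⊢
  linarith

/-- With br² = 2d, the Gaussian exp(-b‖v - x‖²) is at most 1 on the ball and at most exp(-d) times
the wider Gaussian with parameter b/2 outside. The latter carries at most 3/4 of the total integral,
so the ball has volume at least 1/4 of it. -/
theorem le_volume_ball (hd : 1 ≤ d) (x : Vec d) {r : ℝ} (hr : 0 < r) :
    ENNReal.ofReal (1 / 4 * (Real.pi * r ^ 2 / (2 * d)) ^ ((d : ℝ) / 2))
      ≤ volume (Metric.ball x r) := by
  have hd' : (0 : ℝ) < d := by exact_mod_cast hd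
  set b : ℝ := 2 * d / r ^ 2 with hb
  have hb0 : 0 < b := by positivity
  have hbr : b * r ^ 2 = 2 * d := by rw [hb]; field_simp
  have hpb : Real.pi * r ^ 2 / (2 * d) = Real.pi / b := by rw [hb]; field_simp
  rw [hpb]
  set I : ℝ := (Real.pi / b) ^ ((d : ℝ) / 2) with hI
  have hI0 : 0 ≤ I := by positivity
  have hI2 : (Real.pi / (b / 2)) ^ ((d : ℝ) / 2) = 2 ^ ((d : ℝ) / 2) * I := by
    rw [hI, ← Real.mul_rpow (by norm_num) (by positivity)]
    congr 1
    field_simp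
  have h1 := lintegral_exp_neg_mul_sq_norm hb0 x
  have h2 := lintegral_exp_neg_mul_sq_norm (half_pos hb0) x
  rw [hI2] at h2
  have hle : ∀ v : Vec d, ENNReal.ofReal (Real.exp (-b * ‖v - x‖ ^ 2))
      ≤ (Metric.ball x r).indicator 1 v
        + ENNReal.ofReal (Real.exp (-d)) * ENNReal.ofReal (Real.exp (-(b / 2) * ‖v - x‖ ^ 2)) := by
    intro v
    by_cases hv : v ∈ Metric.ball x r
    · rw [Set.indicator_of_mem hv]
      refine le_add_right ?_
      rw [Pi.one_apply, ENNReal.ofReal_le_one]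
      exact Real.exp_le_one_iff.2 (by nlinarith [sq_nonneg ‖v - x‖])
    · rw [← ENNReal.ofReal_mul (Real.exp_nonneg _), ← Real.exp_add]
      refine le_add_left (ENNReal.ofReal_le_ofReal (Real.exp_le_exp.2 ?_))
      rw [mem_ball_iff_norm, not_lt] at hv
      have : r ^ 2 ≤ ‖v - x‖ ^ 2 := by gcongr
      nlinarith
  have h3 := lintegral_mono (μ := volume) hle
  rw [lintegral_add_left (measurable_one.indicator measurableSet_ball), h1,
    lintegral_const_mul _ (by fun_prop), h2, lintegral_indicator_one measurableSet_ball,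
    ← ENNReal.ofReal_mul (Real.exp_nonneg _)] at h3
  have h4 : Real.exp (-d) * (2 ^ ((d : ℝ) / 2) * I) ≤ 3 / 4 * I := by
    have := mul_le_mul_of_nonneg_right (two_rpow_half_mul_exp_neg_le hd) hI0
    linarith
  have h5 : ENNReal.ofReal I = ENNReal.ofReal (1 / 4 * I) + ENNReal.ofReal (3 / 4 * I) := by
    rw [← ENNReal.ofReal_add (by positivity) (by positivity)]
    congr 1
    ring
  have h6 := h3.trans (add_le_add_right (ENNReal.ofReal_le_ofReal h4) _)
  rw [h5] at h6
  exact (ENNReal.add_le_add_iff_right ENNReal.ofReal_ne_top).1 h6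

/-- The exponential of a squared norm as a Gaussian mixture of exponentials of linear forms. -/
theorem lintegral_exp_inner_sub_half_sq (y : Vec d) :
    ∫⁻ g : Vec d, ENNReal.ofReal (Real.exp (⟪g, y⟫ - 1 / 2 * ‖g‖ ^ 2))
      = ENNReal.ofReal ((2 * Real.pi) ^ ((d : ℝ) / 2)) * ENNReal.ofReal (Real.exp (‖y‖ ^ 2 / 2)) := by
  have h1 := lintegral_exp_neg_mul_sq_norm (b := 1 / 2) (by norm_num) y
  have h2 : Real.pi / (1 / 2) = 2 * Real.pi := by ring
  rw [h2] at h1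
  rw [← h1, ← lintegral_mul_const _ (by fun_prop)]
  refine lintegral_congr fun g => ?_
  rw [← ENNReal.ofReal_mul (Real.exp_nonneg _), ← Real.exp_add, norm_sub_sq_real]
  congr 2
  ring

variable {Ω : Type*} [MeasurableSpace Ω] {P : Measure Ω} [SFinite P]

/-- Linearize exp(‖Y‖²/(4s)) by a Gaussian integral over g, exchange the integrals, and use the
assumption for each g. With sa² = 1/2 the weight exp(-‖g‖²/2) is only weakened to exp(-‖g‖²/4),
which costs 2^(d/2). -/
theorem lintegral_exp_sq_norm_le {Y : Ω → Vec d} (hY : Measurable Y) {s : ℝ} (hs : 0 < s)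
    (h : ∀ u : Vec d, ∫⁻ ω, ENNReal.ofReal (Real.exp ⟪u, Y ω⟫) ∂P
      ≤ ENNReal.ofReal (Real.exp (s * ‖u‖ ^ 2 / 2))) :
    ∫⁻ ω, ENNReal.ofReal (Real.exp (‖Y ω‖ ^ 2 / (4 * s))) ∂P
      ≤ ENNReal.ofReal (2 ^ ((d : ℝ) / 2)) := by
  set a : ℝ := (Real.sqrt (2 * s))⁻¹ with ha
  have ha2 : a ^ 2 = 1 / (2 * s) := by
    rw [ha, inv_pow, Real.sq_sqrt (by positivity), one_div]
  have hsa : s * a ^ 2 = 1 / 2 := by rw [ha2]; field_simp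
  have h2π : 0 < (2 * Real.pi) ^ ((d : ℝ) / 2) := by positivity
  have hc : ENNReal.ofReal ((2 * Real.pi) ^ ((d : ℝ) / 2)) ≠ 0 := by simpa using h2π
  rw [← ENNReal.mul_le_mul_iff_right hc ENNReal.ofReal_ne_top, ← lintegral_const_mul _ (by fun_prop)]
  calc ∫⁻ ω, ENNReal.ofReal ((2 * Real.pi) ^ ((d : ℝ) / 2))
        * ENNReal.ofReal (Real.exp (‖Y ω‖ ^ 2 / (4 * s))) ∂P
      = ∫⁻ ω, (∫⁻ g : Vec d, ENNReal.ofReal (Real.exp (⟪g, a • Y ω⟫ - 1 / 2 * ‖g‖ ^ 2))) ∂P := by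
        refine lintegral_congr fun ω => ?_
        rw [lintegral_exp_inner_sub_half_sq, norm_smul, mul_pow, Real.norm_eq_abs, sq_abs, ha2]
        congr 3
        field_simp
        ring
    _ = ∫⁻ g : Vec d, ∫⁻ ω, ENNReal.ofReal (Real.exp (⟪g, a • Y ω⟫ - 1 / 2 * ‖g‖ ^ 2)) ∂P := by
        rw [lintegral_lintegral_swap]
        exact Measurable.aemeasurable (by unfold Function.uncurry; fun_prop)
    _ ≤ ∫⁻ g : Vec d, ENNReal.ofReal (Real.exp (-(1 / 4) * ‖g - 0‖ ^ 2)) := by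
        refine lintegral_mono fun g => ?_
        calc ∫⁻ ω, ENNReal.ofReal (Real.exp (⟪g, a • Y ω⟫ - 1 / 2 * ‖g‖ ^ 2)) ∂P
            = ENNReal.ofReal (Real.exp (-(1 / 2 * ‖g‖ ^ 2)))
              * ∫⁻ ω, ENNReal.ofReal (Real.exp ⟪a • g, Y ω⟫) ∂P := by
              rw [← lintegral_const_mul _ (by fun_prop)]
              refine lintegral_congr fun ω => ?_
              rw [← ENNReal.ofReal_mul (Real.exp_nonneg _), ← Real.exp_add, inner_smul_left,
                inner_smul_right]
              congr 2
              simp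
              ring
          _ ≤ ENNReal.ofReal (Real.exp (-(1 / 2 * ‖g‖ ^ 2)))
              * ENNReal.ofReal (Real.exp (s * ‖a • g‖ ^ 2 / 2)) := by gcongr; exact h _
          _ = _ := by
              rw [← ENNReal.ofReal_mul (Real.exp_nonneg _), ← Real.exp_add, norm_smul, mul_pow,
                Real.norm_eq_abs, sq_abs, ← mul_assoc, hsa, sub_zero]
              congr 2
              ring
    _ = ENNReal.ofReal ((2 * Real.pi) ^ ((d : ℝ) / 2)) * ENNReal.ofReal (2 ^ ((d : ℝ) / 2)) := by
        rw [lintegral_exp_neg_mul_sq_norm (by norm_num), ← ENNReal.ofReal_mul h2π.le,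
          ← Real.mul_rpow (by positivity) (by norm_num)]
        congr 2
        ring

end GaussianIntegrals

/-! ### Uniform deviation bound for a Lipschitz random field -/

section UniformBound

variable {d : ℕ} {Ω : Type*} [MeasurableSpace Ω] {P : Measure Ω} [IsProbabilityMeasure P]

/-- The exponential rate `q` in the uniform bound for an `L`-Lipschitz random field. -/
def unifRate (L τ : ℝ) : ℝ := 64 * L ^ 2 * (1 / τ + 1 / (2 * L)) ^ 2 + 2

/-- The constant in the fourth-moment form of the uniform bound. -/
def unifConst (L τ : ℝ) : ℝ := 257 + 128 * unifRate L τ ^ 2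

/-- Converts an exponential lower bound on y into a polynomial bound on x, through x² ≤ 2q² + 2(x -
q)² and (x - q)² ≤ 2exp(x - q) for x ≥ q. -/
theorem mul_self_le_of_exp_le {x y q : ℝ} (hx : 0 ≤ x) (hq : 0 ≤ q) (h : Real.exp (x - q) ≤ y) :
    x ^ 2 ≤ 2 * q ^ 2 + 4 * y := by
  have hy : 0 ≤ y := (Real.exp_nonneg _).trans h
  rcases le_total x q with hxq | hxq
  · nlinarith
  · have h1 := Real.quadratic_le_exp_of_nonneg (x := x - q) (by linarith)
    nlinarith [sq_nonneg (x - 2 * q), sq_nonneg (x - q)]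

/-- A Lipschitz random field whose value at each point has a Gaussian-type squared exponential
moment is, uniformly over the whole space, at most linear with an arbitrary slope plus a random
offset with a fourth moment of the order of the pointwise one. -/
theorem exists_uniform_bound (hd : 1 ≤ d) {ξ : Ω → Vec d → Vec d}
    (hξ : Measurable fun p : Ω × Vec d => ξ p.1 p.2) {L τ ν : ℝ} (hL : 0 < L) (hτ : 0 < τ)
    (hν : 0 < ν) (hlip : ∀ ω θ θ', ‖ξ ω θ - ξ ω θ'‖ ≤ L * ‖θ - θ'‖)
    (hexp : ∀ θ, ∫⁻ ω, ENNReal.ofReal (Real.exp (ν * ‖ξ ω θ‖ ^ 2)) ∂P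
      ≤ ENNReal.ofReal (2 ^ ((d : ℝ) / 2))) (θ₀ : Vec d) :
    ∃ Ξ : Ω → ℝ, Measurable Ξ ∧ (∀ ω, 0 ≤ Ξ ω) ∧
      (∀ᵐ ω ∂P, ∀ θ, ‖ξ ω θ‖ ≤ τ * ‖θ - θ₀‖ + Ξ ω) ∧
      ∫⁻ ω, ENNReal.ofReal (Ξ ω ^ 4) ∂P ≤ ENNReal.ofReal (unifConst L τ * (d / ν) ^ 2) := by
  have hd' : (1 : ℝ) ≤ d := by exact_mod_cast hd
  have hd0 : (0 : ℝ) < d := by linarith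
  set k : ℝ := 1 / τ + 1 / (2 * L) with hk
  have hk0 : 0 < k := by positivity
  -- If ‖ξ(θ)‖ = s ≥ τ‖θ - θ₀‖, points within s/(2L) of θ are within ks of θ₀. This β makes the
  -- penalty there at most νs²/8, half of the guaranteed ν(s/2)².
  set β : ℝ := 1 / (8 * k ^ 2) with hβ
  have hβ0 : 0 < β := by positivity
  have hβk : β * k ^ 2 = 1 / 8 := by rw [hβ]; field_simp
  set q : ℝ := unifRate L τ with hq
  have hqdef : q = 64 * L ^ 2 * k ^ 2 + 2 := rfl
  have hq0 : 0 < q := by rw [hqdef]; positivity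
  -- `le_volume_ball` at radius s/(2L) gives at least this volume once s² ≥ d/ν.
  set v₀ : ℝ := 1 / 4 * (Real.pi / (8 * L ^ 2 * ν)) ^ ((d : ℝ) / 2) with hv₀
  have hv₀0 : 0 < v₀ := by positivity
  set K₀ : ℝ := v₀ * Real.exp (q * d) with hK₀
  have hK₀0 : 0 < K₀ := by positivity
  set J : Ω → ENNReal := fun ω => ∫⁻ θ : Vec d,
    ENNReal.ofReal (Real.exp (ν * ‖ξ ω θ‖ ^ 2 + -(ν * β) * ‖θ - θ₀‖ ^ 2)) with hJ
  have hmeas2 : Measurable fun p : Ω × Vec d =>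
      ENNReal.ofReal (Real.exp (ν * ‖ξ p.1 p.2‖ ^ 2 + -(ν * β) * ‖p.2 - θ₀‖ ^ 2)) := by
    fun_prop
  have hJm : Measurable J := hmeas2.lintegral_prod_right'
  have hEJ : ∫⁻ ω, J ω ∂P ≤ ENNReal.ofReal K₀ := by
    calc ∫⁻ ω, J ω ∂P
        = ∫⁻ θ : Vec d, ∫⁻ ω,
          ENNReal.ofReal (Real.exp (ν * ‖ξ ω θ‖ ^ 2 + -(ν * β) * ‖θ - θ₀‖ ^ 2)) ∂P := by
          rw [hJ, lintegral_lintegral_swap]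
          exact hmeas2.aemeasurable
      _ ≤ ∫⁻ θ : Vec d, ENNReal.ofReal (2 ^ ((d : ℝ) / 2))
            * ENNReal.ofReal (Real.exp (-(ν * β) * ‖θ - θ₀‖ ^ 2)) := by
          refine lintegral_mono fun θ => ?_
          have hm : Measurable fun ω => ξ ω θ := hξ.comp (measurable_id.prodMk measurable_const)
          simp only [Real.exp_add, ENNReal.ofReal_mul (Real.exp_nonneg _)]
          rw [lintegral_mul_const _ (by fun_prop)]
          gcongr
          exact hexp θ
      _ = ENNReal.ofReal (2 ^ ((d : ℝ) / 2) * (Real.pi / (ν * β)) ^ ((d : ℝ) / 2)) := by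
          rw [lintegral_const_mul _ (by fun_prop), lintegral_exp_neg_mul_sq_norm (by positivity),
            ENNReal.ofReal_mul (by positivity)]
      _ ≤ ENNReal.ofReal K₀ := by
          refine ENNReal.ofReal_le_ofReal ?_
          have h1 : (2 : ℝ) ^ ((d : ℝ) / 2) * (Real.pi / (ν * β)) ^ ((d : ℝ) / 2)
              = (Real.pi / (8 * L ^ 2 * ν)) ^ ((d : ℝ) / 2)
                * (128 * L ^ 2 * k ^ 2) ^ ((d : ℝ) / 2) := by
            rw [← Real.mul_rpow (by norm_num) (by positivity),
              ← Real.mul_rpow (by positivity) (by positivity)]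
            congr 1
            rw [hβ]
            field_simp
            ring
          -- The ratio of the two Gaussian volumes is exponential in d; together with 4 ≤ exp(2d)
          -- for the factor 1/4 in v₀ it is absorbed by exp(qd).
          have h2 : (128 * L ^ 2 * k ^ 2) ^ ((d : ℝ) / 2)
              ≤ Real.exp ((128 * L ^ 2 * k ^ 2) * ((d : ℝ) / 2)) := by
            rw [Real.exp_mul]
            refine Real.rpow_le_rpow (by positivity) ?_ (by positivity)
            linarith [Real.add_one_le_exp (128 * L ^ 2 * k ^ 2)]
          have h3 : (4 : ℝ) ≤ Real.exp (2 * d) := by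
            have h5 := Real.quadratic_le_exp_of_nonneg (x := 2 * (d : ℝ)) (by positivity)
            nlinarith
          have h4 : Real.exp (q * d)
              = Real.exp ((128 * L ^ 2 * k ^ 2) * ((d : ℝ) / 2)) * Real.exp (2 * d) := by
            rw [← Real.exp_add, hqdef]
            congr 1
            ring
          rw [h1, hK₀, hv₀, h4]
          set A := (Real.pi / (8 * L ^ 2 * ν)) ^ ((d : ℝ) / 2)
          set E := Real.exp ((128 * L ^ 2 * k ^ 2) * ((d : ℝ) / 2))
          have hA : 0 ≤ A := by positivity
          have hE : 0 ≤ E := Real.exp_nonneg _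
          calc A * (128 * L ^ 2 * k ^ 2) ^ ((d : ℝ) / 2) ≤ A * E := by gcongr
            _ ≤ A * E * (Real.exp (2 * d) / 4) := le_mul_of_one_le_right (by positivity) (by linarith)
            _ = _ := by ring
  -- f dominates the fourth power of the offset: the first term handles s² ≤ d/ν, the second is
  -- `mul_self_le_of_exp_le` for x = νs²/8. Since J/K₀ has mean at most 1, the mean of f is of order
  -- (d/ν)².
  set f : Ω → ℝ := fun ω =>
    (d / ν) ^ 2 + 64 / ν ^ 2 * (2 * (q * d) ^ 2 + 4 * ((J ω).toReal / K₀)) with hf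
  have hf0 : ∀ ω, 0 ≤ f ω := fun ω => by
    have : 0 ≤ (J ω).toReal := ENNReal.toReal_nonneg
    simp only [hf]
    positivity
  have hfm : Measurable f := by
    have := hJm.ennreal_toReal
    simp only [hf]
    fun_prop
  have hroot : ∀ ω, (Real.sqrt (Real.sqrt (f ω))) ^ 4 = f ω := fun ω => by
    rw [show (4 : ℕ) = 2 * 2 from rfl, pow_mul, Real.sq_sqrt (Real.sqrt_nonneg _),
      Real.sq_sqrt (hf0 ω)]
  refine ⟨fun ω => Real.sqrt (Real.sqrt (f ω)), by fun_prop, fun ω => Real.sqrt_nonneg _, ?_, ?_⟩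
  · have hfin : ∀ᵐ ω ∂P, J ω < ⊤ :=
      ae_lt_top hJm (hEJ.trans_lt ENNReal.ofReal_lt_top).ne
    filter_upwards [hfin] with ω hω θ
    set s := ‖ξ ω θ‖ with hs
    have hs0 : 0 ≤ s := norm_nonneg _
    rcases le_total s (τ * ‖θ - θ₀‖) with h1 | h1
    · exact h1.trans (le_add_of_nonneg_right (Real.sqrt_nonneg _))
    · refine le_trans ?_ (le_add_of_nonneg_left (by positivity))
      refine le_of_pow_le_pow_left₀ (n := 4) (by norm_num) (Real.sqrt_nonneg _) ?_
      rw [hroot]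
      have hJ0 : 0 ≤ (J ω).toReal := ENNReal.toReal_nonneg
      rcases le_total (s ^ 2) (d / ν) with h2 | h2
      · have h3 : s ^ 4 ≤ (d / ν) ^ 2 := by
          rw [show s ^ 4 = (s ^ 2) ^ 2 by ring]
          gcongr
        refine h3.trans (le_add_of_nonneg_right (by positivity))
      · have hspos : 0 < s := by
          have : 0 < s ^ 2 := lt_of_lt_of_le (by positivity) h2
          exact lt_of_le_of_ne' hs0 (sq_pos_iff.1 this)
        set r : ℝ := s / (2 * L) with hr
        have hr0 : 0 < r := by positivity
        have hball : ∀ θ' ∈ Metric.ball θ r, ν * s ^ 2 / 8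
            ≤ ν * ‖ξ ω θ'‖ ^ 2 + -(ν * β) * ‖θ' - θ₀‖ ^ 2 := by
          intro θ' hθ'
          rw [mem_ball_iff_norm] at hθ'
          have h4 : s / 2 ≤ ‖ξ ω θ'‖ := by
            have h5 := hlip ω θ θ'
            have h6 := norm_sub_norm_le (ξ ω θ) (ξ ω θ')
            have h7 : L * ‖θ - θ'‖ ≤ s / 2 := by
              rw [norm_sub_rev]
              calc L * ‖θ' - θ‖ ≤ L * r := by gcongr
                _ = s / 2 := by rw [hr]; field_simp
            linarith
          have h5 : ‖θ' - θ₀‖ ≤ k * s := by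
            have h6 : ‖θ' - θ₀‖ ≤ ‖θ' - θ‖ + ‖θ - θ₀‖ := norm_sub_le_norm_sub_add_norm_sub _ _ _
            have h7 : ‖θ - θ₀‖ ≤ s / τ := by rwa [le_div_iff₀' hτ]
            have h8 : k * s = s / τ + r := by rw [hk, hr]; ring
            linarith
          have h6 : (s / 2) ^ 2 ≤ ‖ξ ω θ'‖ ^ 2 := by gcongr
          have h7 : ‖θ' - θ₀‖ ^ 2 ≤ (k * s) ^ 2 := by gcongr
          have h8 : β * ‖θ' - θ₀‖ ^ 2 ≤ s ^ 2 / 8 := by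
            calc β * ‖θ' - θ₀‖ ^ 2 ≤ β * (k * s) ^ 2 := by gcongr
              _ = (β * k ^ 2) * s ^ 2 := by ring
              _ = s ^ 2 / 8 := by rw [hβk]; ring
          nlinarith
        have hJge : ENNReal.ofReal (Real.exp (ν * s ^ 2 / 8) * v₀) ≤ J ω := by
          rw [ENNReal.ofReal_mul (Real.exp_nonneg _)]
          calc ENNReal.ofReal (Real.exp (ν * s ^ 2 / 8)) * ENNReal.ofReal v₀
              ≤ ENNReal.ofReal (Real.exp (ν * s ^ 2 / 8)) * volume (Metric.ball θ r) := by
                gcongr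
                refine le_trans (ENNReal.ofReal_le_ofReal ?_) (le_volume_ball hd θ hr0)
                rw [hv₀]
                gcongr 1 / 4 * ?_ ^ _
                rw [hr, div_pow, div_le_div_iff₀ (by positivity) (by positivity)]
                have h3 : (d : ℝ) ≤ ν * s ^ 2 := by
                  rw [div_le_iff₀ hν] at h2
                  linarith
                have h4 : s ^ 2 / (2 * L) ^ 2 * (8 * L ^ 2 * ν) = 2 * (ν * s ^ 2) := by
                  field_simp
                  ring
                calc Real.pi * (2 * d) ≤ Real.pi * (2 * (ν * s ^ 2)) := by gcongr
                  _ = Real.pi * (s ^ 2 / (2 * L) ^ 2) * (8 * L ^ 2 * ν) := by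
                    rw [mul_assoc, h4]
            _ = ∫⁻ θ' in Metric.ball θ r, ENNReal.ofReal (Real.exp (ν * s ^ 2 / 8)) := by
                rw [setLIntegral_const]
            _ ≤ ∫⁻ θ' in Metric.ball θ r, ENNReal.ofReal
                  (Real.exp (ν * ‖ξ ω θ'‖ ^ 2 + -(ν * β) * ‖θ' - θ₀‖ ^ 2)) :=
                setLIntegral_mono' measurableSet_ball fun θ' hθ' =>
                  ENNReal.ofReal_le_ofReal (Real.exp_le_exp.2 (hball θ' hθ'))
            _ ≤ J ω := setLIntegral_le_lintegral _ _
        have hJr : Real.exp (ν * s ^ 2 / 8) * v₀ ≤ (J ω).toReal :=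
          (ENNReal.ofReal_le_iff_le_toReal hω.ne).1 hJge
        have hx : Real.exp (ν * s ^ 2 / 8 - q * d) ≤ (J ω).toReal / K₀ := by
          rw [le_div_iff₀ hK₀0, Real.exp_sub, hK₀]
          calc _ = Real.exp (ν * s ^ 2 / 8) * v₀ := by
                have := (Real.exp_pos (q * d)).ne'
                field_simp
            _ ≤ _ := hJr
        have h3 := mul_self_le_of_exp_le (by positivity) (by positivity) hx
        have h4 : s ^ 4 = 64 / ν ^ 2 * (ν * s ^ 2 / 8) ^ 2 := by
          field_simp
          ring
        rw [h4]
        refine le_trans ?_ (le_add_of_nonneg_left (by positivity))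
        gcongr
  · simp only [hroot]
    have hsplit : ∀ ω, ENNReal.ofReal (f ω)
        ≤ ENNReal.ofReal ((d / ν) ^ 2 + 128 / ν ^ 2 * (q * d) ^ 2)
          + ENNReal.ofReal (256 / (ν ^ 2 * K₀)) * J ω := by
      intro ω
      have h1 : f ω = ((d / ν) ^ 2 + 128 / ν ^ 2 * (q * d) ^ 2)
          + 256 / (ν ^ 2 * K₀) * (J ω).toReal := by
        simp only [hf]
        field_simp
        ring
      rw [h1, ENNReal.ofReal_add (by positivity) (by positivity),
        ENNReal.ofReal_mul (by positivity)]
      gcongr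
      exact ENNReal.ofReal_toReal_le
    refine (lintegral_mono hsplit).trans ?_
    rw [lintegral_add_left measurable_const, lintegral_const_mul _ hJm, lintegral_const,
      measure_univ, mul_one]
    calc _ ≤ ENNReal.ofReal ((d / ν) ^ 2 + 128 / ν ^ 2 * (q * d) ^ 2)
          + ENNReal.ofReal (256 / (ν ^ 2 * K₀)) * ENNReal.ofReal K₀ := by gcongr
      _ ≤ _ := by
        rw [← ENNReal.ofReal_mul (by positivity), ← ENNReal.ofReal_add (by positivity) (by positivity)]
        refine ENNReal.ofReal_le_ofReal ?_
        have h1 : 256 / (ν ^ 2 * K₀) * K₀ = 256 / ν ^ 2 := by field_simp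
        have h2 : unifConst L τ * (d / ν) ^ 2
            = (d / ν) ^ 2 + 128 / ν ^ 2 * (q * d) ^ 2 + 256 / ν ^ 2 * d ^ 2 := by
          rw [unifConst, ← hq]
          field_simp
          ring
        rw [h1, h2]
        have h3 : 256 / ν ^ 2 * 1 ≤ 256 / ν ^ 2 * (d : ℝ) ^ 2 := by
          gcongr
          nlinarith
        linarith

end UniformBound

/-! ### Calculus of Lᵖ bounds -/

section LpBounds

variable {Ω : Type*} [MeasurableSpace Ω] {P : Measure Ω}
  {E : Type*} [NormedAddCommGroup E] {G : Type*} [NormedAddCommGroup G]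

/-- `f` is measurable with `Lᵖ` norm at most `a`. -/
def LpLe (P : Measure Ω) (p : ENNReal) (f : Ω → E) (a : ℝ) : Prop :=
  AEStronglyMeasurable f P ∧ eLpNorm f p P ≤ ENNReal.ofReal a

namespace LpLe

variable {p : ENNReal} {f : Ω → E} {g : Ω → G} {a b : ℝ}

theorem mono (h : LpLe P p f a) (hab : a ≤ b) : LpLe P p f b :=
  ⟨h.1, h.2.trans (ENNReal.ofReal_le_ofReal hab)⟩

theorem of_norm_le (h : LpLe P p f a) (hg : AEStronglyMeasurable g P)
    (hle : ∀ᵐ ω ∂P, ‖g ω‖ ≤ ‖f ω‖) : LpLe P p g a :=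
  ⟨hg, (eLpNorm_mono_ae hle).trans h.2⟩

theorem norm (h : LpLe P p f a) : LpLe P p (fun ω => ‖f ω‖) a :=
  h.of_norm_le h.1.norm (Filter.Eventually.of_forall fun ω => by simp)

theorem add {f' : Ω → E} (h : LpLe P p f a) (h' : LpLe P p f' b) (hp : 1 ≤ p) (ha : 0 ≤ a)
    (hb : 0 ≤ b) : LpLe P p (fun ω => f ω + f' ω) (a + b) := by
  refine ⟨h.1.add h'.1, (eLpNorm_add_le h.1 h'.1 hp).trans ?_⟩
  rw [ENNReal.ofReal_add ha hb]
  exact add_le_add h.2 h'.2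

theorem const_smul [NormedSpace ℝ E] (h : LpLe P p f a) (c : ℝ) :
    LpLe P p (fun ω => c • f ω) (|c| * a) := by
  refine ⟨h.1.const_smul c, eLpNorm_const_smul_le.trans ?_⟩
  rw [ENNReal.ofReal_mul (abs_nonneg c), ← Real.norm_eq_abs, ofReal_norm]
  gcongr
  exact h.2

theorem const_mul {f : Ω → ℝ} (h : LpLe P p f a) {c : ℝ} (hc : 0 ≤ c) :
    LpLe P p (fun ω => c * f ω) (c * a) := by
  simpa [abs_of_nonneg hc] using h.const_smul c

theorem zero : LpLe P p (fun _ => (0 : E)) a :=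
  ⟨aestronglyMeasurable_const, by simp⟩

theorem sum {ι : Type*} {s : Finset ι} {f : ι → Ω → E} {a : ι → ℝ} (hp : 1 ≤ p)
    (h : ∀ i ∈ s, LpLe P p (f i) (a i)) (ha : ∀ i ∈ s, 0 ≤ a i) :
    LpLe P p (fun ω => ∑ i ∈ s, f i ω) (∑ i ∈ s, a i) := by
  classical
  induction s using Finset.induction_on with
  | empty => simpa using zero (P := P) (p := p) (E := E) (a := 0)
  | insert i s his ih =>
    simp only [Finset.sum_insert his]
    exact (h i (Finset.mem_insert_self _ _)).add
      (ih (fun j hj => h j (Finset.mem_insert_of_mem hj)) fun j hj => ha j (Finset.mem_insert_of_mem hj))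
      hp (ha i (Finset.mem_insert_self _ _))
      (Finset.sum_nonneg fun j hj => ha j (Finset.mem_insert_of_mem hj))

theorem const [IsProbabilityMeasure P] (hp : p ≠ 0) (c : E) : LpLe P p (fun _ => c) ‖c‖ := by
  refine ⟨aestronglyMeasurable_const, ?_⟩
  rw [eLpNorm_const c hp (IsProbabilityMeasure.ne_zero P)]
  simp

theorem of_exponent_le [IsProbabilityMeasure P] {q : ENNReal} (h : LpLe P q f a) (hpq : p ≤ q) :
    LpLe P p f a :=
  ⟨h.1, (eLpNorm_le_eLpNorm_of_exponent_le hpq h.1).trans h.2⟩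

theorem iff_lintegral {n : ℕ} (hn : n ≠ 0) (hf : AEStronglyMeasurable f P) (ha : 0 ≤ a) :
    LpLe P n f a ↔ ∫⁻ ω, ENNReal.ofReal (‖f ω‖ ^ n) ∂P ≤ ENNReal.ofReal (a ^ n) := by
  have h1 := eLpNorm_nnreal_pow_eq_lintegral (f := f) (μ := P) (p := (n : NNReal))
    (by exact_mod_cast hn)
  have h2 : ∫⁻ ω, ENNReal.ofReal (‖f ω‖ ^ n) ∂P = eLpNorm f n P ^ n := by
    simp only [NNReal.coe_natCast, ENNReal.rpow_natCast] at h1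
    rw [ENNReal.coe_natCast] at h1
    rw [h1]
    refine lintegral_congr fun ω => ?_
    rw [ENNReal.ofReal_pow (norm_nonneg _), ofReal_norm]
  rw [h2, ENNReal.ofReal_pow ha, LpLe, and_iff_right hf]
  exact (ENNReal.pow_le_pow_left_iff hn).symm

theorem memLp (h : LpLe P p f a) : MemLp f p P := ⟨h.1, h.2.trans_lt ENNReal.ofReal_lt_top⟩

theorem iff_integral {n : ℕ} (hn : n ≠ 0) (hf : MemLp f n P) (ha : 0 ≤ a) :
    LpLe P n f a ↔ ∫ ω, ‖f ω‖ ^ n ∂P ≤ a ^ n := by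
  rw [iff_lintegral hn hf.1 ha, ← ofReal_integral_eq_lintegral_ofReal (hf.integrable_norm_pow hn)
    (Filter.Eventually.of_forall fun ω => by positivity)]
  exact ENNReal.ofReal_le_ofReal_iff (by positivity)

theorem integrable_norm_sq (h : LpLe P 2 f a) : Integrable (fun ω => ‖f ω‖ ^ 2) P :=
  h.memLp.integrable_norm_pow (p := 2) (by norm_num)

theorem integral_norm_sq_le (h : LpLe P 2 f a) (ha : 0 ≤ a) : ∫ ω, ‖f ω‖ ^ 2 ∂P ≤ a ^ 2 :=
  (iff_integral (n := 2) (by norm_num) h.memLp ha).1 h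

theorem sq (h : LpLe P 4 f a) (ha : 0 ≤ a) : LpLe P 2 (fun ω => ‖f ω‖ ^ 2) (a ^ 2) := by
  have h4 := (iff_lintegral (n := 4) (by norm_num) h.1 ha).1 h
  refine (iff_lintegral (n := 2) (by norm_num) (h.1.norm.pow 2) (by positivity)).2 ?_
  simpa [← pow_mul] using h4

end LpLe

end LpBounds

/-! ### Second and fourth moments of independent sums -/

section Moments

theorem integral_inner_eq_zero {Ω : Type*} [MeasurableSpace Ω] {P : Measure Ω} {E : Type*}
    [NormedAddCommGroup E] [InnerProductSpace ℝ E] [CompleteSpace E] [MeasurableSpace E]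
    [BorelSpace E] {Y Z : Ω → E} (h : IndepFun Y Z P) (hY : Integrable Y P)
    (hZ : Integrable Z P) (h0 : ∫ ω, Z ω ∂P = 0) : ∫ ω, ⟪Y ω, Z ω⟫ ∂P = 0 := by
  have := h.integral_bilin hY hZ (innerSL ℝ)
  rw [h0, map_zero] at this
  exact this

/-- Only the first-order term in y is kept as an inner product: it has mean zero when y is centered
and independent of x. Young's inequality takes care of the rest. -/
theorem norm_add_pow_four_le {E : Type*} [NormedAddCommGroup E] [InnerProductSpace ℝ E] {x y : E} {b : ℝ} (hy : ‖y‖ ≤ b) :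
    ‖x + y‖ ^ 4 ≤ ‖x‖ ^ 4 + 4 * ⟪‖x‖ ^ 2 • x, y⟫ + 8 * b ^ 2 * ‖x‖ ^ 2 + 3 * b ^ 4 := by
  have hb : 0 ≤ b := (norm_nonneg _).trans hy
  have h1 : ‖x + y‖ ^ 4 = (‖x‖ ^ 2 + 2 * ⟪x, y⟫ + ‖y‖ ^ 2) ^ 2 := by
    rw [← norm_add_sq_real]; ring
  rw [h1, inner_smul_left]
  simp only [conj_trivial]
  have hxy : |⟪x, y⟫| ≤ ‖x‖ * b :=
    (abs_real_inner_le_norm x y).trans (by gcongr)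
  have hxy2 : ⟪x, y⟫ ^ 2 ≤ ‖x‖ ^ 2 * b ^ 2 := by
    rw [← sq_abs, ← mul_pow]; gcongr
  have hy2 : ‖y‖ ^ 2 ≤ b ^ 2 := by gcongr
  have hy4 : ‖y‖ ^ 4 ≤ b ^ 4 := by gcongr
  have h5 : ⟪x, y⟫ * ‖y‖ ^ 2 ≤ (‖x‖ ^ 2 * b ^ 2 + b ^ 4) / 2 := by
    calc ⟪x, y⟫ * ‖y‖ ^ 2 ≤ ‖x‖ * b * b ^ 2 :=
          mul_le_mul ((le_abs_self _).trans hxy) hy2 (by positivity) (by positivity)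
      _ ≤ _ := by nlinarith [mul_nonneg (sq_nonneg (‖x‖ - b)) (sq_nonneg b)]
  have h6 : ‖x‖ ^ 2 * ‖y‖ ^ 2 ≤ ‖x‖ ^ 2 * b ^ 2 := by gcongr
  nlinarith

variable {Ω : Type*} [MeasurableSpace Ω] {P : Measure Ω} [IsProbabilityMeasure P]
  {E : Type*} [NormedAddCommGroup E] [InnerProductSpace ℝ E] [CompleteSpace E]
  [MeasurableSpace E] [BorelSpace E] [SecondCountableTopology E]

/-- Second moment of a sum of independent centered random vectors. -/
theorem integral_norm_sum_sq {ι : Type*} (s : Finset ι) {Y : ι → Ω → E}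
    (hY : ∀ i, MemLp (Y i) 2 P) (hind : Pairwise fun i j => IndepFun (Y i) (Y j) P)
    (h0 : ∀ i, ∫ ω, Y i ω ∂P = 0) :
    ∫ ω, ‖∑ i ∈ s, Y i ω‖ ^ 2 ∂P = ∑ i ∈ s, ∫ ω, ‖Y i ω‖ ^ 2 ∂P := by
  classical
  have hi : ∀ i, Integrable (Y i) P := fun i => (hY i).integrable (by norm_num)
  have hij : ∀ i j, Integrable (fun ω => ⟪Y i ω, Y j ω⟫) P := by
    intro i j
    refine (((hY i).integrable_norm_pow (p := 2) (by norm_num)).add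
      ((hY j).integrable_norm_pow (p := 2) (by norm_num))).mono' ((hY i).1.inner (hY j).1)
      (Filter.Eventually.of_forall fun ω => ?_)
    refine (norm_inner_le_norm _ _).trans ?_
    simp only [Pi.add_apply]
    nlinarith [sq_nonneg (‖Y i ω‖ - ‖Y j ω‖), sq_nonneg ‖Y i ω‖, sq_nonneg ‖Y j ω‖]
  have h1 : ∀ ω, ‖∑ i ∈ s, Y i ω‖ ^ 2 = ∑ i ∈ s, ∑ j ∈ s, ⟪Y i ω, Y j ω⟫ := by
    intro ω
    rw [← real_inner_self_eq_norm_sq, sum_inner]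
    simp only [inner_sum]
  simp only [h1]
  rw [integral_finsetSum _ fun i _ => integrable_finsetSum _ fun j _ => hij i j]
  refine Finset.sum_congr rfl fun i hi' => ?_
  rw [integral_finsetSum _ fun j _ => hij i j, Finset.sum_eq_single i]
  · simp only [real_inner_self_eq_norm_sq]
  · intro j _ hne
    exact integral_inner_eq_zero (hind hne.symm) (hi i) (hi j) (h0 j)
  · intro h; exact absurd hi' h

/-- Fourth moment of a sum of independent, centered, bounded random vectors. -/
theorem integral_norm_sum_pow_four_le {ι : Type*} (s : Finset ι) {Y : ι → Ω → E}
    (hm : ∀ i, Measurable (Y i)) (hind : iIndepFun Y P) {b : ℝ} (hb : ∀ i ω, ‖Y i ω‖ ≤ b)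
    (h0 : ∀ i, ∫ ω, Y i ω ∂P = 0) :
    ∫ ω, ‖∑ i ∈ s, Y i ω‖ ^ 4 ∂P ≤ 4 * (s.card : ℝ) ^ 2 * b ^ 4 := by
  classical
  suffices hs : (∫ ω, ‖∑ i ∈ s, Y i ω‖ ^ 2 ∂P ≤ s.card * b ^ 2) ∧
      ∫ ω, ‖∑ i ∈ s, Y i ω‖ ^ 4 ∂P ≤ 4 * (s.card : ℝ) ^ 2 * b ^ 4 from hs.2
  have hbd : ∀ (t : Finset ι) ω, ‖∑ i ∈ t, Y i ω‖ ≤ t.card * b := fun t ω =>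
    (norm_sum_le _ _).trans ((Finset.sum_le_card_nsmul _ _ _ fun i _ => hb i ω).trans
      (by simp))
  have hmS : ∀ t : Finset ι, Measurable fun ω => ∑ i ∈ t, Y i ω := fun t =>
    Finset.measurable_sum t fun i _ => hm i
  have hpow : ∀ (t : Finset ι) (k : ℕ), Integrable (fun ω => ‖∑ i ∈ t, Y i ω‖ ^ k) P := by
    intro t k
    refine Integrable.of_bound ((hmS t).norm.pow_const k).aestronglyMeasurable ((t.card * b) ^ k)
      (Filter.Eventually.of_forall fun ω => ?_)
    rw [norm_pow, norm_norm]
    exact pow_le_pow_left₀ (norm_nonneg _) (hbd t ω) k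
  have hYi : ∀ i, Integrable (Y i) P := fun i =>
    Integrable.of_bound (hm i).aestronglyMeasurable b (Filter.Eventually.of_forall (hb i))
  induction s using Finset.induction_on with
  | empty => simp
  | insert i s his ih =>
    obtain ⟨ih2, ih4⟩ := ih
    set S : Ω → E := fun ω => ∑ j ∈ s, Y j ω with hS
    have hSi : IndepFun S (Y i) P := by
      have := hind.indepFun_finsetSum_of_notMem hm his
      rwa [show (∑ j ∈ s, Y j) = S by ext ω; simp [hS]] at this
    have hSm : Measurable S := hmS s
    have hSint : Integrable S P :=
      Integrable.of_bound hSm.aestronglyMeasurable _ (Filter.Eventually.of_forall (hbd s))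
    have hS3m : Measurable fun ω => ‖S ω‖ ^ 2 • S ω := (hSm.norm.pow_const 2).smul hSm
    have hS3int : Integrable (fun ω => ‖S ω‖ ^ 2 • S ω) P := by
      refine Integrable.of_bound hS3m.aestronglyMeasurable ((s.card * b) ^ 2 * (s.card * b))
        (Filter.Eventually.of_forall fun ω => ?_)
      rw [norm_smul, norm_pow, norm_norm]
      have := hbd s ω
      have h' : 0 ≤ s.card * b := (norm_nonneg _).trans this
      gcongr
    have hS3ind : IndepFun (fun ω => ‖S ω‖ ^ 2 • S ω) (Y i) P :=
      hSi.comp (φ := fun x : E => ‖x‖ ^ 2 • x) (ψ := id) (by fun_prop) measurable_id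
    have hin1 : Integrable (fun ω => ⟪S ω, Y i ω⟫) P :=
      hSi.integrable_bilin hSint (hYi i) (innerSL ℝ)
    have hin3 : Integrable (fun ω => ⟪‖S ω‖ ^ 2 • S ω, Y i ω⟫) P :=
      hS3ind.integrable_bilin hS3int (hYi i) (innerSL ℝ)
    have hz1 := integral_inner_eq_zero hSi hSint (hYi i) (h0 i)
    have hz3 := integral_inner_eq_zero hS3ind hS3int (hYi i) (h0 i)
    have hsum : ∀ ω, ∑ j ∈ insert i s, Y j ω = S ω + Y i ω := fun ω => by
      rw [Finset.sum_insert his, add_comm]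
    have hc : ((insert i s).card : ℝ) = s.card + 1 := by
      rw [Finset.card_insert_of_notMem his]; push_cast; rfl
    have hp2 : Integrable (fun ω => ‖S ω + Y i ω‖ ^ 2) P := by
      simpa only [hsum] using hpow (insert i s) 2
    have hp4 : Integrable (fun ω => ‖S ω + Y i ω‖ ^ 4) P := by
      simpa only [hsum] using hpow (insert i s) 4
    have hS2 : Integrable (fun ω => ‖S ω‖ ^ 2) P := hpow s 2
    have hS4 : Integrable (fun ω => ‖S ω‖ ^ 4) P := hpow s 4
    simp only [hsum, hc]
    constructor
    · have h1 : ∀ ω, ‖S ω + Y i ω‖ ^ 2 ≤ ‖S ω‖ ^ 2 + 2 * ⟪S ω, Y i ω⟫ + b ^ 2 := by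
        intro ω
        rw [norm_add_sq_real]
        have : ‖Y i ω‖ ^ 2 ≤ b ^ 2 := pow_le_pow_left₀ (norm_nonneg _) (hb i ω) 2
        linarith
      have hI : Integrable (fun ω => ‖S ω‖ ^ 2 + 2 * ⟪S ω, Y i ω⟫) P := hS2.add (hin1.const_mul 2)
      refine (integral_mono hp2 (hI.add (integrable_const (b ^ 2))) h1).trans ?_
      simp only [Pi.add_apply]
      rw [integral_add hI (integrable_const _), integral_add hS2 (hin1.const_mul 2),
        integral_const_mul, hz1]
      simp
      linarith
    · have hI1 : Integrable (fun ω => ‖S ω‖ ^ 4 + 4 * ⟪‖S ω‖ ^ 2 • S ω, Y i ω⟫) P :=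
        hS4.add (hin3.const_mul 4)
      have hI2 : Integrable (fun ω => ‖S ω‖ ^ 4 + 4 * ⟪‖S ω‖ ^ 2 • S ω, Y i ω⟫
          + 8 * b ^ 2 * ‖S ω‖ ^ 2) P := hI1.add (hS2.const_mul _)
      refine (integral_mono hp4 (hI2.add (integrable_const (3 * b ^ 4)))
        fun ω => norm_add_pow_four_le (hb i ω)).trans ?_
      simp only [Pi.add_apply]
      rw [integral_add hI2 (integrable_const _), integral_add hI1 (hS2.const_mul _),
        integral_add hS4 (hin3.const_mul 4), integral_const_mul, integral_const_mul, hz3]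
      simp only [mul_zero, add_zero, integral_const, probReal_univ, smul_eq_mul, one_mul]
      -- The induction closes because 4k² + 8k + 3 ≤ 4(k + 1)².
      have : 8 * b ^ 2 * ∫ ω, ‖S ω‖ ^ 2 ∂P ≤ 8 * b ^ 2 * (s.card * b ^ 2) := by gcongr
      nlinarith [sq_nonneg (b ^ 2)]

end Moments

/-! ### Fourth moments of standard Gaussian vectors -/

section GaussianMoments

variable {d : ℕ}

/-- A crude bound suffices: z⁴ ≤ 24(exp z + exp(-z)), whose mean is 48·exp(1/2) ≤ 96. -/
theorem integral_pow_four_gaussianReal_le : ∫ z, z ^ 4 ∂(gaussianReal 0 1) ≤ 96 := by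
  have h1 : ∀ t : ℝ, ∫ z, Real.exp (t * z) ∂(gaussianReal 0 1) = Real.exp (t ^ 2 / 2) := by
    intro t
    have := mgf_gaussianReal (p := gaussianReal 0 1) (X := id) (μ := 0) (v := 1) (by simp) t
    simpa [mgf] using this
  have hi : ∀ t : ℝ, Integrable (fun z => Real.exp (t * z)) (gaussianReal 0 1) := fun t =>
    integrable_exp_mul_gaussianReal t
  have h4 : Integrable (fun z : ℝ => z ^ 4) (gaussianReal 0 1) := by
    have := (memLp_id_gaussianReal (μ := 0) (v := 1) 4).integrable_norm_pow (p := 4) (by norm_num)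
    refine this.congr (Filter.Eventually.of_forall fun z => ?_)
    simp only [id, Real.norm_eq_abs]
    exact Even.pow_abs (by decide) z
  have hle : ∀ z : ℝ, z ^ 4 ≤ 24 * Real.exp (1 * z) + 24 * Real.exp (-1 * z) := by
    intro z
    have h2 := Real.pow_div_factorial_le_exp |z| (abs_nonneg z) 4
    have h3 : |z| ^ 4 = z ^ 4 := Even.pow_abs (by decide) z
    have h24 : ((Nat.factorial 4 : ℕ) : ℝ) = 24 := by norm_num [Nat.factorial]
    rw [h3, h24] at h2
    have h4 := Real.exp_pos (1 * z)
    have h5 := Real.exp_pos (-1 * z)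
    rcases abs_cases z with ⟨h, _⟩ | ⟨h, _⟩
    · rw [h] at h2
      rw [one_mul] at *
      linarith
    · rw [h] at h2
      rw [neg_one_mul] at *
      linarith
  refine (integral_mono h4 (((hi 1).const_mul 24).add ((hi (-1)).const_mul 24)) hle).trans ?_
  simp only [Pi.add_apply]
  rw [integral_add ((hi 1).const_mul 24) ((hi (-1)).const_mul 24), integral_const_mul,
    integral_const_mul, h1, h1]
  have : Real.exp (1 / 2) ≤ 2 := by
    have h6 : Real.exp (1 / 2) ^ 2 = Real.exp 1 := by rw [← Real.exp_nat_mul]; norm_num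
    have h7 := Real.exp_one_lt_d9
    nlinarith [Real.exp_pos (1 / 2)]
  norm_num at this ⊢
  linarith

theorem norm_pow_four_le (x : Vec d) : ‖x‖ ^ 4 ≤ d * ∑ a, x a ^ 4 := by
  have h1 : ‖x‖ ^ 4 = (∑ a, x a ^ 2) ^ 2 := by
    rw [show ‖x‖ ^ 4 = (‖x‖ ^ 2) ^ 2 by ring, EuclideanSpace.real_norm_sq_eq]
  rw [h1]
  have := sq_sum_le_card_mul_sum_sq (s := Finset.univ) (f := fun a => x a ^ 2)
  simpa [← pow_mul] using this

theorem lpLe_four_stdGaussian : LpLe (stdGaussian (Vec d)) 4 (fun z => z) (4 * Real.sqrt d) := by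
  have hmem : MemLp (fun z : Vec d => z) 4 (stdGaussian (Vec d)) :=
    IsGaussian.memLp_id (stdGaussian (Vec d)) 4 (by norm_num)
  have hcoord : ∀ a : Fin d, (stdGaussian (Vec d)).map (fun z => z a) = gaussianReal 0 1 := by
    intro a
    have h1 := IsGaussian.map_eq_gaussianReal (μ := stdGaussian (Vec d))
      (innerSL ℝ (EuclideanSpace.single a (1 : ℝ)))
    rw [integral_strongDual_stdGaussian, variance_dual_stdGaussian] at h1
    convert! h1 using 2
    · funext z
      simp [EuclideanSpace.inner_single_left]
    · simp
  have hm : ∀ a : Fin d, Measurable fun z : Vec d => z a := fun a => by fun_prop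
  have h4i : Integrable (fun z : ℝ => z ^ 4) (gaussianReal 0 1) := by
    have := (memLp_id_gaussianReal (μ := 0) (v := 1) 4).integrable_norm_pow (p := 4) (by norm_num)
    refine this.congr (Filter.Eventually.of_forall fun z => ?_)
    simp only [id, Real.norm_eq_abs]
    exact Even.pow_abs (by decide) z
  have hci : ∀ a : Fin d, Integrable (fun z : Vec d => z a ^ 4) (stdGaussian (Vec d)) := by
    intro a
    rw [← hcoord a] at h4i
    exact h4i.comp_measurable (hm a)
  have hc : ∀ a : Fin d, ∫ z, z a ^ 4 ∂(stdGaussian (Vec d)) ≤ 96 := by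
    intro a
    have := integral_pow_four_gaussianReal_le
    rw [← hcoord a, integral_map (hm a).aemeasurable (by fun_prop)] at this
    exact this
  refine (LpLe.iff_integral (n := 4) (by norm_num) hmem (by positivity)).2 ?_
  have hs : Integrable (fun z : Vec d => (d : ℝ) * ∑ a, z a ^ 4) (stdGaussian (Vec d)) :=
    (integrable_finsetSum _ fun a _ => hci a).const_mul _
  refine (integral_mono (hmem.integrable_norm_pow (p := 4) (by norm_num)) hs
    fun z => norm_pow_four_le z).trans ?_
  rw [integral_const_mul, integral_finsetSum _ fun a _ => hci a]
  have h5 : ∑ a : Fin d, ∫ z, z a ^ 4 ∂(stdGaussian (Vec d)) ≤ d * 96 :=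
    (Finset.sum_le_sum fun a _ => hc a).trans (by simp)
  have h6 : (4 * Real.sqrt d) ^ 4 = 256 * (d : ℝ) ^ 2 := by
    rw [mul_pow, show Real.sqrt d ^ 4 = (Real.sqrt d ^ 2) ^ 2 by ring, Real.sq_sqrt (by positivity)]
    norm_num
  rw [h6]
  have hd : (0 : ℝ) ≤ d := by positivity
  nlinarith [mul_le_mul_of_nonneg_left h5 hd, sq_nonneg (d : ℝ)]

end GaussianMoments

/-- The constant in the fourth-moment bound for the uniform deviation of an empirical gradient. -/
def gradConst (τ₁ τ₂ C₁ : ℝ) : ℝ :=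
  Real.sqrt (32 * Real.sqrt (unifConst (2 * τ₂) (τ₁ / 2))) * C₁

theorem integral_comp_of_law {𝒳 Ω E : Type*} [MeasurableSpace 𝒳] [MeasurableSpace Ω]
    [NormedAddCommGroup E] [NormedSpace ℝ E] [MeasurableSpace E] [BorelSpace E]
    [SecondCountableTopology E] {P : Measure Ω} {F : Measure 𝒳}
    {X : Ω → 𝒳} (hX : Measurable X) (hlaw : P.map X = F) {g : 𝒳 → E} (hg : Measurable g) :
    ∫ ω, g (X ω) ∂P = ∫ x, g x ∂F := by
  rw [← hlaw, integral_map hX.aemeasurable hg.aestronglyMeasurable]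

/-! ### Empirical gradients and Hessians of an i.i.d. sample -/

namespace RegularProblem

variable {d : ℕ} {𝒳 Ω : Type*} [MeasurableSpace 𝒳] [MeasurableSpace Ω] {P : Measure Ω}
  [IsProbabilityMeasure P] {F : Measure 𝒳} [IsProbabilityMeasure F]
  {ρ : 𝒳 → Vec d → ℝ} {Θ : Set (Vec d)} {θ₀ : Vec d} {τ₁ τ₂ W C₁ C₂ : ℝ}
  {ι : Type*} [Fintype ι] {X : ι → Ω → 𝒳}
  (h : RegularProblem F ρ Θ θ₀ τ₁ τ₂ W C₁ C₂)
include h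

/-- In the direction u/‖u‖ the summands are independent and sub-Gaussian, so their variance proxies
add; the moment generating function of the sum is then taken at ‖u‖. -/
theorem lintegral_exp_inner_sum_dev_le (hC₁ : 0 < C₁) (hX : ∀ j, Measurable (X j))
    (hlaw : ∀ j, P.map (X j) = F) (hind : iIndepFun X P) (θ u : Vec d) :
    ∫⁻ ω, ENNReal.ofReal (Real.exp ⟪u, ∑ j, (grad ρ (X j ω) θ - popGrad F ρ θ)⟫) ∂P
      ≤ ENNReal.ofReal (Real.exp ((Fintype.card ι * (8 * C₁ ^ 2)) * ‖u‖ ^ 2 / 2)) := by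
  rcases eq_or_ne u 0 with rfl | hu
  · simp
  have hu' : 0 < ‖u‖ := norm_pos_iff.2 hu
  set v : Vec d := ‖u‖⁻¹ • u with hv
  have hv1 : ‖v‖ = 1 := by rw [hv, norm_smul, norm_inv, norm_norm, inv_mul_cancel₀ hu'.ne']
  have huv : u = ‖u‖ • v := by rw [hv, smul_smul, mul_inv_cancel₀ hu'.ne', one_smul]
  have hsub : ∀ j ∈ Finset.univ, HasSubgaussianMGF
      (fun ω => ⟪v, grad ρ (X j ω) θ - popGrad F ρ θ⟫) (Real.toNNReal (8 * C₁ ^ 2)) P := by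
    intro j _
    refine HasSubgaussianMGF.of_map (Y := X j)
      (X := fun x => ⟪v, grad ρ x θ - popGrad F ρ θ⟫) (hX j).aemeasurable ?_
    rw [hlaw j]
    exact h.hasSubgaussianMGF_dev hC₁ θ hv1
  have hind' : iIndepFun (fun j ω => ⟪v, grad ρ (X j ω) θ - popGrad F ρ θ⟫) P :=
    hind.comp (fun _ x => ⟪v, grad ρ x θ - popGrad F ρ θ⟫) fun _ => h.measurable_inner_dev θ v
  have hS := HasSubgaussianMGF.sum_of_iIndepFun hind' hsub
  have h1 := hS.mgf_le ‖u‖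
  have h2 := hS.integrable_exp_mul ‖u‖
  rw [mgf] at h1
  have h3 : ∀ ω, ‖u‖ * ∑ j, ⟪v, grad ρ (X j ω) θ - popGrad F ρ θ⟫
      = ⟪u, ∑ j, (grad ρ (X j ω) θ - popGrad F ρ θ)⟫ := by
    intro ω
    rw [← inner_sum]
    conv_rhs => rw [huv, inner_smul_left]
    simp
  simp only [h3] at h1 h2
  rw [← ofReal_integral_eq_lintegral_ofReal h2
    (Filter.Eventually.of_forall fun ω => Real.exp_nonneg _)]
  refine ENNReal.ofReal_le_ofReal (h1.trans (le_of_eq ?_))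
  congr 2
  simp only [Finset.sum_const, Finset.card_univ, nsmul_eq_mul, NNReal.coe_mul,
    NNReal.coe_natCast, Real.coe_toNNReal _ (show 0 ≤ 8 * C₁ ^ 2 by positivity)]

/-- Uniform deviation bound for the empirical gradient of an i.i.d. sample. -/
theorem exists_grad_bound (hd : 1 ≤ d) (hτ₁ : 0 < τ₁) (hτ₂ : 0 < τ₂) (hC₁ : 0 < C₁)
    [Nonempty ι] (hX : ∀ j, Measurable (X j))
    (hlaw : ∀ j, P.map (X j) = F) (hind : iIndepFun X P) :
    ∃ Ξ : Ω → ℝ, (∀ ω, 0 ≤ Ξ ω) ∧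
      LpLe P 4 Ξ (gradConst τ₁ τ₂ C₁ * Real.sqrt (d / Fintype.card ι)) ∧
      ∀ᵐ ω ∂P, ∀ θ, ‖(1 / (Fintype.card ι : ℝ)) • ∑ j, grad ρ (X j ω) θ - popGrad F ρ θ‖
        ≤ τ₁ / 2 * ‖θ - θ₀‖ + Ξ ω := by
  set k : ℝ := (Fintype.card ι : ℝ) with hk
  have hk0 : 0 < k := by rw [hk]; exact_mod_cast Fintype.card_pos
  set ξ : Ω → Vec d → Vec d := fun ω θ => (1 / k) • ∑ j, (grad ρ (X j ω) θ - popGrad F ρ θ) with hξ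
  have hξeq : ∀ ω θ, (1 / k) • ∑ j, grad ρ (X j ω) θ - popGrad F ρ θ = ξ ω θ := by
    intro ω θ
    simp only [hξ, Finset.sum_sub_distrib, smul_sub, Finset.sum_const, Finset.card_univ]
    rw [← Nat.cast_smul_eq_nsmul ℝ, smul_smul, ← hk, one_div_mul_cancel hk0.ne', one_smul]
  have hpc : Continuous (popGrad F ρ) := by
    rw [continuous_iff_continuousAt]
    exact fun θ => (h.hasFDerivAt_popGrad hd hτ₁ hC₁ θ).continuousAt
  have hξm : Measurable fun p : Ω × Vec d => ξ p.1 p.2 := by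
    simp only [hξ]
    refine Measurable.const_smul (Finset.measurable_sum _ fun j _ => ?_) (1 / k)
    refine Measurable.sub ?_ (hpc.measurable.comp measurable_snd)
    exact h.measurable_uncurry_grad.comp (((hX j).comp measurable_fst).prodMk measurable_snd)
  have hlip : ∀ ω θ θ', ‖ξ ω θ - ξ ω θ'‖ ≤ (2 * τ₂) * ‖θ - θ'‖ := by
    intro ω θ θ'
    simp only [hξ]
    rw [← smul_sub, ← Finset.sum_sub_distrib, norm_smul, Real.norm_of_nonneg (by positivity)]
    have h1 : ‖∑ j, (grad ρ (X j ω) θ - popGrad F ρ θ - (grad ρ (X j ω) θ' - popGrad F ρ θ'))‖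
        ≤ k * ((2 * τ₂) * ‖θ - θ'‖) := by
      refine (norm_sum_le_of_le _ (f := fun j => grad ρ (X j ω) θ - popGrad F ρ θ
        - (grad ρ (X j ω) θ' - popGrad F ρ θ')) (n := fun _ => (2 * τ₂) * ‖θ - θ'‖)
        fun j _ => ?_).trans (le_of_eq (by simp [hk]))
      have h2 := h.norm_grad_sub_le (X j ω) θ θ'
      have h3 := h.norm_popGrad_sub_le hC₁ θ θ'
      have h4 : grad ρ (X j ω) θ - popGrad F ρ θ - (grad ρ (X j ω) θ' - popGrad F ρ θ')
        = (grad ρ (X j ω) θ - grad ρ (X j ω) θ') - (popGrad F ρ θ - popGrad F ρ θ') := by abel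
      rw [h4]
      exact (norm_sub_le _ _).trans (by linarith)
    calc _ ≤ 1 / k * (k * ((2 * τ₂) * ‖θ - θ'‖)) := by gcongr
      _ = _ := by field_simp
  have hs : 0 < k * (8 * C₁ ^ 2) := by positivity
  have hν : 0 < k / (32 * C₁ ^ 2) := by positivity
  -- The field is 2τ₂-Lipschitz, and the slope τ₁/2 is half of the contraction rate. The sum has
  -- variance proxy s = 8kC₁², and ν = k²/(4s) after dividing the sum by k.
  obtain ⟨Ξ, hm, h0, hbd, h4⟩ := exists_uniform_bound (P := P) hd hξm (L := 2 * τ₂) (τ := τ₁ / 2)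
    (ν := k / (32 * C₁ ^ 2)) (by positivity) (by positivity) hν hlip (fun θ => by
      have hYm : Measurable fun ω => ∑ j, (grad ρ (X j ω) θ - popGrad F ρ θ) :=
        Finset.measurable_sum _ fun j _ => ((h.measurable_grad θ).comp (hX j)).sub_const _
      have h1 := lintegral_exp_sq_norm_le (P := P) hYm hs
        (h.lintegral_exp_inner_sum_dev_le hC₁ hX hlaw hind θ)
      refine le_trans (le_of_eq (lintegral_congr fun ω => ?_)) h1
      simp only [hξ, norm_smul, mul_pow, Real.norm_eq_abs, sq_abs]
      congr 2
      field_simp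
      ring) θ₀
  refine ⟨Ξ, h0, ?_, ?_⟩
  · have hU : 0 ≤ unifConst (2 * τ₂) (τ₁ / 2) := by
      unfold unifConst; positivity
    refine (LpLe.iff_lintegral (n := 4) (by norm_num) hm.aestronglyMeasurable
      (by unfold gradConst; positivity)).2 ?_
    simp only [Real.norm_of_nonneg (h0 _)]
    refine h4.trans (ENNReal.ofReal_le_ofReal (le_of_eq ?_))
    have e4 : ∀ x : ℝ, x ^ 4 = (x ^ 2) ^ 2 := fun x => by ring
    rw [gradConst, mul_pow, mul_pow, e4, Real.sq_sqrt (by positivity), mul_pow, Real.sq_sqrt hU,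
      e4 (Real.sqrt _), Real.sq_sqrt (by positivity)]
    field_simp
  · filter_upwards [hbd] with ω hω θ
    rw [hξeq]
    exact hω θ

theorem integrable_hess_apply (hd : 1 ≤ d) (hτ₁ : 0 < τ₁) (θ v : Vec d) :
    Integrable (fun x => hess ρ x θ v) F :=
  (h.integrable_hess hd hτ₁ θ).apply_continuousLinearMap v

/-- Deviation bound for the empirical Hessian at a point. -/
theorem exists_hess_bound (hd : 1 ≤ d) (hτ₁ : 0 < τ₁) (hτ₂ : 0 < τ₂) [Nonempty ι]
    (hX : ∀ j, Measurable (X j)) (hlaw : ∀ j, P.map (X j) = F) (hind : iIndepFun X P)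
    (θ : Vec d) :
    ∃ M : Ω → ℝ, (∀ ω, 0 ≤ M ω) ∧ LpLe P 4 M (3 * τ₂ * Real.sqrt (d / Fintype.card ι)) ∧
      ∀ ω v, ‖(1 / (Fintype.card ι : ℝ)) • ∑ j, hess ρ (X j ω) θ v - popHess F ρ θ v‖
        ≤ M ω * ‖v‖ := by
  set k : ℝ := (Fintype.card ι : ℝ) with hk
  have hk0 : 0 < k := by rw [hk]; exact_mod_cast Fintype.card_pos
  set e : Fin d → Vec d := fun a => EuclideanSpace.single a 1 with he
  have he1 : ∀ a, ‖e a‖ = 1 := fun a => by simp [he]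
  set Y : Fin d → ι → Ω → Vec d := fun a j ω => hess ρ (X j ω) θ (e a) - popHess F ρ θ (e a) with hY
  have hYm : ∀ a j, Measurable (Y a j) := fun a j =>
    ((h.measurable_hess_apply θ (e a)).comp (hX j)).sub_const _
  have hYb : ∀ a j ω, ‖Y a j ω‖ ≤ 2 * τ₂ := by
    intro a j ω
    have h1 := (hess ρ (X j ω) θ).le_of_opNorm_le (h.bounded_hess _ θ) (e a)
    have h2 := (popHess F ρ θ).le_of_opNorm_le (h.norm_popHess_le θ) (e a)
    rw [he1, mul_one] at h1 h2
    exact (norm_sub_le _ _).trans (by linarith)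
  have hY0 : ∀ a j, ∫ ω, Y a j ω ∂P = 0 := by
    intro a j
    have hg : Measurable fun x => hess ρ x θ (e a) - popHess F ρ θ (e a) :=
      (h.measurable_hess_apply θ (e a)).sub_const _
    have h1 : ∫ ω, Y a j ω ∂P = ∫ x, (hess ρ x θ (e a) - popHess F ρ θ (e a)) ∂F :=
      integral_comp_of_law (hX j) (hlaw j) hg
    rw [h1, integral_sub (h.integrable_hess_apply hd hτ₁ θ _) (integrable_const _),
      h.popHess_apply hd hτ₁]
    simp
  have hYi : ∀ a, iIndepFun (Y a) P := fun a =>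
    hind.comp (fun _ x => hess ρ x θ (e a) - popHess F ρ θ (e a))
      fun _ => (h.measurable_hess_apply θ (e a)).sub_const _
  set S : Fin d → Ω → Vec d := fun a ω => (1 / k) • ∑ j, Y a j ω with hS
  have hSm : ∀ a, Measurable (S a) := fun a =>
    (Finset.measurable_sum _ fun j _ => hYm a j).const_smul (1 / k)
  have hSb : ∀ a ω, ‖S a ω‖ ≤ 2 * τ₂ := by
    intro a ω
    simp only [hS, norm_smul]
    rw [Real.norm_of_nonneg (by positivity)]
    have : ‖∑ j, Y a j ω‖ ≤ k * (2 * τ₂) :=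
      (norm_sum_le_of_le _ fun j _ => hYb a j ω).trans (le_of_eq (by simp [hk]))
    calc _ ≤ 1 / k * (k * (2 * τ₂)) := by gcongr
      _ = _ := by field_simp
  have hS4i : ∀ a, Integrable (fun ω => ‖S a ω‖ ^ 4) P := fun a =>
    Integrable.of_bound ((hSm a).norm.pow_const 4).aestronglyMeasurable ((2 * τ₂) ^ 4)
      (Filter.Eventually.of_forall fun ω => by
        rw [norm_pow, norm_norm]
        exact pow_le_pow_left₀ (norm_nonneg _) (hSb a ω) 4)
  have hS4 : ∀ a, ∫ ω, ‖S a ω‖ ^ 4 ∂P ≤ 64 * τ₂ ^ 4 / k ^ 2 := by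
    intro a
    have h1 := integral_norm_sum_pow_four_le (P := P) Finset.univ (hYm a) (hYi a) (hYb a) (hY0 a)
    have h2 : ∀ ω, ‖S a ω‖ ^ 4 = (1 / k) ^ 4 * ‖∑ j, Y a j ω‖ ^ 4 := fun ω => by
      simp only [hS, norm_smul, mul_pow]
      rw [Real.norm_of_nonneg (by positivity)]
    simp only [h2, integral_const_mul]
    rw [Finset.card_univ, ← hk] at h1
    calc _ ≤ (1 / k) ^ 4 * (4 * k ^ 2 * (2 * τ₂) ^ 4) := by gcongr
      _ = _ := by field_simp; ring
  -- The witness is the Frobenius norm of the Hessian deviation, whose columns S a are means of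
  -- independent, centered vectors of norm at most 2τ₂. It dominates the operator norm, and one
  -- factor d in its fourth power comes from Cauchy–Schwarz over the columns.
  have hMm : Measurable fun ω => Real.sqrt (∑ a, ‖S a ω‖ ^ 2) :=
    (Finset.measurable_sum _ fun a _ => (hSm a).norm.pow_const 2).sqrt
  have hM4 : ∀ ω, Real.sqrt (∑ a, ‖S a ω‖ ^ 2) ^ 4 ≤ d * ∑ a, ‖S a ω‖ ^ 4 := by
    intro ω
    rw [show ∀ x : ℝ, x ^ 4 = (x ^ 2) ^ 2 from fun x => by ring,
      Real.sq_sqrt (Finset.sum_nonneg fun a _ => by positivity)]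
    have := sq_sum_le_card_mul_sum_sq (s := Finset.univ) (f := fun a => ‖S a ω‖ ^ 2)
    simpa [← pow_mul] using this
  refine ⟨fun ω => Real.sqrt (∑ a, ‖S a ω‖ ^ 2), fun ω => Real.sqrt_nonneg _, ?_, ?_⟩
  · refine (LpLe.iff_lintegral (n := 4) (by norm_num) hMm.aestronglyMeasurable (by positivity)).2 ?_
    have hi : Integrable (fun ω => (d : ℝ) * ∑ a, ‖S a ω‖ ^ 4) P :=
      (integrable_finsetSum _ fun a _ => hS4i a).const_mul _
    calc _ ≤ ∫⁻ ω, ENNReal.ofReal (d * ∑ a, ‖S a ω‖ ^ 4) ∂P := by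
          refine lintegral_mono fun ω => ENNReal.ofReal_le_ofReal ?_
          rw [Real.norm_of_nonneg (Real.sqrt_nonneg _)]
          exact hM4 ω
      _ = ENNReal.ofReal (∫ ω, d * ∑ a, ‖S a ω‖ ^ 4 ∂P) := by
          rw [ofReal_integral_eq_lintegral_ofReal hi
            (Filter.Eventually.of_forall fun ω => by positivity)]
      _ ≤ _ := by
          refine ENNReal.ofReal_le_ofReal ?_
          rw [integral_const_mul, integral_finsetSum _ fun a _ => hS4i a]
          have h1 : ∑ a, ∫ ω, ‖S a ω‖ ^ 4 ∂P ≤ d * (64 * τ₂ ^ 4 / k ^ 2) :=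
            (Finset.sum_le_sum fun a _ => hS4 a).trans (by simp)
          have h2 : (3 * τ₂ * Real.sqrt (d / k)) ^ 4 = 81 * τ₂ ^ 4 * (d / k) ^ 2 := by
            rw [mul_pow, show Real.sqrt (d / k) ^ 4 = (Real.sqrt (d / k) ^ 2) ^ 2 by ring,
              Real.sq_sqrt (by positivity)]
            ring
          rw [h2]
          calc (d : ℝ) * ∑ a, ∫ ω, ‖S a ω‖ ^ 4 ∂P ≤ d * (d * (64 * τ₂ ^ 4 / k ^ 2)) := by gcongr
            _ = 64 * τ₂ ^ 4 * (d / k) ^ 2 := by field_simp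
            _ ≤ _ := by gcongr; norm_num
  · intro ω v
    have hv : v = ∑ a, v a • e a := by
      have := (EuclideanSpace.basisFun (Fin d) ℝ).sum_repr v
      simpa [he] using this.symm
    have hlin : (1 / k) • ∑ j, hess ρ (X j ω) θ v - popHess F ρ θ v = ∑ a, v a • S a ω := by
      have h1 : ∀ T : Vec d →L[ℝ] Vec d, T v = ∑ a, v a • T (e a) := by
        intro T
        conv_lhs => rw [hv]
        simp
      simp only [hS, hY, Finset.sum_sub_distrib, smul_sub, Finset.sum_const, Finset.card_univ]
      simp only [← Nat.cast_smul_eq_nsmul ℝ, ← hk]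
      have h2 : ∀ a, v a • (1 / k) • k • popHess F ρ θ (e a) = v a • popHess F ρ θ (e a) := by
        intro a
        rw [smul_smul (1 / k), one_div_mul_cancel hk0.ne', one_smul]
      simp only [h2]
      rw [h1 (popHess F ρ θ)]
      congr 1
      simp only [h1 (hess ρ _ θ), Finset.smul_sum]
      rw [Finset.sum_comm]
      refine Finset.sum_congr rfl fun a _ => Finset.sum_congr rfl fun j _ => ?_
      rw [smul_comm]
    rw [hlin]
    refine (norm_sum_le _ _).trans ?_
    simp only [norm_smul]
    have hcs := Real.sum_mul_le_sqrt_mul_sqrt Finset.univ (fun a => ‖v a‖) (fun a => ‖S a ω‖)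
    rw [mul_comm, EuclideanSpace.norm_eq v]
    exact hcs

theorem memLp_grad (hC₁ : 0 < C₁) (θ : Vec d) : MemLp (fun x => grad ρ x θ) 2 F := by
  have h1 : MemLp (fun x => grad ρ x θ - popGrad F ρ θ) 2 F := by
    have : (fun x => grad ρ x θ - popGrad F ρ θ) = fun x =>
        ∑ a, ⟪EuclideanSpace.single a (1 : ℝ), grad ρ x θ - popGrad F ρ θ⟫ •
          EuclideanSpace.single a (1 : ℝ) := by
      funext x
      have := (EuclideanSpace.basisFun (Fin d) ℝ).sum_repr' (grad ρ x θ - popGrad F ρ θ)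
      simpa using this.symm
    rw [this]
    refine memLp_finsetSum _ fun a _ => ?_
    have h2 : MemLp (fun x => ⟪EuclideanSpace.single a (1 : ℝ), grad ρ x θ - popGrad F ρ θ⟫) 2 F := by
      have := (h.hasSubgaussianMGF_dev hC₁ θ (v := EuclideanSpace.single a (1 : ℝ)) (by simp)).memLp 2
      exact_mod_cast this
    exact ((ContinuousLinearMap.id ℝ ℝ).smulRight
      (EuclideanSpace.single a (1 : ℝ) : Vec d)).comp_memLp' h2
  convert! h1.add (memLp_const (popGrad F ρ θ)) using 2 with x
  simp

/-- The mean gradient vanishes at θ₀, so the covariance there needs no centering. -/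
theorem trace_gradCov_target (hC₁ : 0 < C₁) :
    (gradCov F ρ θ₀).trace = ∫ x, ‖grad ρ x θ₀‖ ^ 2 ∂F := by
  have h0 : ∀ a, ∫ x, grad ρ x θ₀ a ∂F = 0 := by
    intro a
    have h1 : (popGrad F ρ θ₀) a = ∫ x, grad ρ x θ₀ a ∂F :=
      ((EuclideanSpace.proj a : Vec d →L[ℝ] ℝ).integral_comp_comm (h.integrable_grad hC₁ θ₀)).symm
    rw [← h1, h.popGrad_target hC₁]
    rfl
  have hmem : ∀ a, MemLp (fun x => grad ρ x θ₀ a) 2 F := fun a =>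
    (EuclideanSpace.proj a : Vec d →L[ℝ] ℝ).comp_memLp' (h.memLp_grad hC₁ θ₀)
  have hi : ∀ a, Integrable (fun x => (grad ρ x θ₀ a) ^ 2) F := fun a => (hmem a).integrable_sq
  simp only [EuclideanSpace.real_norm_sq_eq]
  rw [integral_finsetSum _ fun a _ => hi a, Matrix.trace]
  refine Finset.sum_congr rfl fun a _ => ?_
  simp only [gradCov, Matrix.diag_apply, Matrix.of_apply, covariance, h0, sub_zero, sq]

/-- Second moment of the empirical gradient of an i.i.d. sample at the target. -/
theorem lpLe_sum_grad_target (hC₁ : 0 < C₁) (hX : ∀ j, Measurable (X j))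
    (hlaw : ∀ j, P.map (X j) = F) (hind : iIndepFun X P) :
    LpLe P 2 (fun ω => ∑ j, grad ρ (X j ω) θ₀)
      (Real.sqrt (Fintype.card ι * (gradCov F ρ θ₀).trace)) := by
  rw [h.trace_gradCov_target hC₁]
  have hgm := h.measurable_grad θ₀
  have hmem : ∀ j, MemLp (fun ω => grad ρ (X j ω) θ₀) 2 P := fun j =>
    (h.memLp_grad hC₁ θ₀).comp_measurePreserving ⟨hX j, hlaw j⟩
  have h1 : ∀ j, ∫ ω, ‖grad ρ (X j ω) θ₀‖ ^ 2 ∂P = ∫ x, ‖grad ρ x θ₀‖ ^ 2 ∂F := fun j =>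
    integral_comp_of_law (hX j) (hlaw j) (hgm.norm.pow_const 2)
  have h2 : ∀ j, ∫ ω, grad ρ (X j ω) θ₀ ∂P = 0 := fun j =>
    (integral_comp_of_law (hX j) (hlaw j) hgm).trans (h.popGrad_target hC₁)
  have hind' : Pairwise fun i j =>
      IndepFun (fun ω => grad ρ (X i ω) θ₀) (fun ω => grad ρ (X j ω) θ₀) P := fun i j hij =>
    (hind.comp (fun _ x => grad ρ x θ₀) fun _ => hgm).indepFun hij
  have htr : 0 ≤ ∫ x, ‖grad ρ x θ₀‖ ^ 2 ∂F := integral_nonneg fun x => by positivity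
  have h3 := integral_norm_sum_sq (P := P) Finset.univ hmem hind' h2
  simp only [h1] at h3
  have hsum : MemLp (fun ω => ∑ j, grad ρ (X j ω) θ₀) 2 P := memLp_finsetSum _ fun j _ => hmem j
  refine (LpLe.iff_integral (n := 2) (by norm_num) hsum (Real.sqrt_nonneg _)).2 ?_
  rw [Real.sq_sqrt (mul_nonneg (Nat.cast_nonneg _) htr), h3]
  simp

end RegularProblem

/-! ### Linear recursions driven by a source -/

section LinearRecursion

variable {E : Type*} [NormedAddCommGroup E] [NormedSpace ℝ E]

/-- The solution of the recursion `v (t + 1) = A (v t) + u t` with `v 0 = 0`. -/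
def linRec (A : E →L[ℝ] E) (u : ℕ → E) : ℕ → E
  | 0 => 0
  | t + 1 => A (linRec A u t) + u t

/-- The bound ‖x‖/τ is the fixed point of r ↦ (1 - ητ)r + η‖x‖, hence is preserved by every step. -/
theorem norm_linRec_const_le {A : E →L[ℝ] E} {η τ : ℝ} (hτ : 0 < τ) (hA : ‖A‖ ≤ 1 - η * τ)
    (hη : 0 ≤ η) (x : E) (t : ℕ) : ‖linRec A (fun _ => η • x) t‖ ≤ 1 / τ * ‖x‖ := by
  induction t with
  | zero => simp only [linRec, norm_zero]; positivity
  | succ t ih =>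
    have h0 : 0 ≤ 1 - η * τ := (norm_nonneg A).trans hA
    have h1 := A.le_of_opNorm_le hA (linRec A (fun _ => η • x) t)
    have h2 : ‖η • x‖ = η * ‖x‖ := by rw [norm_smul, Real.norm_of_nonneg hη]
    calc ‖linRec A (fun _ => η • x) (t + 1)‖
        ≤ ‖A (linRec A (fun _ => η • x) t)‖ + ‖η • x‖ := norm_add_le _ _
      _ ≤ (1 - η * τ) * (1 / τ * ‖x‖) + η * ‖x‖ := by
          rw [h2]
          gcongr
          exact h1.trans (by gcongr)
      _ = 1 / τ * ‖x‖ := by field_simp; ring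

theorem linRec_eq_sum (A : E →L[ℝ] E) (u : ℕ → E) (t : ℕ) :
    linRec A u t = ∑ s ∈ Finset.range t, (A ^ (t - 1 - s)) (u s) := by
  induction t with
  | zero => simp [linRec]
  | succ t ih =>
    rw [linRec, ih, Finset.sum_range_succ, map_sum]
    congr 1
    · refine Finset.sum_congr rfl fun s hs => ?_
      have : t + 1 - 1 - s = (t - 1 - s) + 1 := by
        have := Finset.mem_range.1 hs
        omega
      rw [this, pow_succ']
      rfl
    · simp

end LinearRecursion

/-! ### Accumulated privacy noise -/

section Noise

variable {d m : ℕ} {𝒳 Ω : Type*} [MeasurableSpace 𝒳] [MeasurableSpace Ω] {P : Measure Ω}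
  {F : Measure 𝒳} {n : Fin m → ℕ}
  {X : (i : Fin m) → Fin (n i) → Ω → 𝒳} {Z : ℕ → Fin m → ℕ → Ω → Vec d}

namespace IsSample

theorem lpLe_noise (hS : IsSample P F X Z) (r : ℕ) (i : Fin m) (t : ℕ) :
    LpLe P 4 (Z r i t) (4 * Real.sqrt d) := by
  have hmp : MeasurePreserving (Z r i t) P (stdGaussian (Vec d)) :=
    ⟨hS.measurable_noise r i t, hS.law_noise r i t⟩
  have h1 := lpLe_four_stdGaussian (d := d)
  refine ⟨(hS.measurable_noise r i t).aestronglyMeasurable, ?_⟩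
  have := eLpNorm_comp_measurePreserving (p := 4) h1.1 hmp
  exact (le_of_eq this).trans h1.2

/-- Second moment of the accumulated noise of one round. -/
theorem lpLe_linRec_noise [IsProbabilityMeasure P] (hS : IsSample P F X Z) {A : Vec d →L[ℝ] Vec d} {a : ℝ} (ha1 : a < 1)
    (hA : ‖A‖ ≤ a) (s : Fin m → ℝ) (r K : ℕ) :
    LpLe P 2 (fun ω => linRec A (fun t => ∑ i, s i • Z r i t ω) K)
      (Real.sqrt (16 * d * (∑ i, s i ^ 2) / (1 - a))) := by
  have ha0 : 0 ≤ a := (norm_nonneg A).trans hA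
  set B : Fin m × ℕ → Vec d →L[ℝ] Vec d := fun p => s p.1 • A ^ (K - 1 - p.2) with hB
  set Y : Fin m × ℕ → Ω → Vec d := fun p ω => B p (Z r p.1 p.2 ω) with hY
  have hYeq : ∀ ω, linRec A (fun t => ∑ i, s i • Z r i t ω) K
      = ∑ p ∈ Finset.univ ×ˢ Finset.range K, Y p ω := by
    intro ω
    rw [linRec_eq_sum, Finset.sum_product_right]
    refine Finset.sum_congr rfl fun t _ => ?_
    rw [map_sum]
    simp [hY, hB]
  have hZ2 : ∀ p : Fin m × ℕ, LpLe P 2 (Z r p.1 p.2) (4 * Real.sqrt d) := fun p =>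
    (hS.lpLe_noise r p.1 p.2).of_exponent_le (by norm_num)
  have hYmem : ∀ p, MemLp (Y p) 2 P := fun p => (B p).comp_memLp' (hZ2 p).memLp
  have hinj : Function.Injective fun p : Fin m × ℕ => ((r, p.1, p.2) : ℕ × Fin m × ℕ) := by
    intro p q hpq
    simp only [Prod.mk.injEq, true_and] at hpq
    exact Prod.ext hpq.1 hpq.2
  have hYind : Pairwise fun p q => IndepFun (Y p) (Y q) P := by
    intro p q hpq
    have h1 := (hS.indep_noise.precomp hinj).indepFun hpq
    exact h1.comp (φ := B p) (ψ := B q) (B p).measurable (B q).measurable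
  have hY0 : ∀ p, ∫ ω, Y p ω ∂P = 0 := by
    intro p
    have h1 : ∫ ω, Z r p.1 p.2 ω ∂P = 0 := by
      have := integral_comp_of_law (hS.measurable_noise r p.1 p.2) (hS.law_noise r p.1 p.2)
        (g := fun z => z) measurable_id
      rw [this]
      exact integral_id_stdGaussian
    rw [(B p).integral_comp_comm ((hZ2 p).memLp.integrable (by norm_num)), h1, map_zero]
  -- One of the two factors a^(K - 1 - t) is discarded, so the geometric series sums to at most 1/(1
  -- - a). The zeroth power is treated apart: the identity has norm at most 1, and norm 0 when d =
  -- 0.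
  have hBn : ∀ p, ‖B p‖ ^ 2 ≤ s p.1 ^ 2 * a ^ (K - 1 - p.2) := by
    intro p
    have h1 : ‖A ^ (K - 1 - p.2)‖ ≤ a ^ (K - 1 - p.2) := by
      rcases Nat.eq_zero_or_pos (K - 1 - p.2) with h0 | h0
      · rw [h0, pow_zero, pow_zero]
        exact ContinuousLinearMap.norm_id_le
      · exact (norm_pow_le' A h0).trans (pow_le_pow_left₀ (norm_nonneg _) hA _)
    have h2 : a ^ (K - 1 - p.2) ≤ 1 := pow_le_one₀ ha0 ha1.le
    have h3 : 0 ≤ a ^ (K - 1 - p.2) := by positivity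
    simp only [hB, norm_smul, mul_pow, Real.norm_eq_abs, sq_abs]
    gcongr
    nlinarith [norm_nonneg (A ^ (K - 1 - p.2))]
  have hYp : ∀ p, ∫ ω, ‖Y p ω‖ ^ 2 ∂P ≤ s p.1 ^ 2 * a ^ (K - 1 - p.2) * (16 * d) := by
    intro p
    have h1 := (hZ2 p).integral_norm_sq_le (by positivity)
    rw [mul_pow, Real.sq_sqrt (by positivity)] at h1
    have h2 : ∀ ω, ‖Y p ω‖ ^ 2 ≤ ‖B p‖ ^ 2 * ‖Z r p.1 p.2 ω‖ ^ 2 := fun ω => by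
      rw [← mul_pow]
      gcongr
      exact (B p).le_opNorm _
    calc ∫ ω, ‖Y p ω‖ ^ 2 ∂P ≤ ∫ ω, ‖B p‖ ^ 2 * ‖Z r p.1 p.2 ω‖ ^ 2 ∂P :=
          integral_mono ((hYmem p).integrable_norm_pow (p := 2) (by norm_num))
            ((hZ2 p).integrable_norm_sq.const_mul _) h2
      _ = ‖B p‖ ^ 2 * ∫ ω, ‖Z r p.1 p.2 ω‖ ^ 2 ∂P := integral_const_mul _ _
      _ ≤ s p.1 ^ 2 * a ^ (K - 1 - p.2) * (16 * d) := by
          refine mul_le_mul (hBn p) (h1.trans (by norm_num)) (integral_nonneg fun ω => by positivity)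
            (by positivity)
  have hgeo : ∑ t ∈ Finset.range K, a ^ (K - 1 - t) ≤ 1 / (1 - a) := by
    rw [Finset.sum_range_reflect (fun t => a ^ t) K, geom_sum_eq ha1.ne,
      ← neg_div_neg_eq, neg_sub, neg_sub]
    have h1 : 0 < 1 - a := by linarith
    gcongr
    have : 0 ≤ a ^ K := by positivity
    linarith
  have h1a : 0 < 1 - a := by linarith
  have hsum : MemLp (fun ω => ∑ p ∈ Finset.univ ×ˢ Finset.range K, Y p ω) 2 P :=
    memLp_finsetSum _ fun p _ => hYmem p
  simp only [hYeq]
  refine (LpLe.iff_integral (n := 2) (by norm_num) hsum (Real.sqrt_nonneg _)).2 ?_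
  rw [integral_norm_sum_sq _ hYmem hYind hY0, Real.sq_sqrt (by positivity)]
  refine (Finset.sum_le_sum fun p _ => hYp p).trans ?_
  rw [Finset.sum_product]
  have h3 : ∀ i : Fin m, ∑ t ∈ Finset.range K, s i ^ 2 * a ^ (K - 1 - t) * (16 * d)
      ≤ s i ^ 2 * (16 * d / (1 - a)) := by
    intro i
    rw [← Finset.sum_mul, ← Finset.mul_sum, mul_assoc]
    gcongr
    calc (∑ t ∈ Finset.range K, a ^ (K - 1 - t)) * (16 * d) ≤ 1 / (1 - a) * (16 * d) := by gcongr
      _ = _ := by ring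
  refine (Finset.sum_le_sum fun i _ => h3 i).trans (le_of_eq ?_)
  rw [← Finset.sum_mul]
  ring

end IsSample

end Noise

/-! ### Local iterates of one client -/

section Iterates

variable {d : ℕ} {𝒳 Ω : Type*} [MeasurableSpace 𝒳] [MeasurableSpace Ω] {P : Measure Ω}
  {F : Measure 𝒳}
  {ρ : 𝒳 → Vec d → ℝ} {Θ : Set (Vec d)} {θ₀ : Vec d} {τ₁ τ₂ W C₁ C₂ : ℝ}

namespace RegularProblem

theorem measurable_localIter (h : RegularProblem F ρ Θ θ₀ τ₁ τ₂ W C₁ C₂) (η σ : ℝ) {k : ℕ}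
    {x : Fin k → Ω → 𝒳} (hx : ∀ j, Measurable (x j)) {z : ℕ → Ω → Vec d}
    (hz : ∀ t, Measurable (z t)) {ϑ : Ω → Vec d} (hϑ : Measurable ϑ) (t : ℕ) :
    Measurable fun ω => localIter ρ η σ (fun j => x j ω) (fun t => z t ω) (ϑ ω) t := by
  induction t with
  | zero => exact hϑ
  | succ t ih =>
    simp only [localIter]
    have h1 : Measurable fun ω => ∑ j, grad ρ (x j ω)
        (localIter ρ η σ (fun j => x j ω) (fun t => z t ω) (ϑ ω) t) :=
      Finset.measurable_sum _ fun j _ => h.measurable_uncurry_grad.comp ((hx j).prodMk ih)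
    fun_prop

theorem measurable_fedAvg (h : RegularProblem F ρ Θ θ₀ τ₁ τ₂ W C₁ C₂) (η : ℝ) (K : ℕ) {m : ℕ}
    {n : Fin m → ℕ} (σ : Fin m → ℝ) {x : (i : Fin m) → Fin (n i) → Ω → 𝒳}
    (hx : ∀ i j, Measurable (x i j)) {z : ℕ → Fin m → ℕ → Ω → Vec d}
    (hz : ∀ r i t, Measurable (z r i t)) (r : ℕ) :
    Measurable fun ω => fedAvg ρ η K σ (fun i j => x i j ω) (fun r i t => z r i t ω) r := by
  induction r with
  | zero => exact measurable_const
  | succ r ih =>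
    simp only [fedAvg]
    refine Finset.measurable_sum _ fun i _ => ?_
    have h1 := h.measurable_localIter η (σ i) (hx i) (hz r i) ih K
    fun_prop

/-- Fourth-moment control of the local iterates of one client. -/
theorem lpLe_localIter [IsProbabilityMeasure F] (h : RegularProblem F ρ Θ θ₀ τ₁ τ₂ W C₁ C₂)
    (hd : 1 ≤ d) (hτ₁ : 0 < τ₁) (hC₁ : 0 < C₁) {η σ : ℝ} (hη : 0 < η) (hητ : η * τ₂ ≤ 1)
    (hσ : 0 ≤ σ) {k : ℕ} {x : Fin k → Ω → 𝒳} (hx : ∀ j, Measurable (x j)) {z : ℕ → Ω → Vec d}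
    (hz : ∀ t, Measurable (z t)) {ϑ : Ω → Vec d} (hϑ : Measurable ϑ)
    {Ξ : Ω → ℝ} (hΞ0 : ∀ ω, 0 ≤ Ξ ω)
    (hΞ : ∀ᵐ ω ∂P, ∀ θ, ‖(1 / (k : ℝ)) • ∑ j, grad ρ (x j ω) θ - popGrad F ρ θ‖
        ≤ τ₁ / 2 * ‖θ - θ₀‖ + Ξ ω)
    {g s e : ℝ} (hg : 0 ≤ g) (hs : 0 ≤ s) (he : 0 ≤ e) (hΞL : LpLe P 4 Ξ g)
    (hzL : ∀ t, LpLe P 4 (z t) s) (hϑL : LpLe P 4 (fun ω => ϑ ω - θ₀) e) (t : ℕ) :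
    LpLe P 4 (fun ω => localIter ρ η σ (fun j => x j ω) (fun t => z t ω) (ϑ ω) t - θ₀)
      ((1 - η * τ₁ / 2) ^ t * e
        + (1 - (1 - η * τ₁ / 2) ^ t) * ((η * g + σ * s) * (2 / (η * τ₁)))) := by
  have hητ₁ : η * τ₁ ≤ 1 := (mul_le_mul_of_nonneg_left (h.tau_le hd) hη.le).trans hητ
  set κ : ℝ := 1 - η * τ₁ / 2 with hκ
  have hκ0 : 0 ≤ κ := by rw [hκ]; linarith
  have hκ1 : κ ≤ 1 := by rw [hκ]; nlinarith
  -- b is the fixed point of x ↦ κx + ηg + σs, so the bound after t steps is a convex combination of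
  -- the initial e and b.
  set b : ℝ := (η * g + σ * s) * (2 / (η * τ₁)) with hb
  have hb0 : 0 ≤ b := by positivity
  have hbκ : (1 - κ) * b = η * g + σ * s := by rw [hκ, hb]; field_simp; ring
  induction t with
  | zero => simpa [localIter] using hϑL
  | succ t ih =>
    have hκt : κ ^ t ≤ 1 := pow_le_one₀ hκ0 hκ1
    have hat : 0 ≤ κ ^ t * e + (1 - κ ^ t) * b :=
      add_nonneg (by positivity) (mul_nonneg (by linarith) hb0)
    set θ : Ω → Vec d := fun ω => localIter ρ η σ (fun j => x j ω) (fun t => z t ω) (ϑ ω) t with hθ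
    have hm := h.measurable_localIter η σ hx hz hϑ (t + 1)
    have hF : LpLe P 4 (fun ω => κ * ‖θ ω - θ₀‖ + (η * Ξ ω + σ * ‖z t ω‖))
        (κ * (κ ^ t * e + (1 - κ ^ t) * b) + (η * g + σ * s)) :=
      (ih.norm.const_mul hκ0).add ((hΞL.const_mul hη.le).add ((hzL t).norm.const_mul hσ)
        (by norm_num) (by positivity) (by positivity)) (by norm_num) (by positivity) (by positivity)
    have hval : κ * (κ ^ t * e + (1 - κ ^ t) * b) + (η * g + σ * s)
        = κ ^ (t + 1) * e + (1 - κ ^ (t + 1)) * b := by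
      rw [← hbκ]; ring
    rw [hval] at hF
    refine hF.of_norm_le (hm.sub_const _).aestronglyMeasurable ?_
    filter_upwards [hΞ] with ω hω
    have h1 : localIter ρ η σ (fun j => x j ω) (fun t => z t ω) (ϑ ω) (t + 1) - θ₀
        = (θ ω - η • popGrad F ρ (θ ω) - θ₀)
          - η • ((1 / (k : ℝ)) • ∑ j, grad ρ (x j ω) (θ ω) - popGrad F ρ (θ ω)) + σ • z t ω := by
      simp only [localIter, hθ]
      rw [smul_sub, smul_smul, mul_one_div]
      abel
    have h2 := h.norm_step_sub_target_le hd hτ₁ hC₁ hη.le hητ (θ ω)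
    have h3 := hω (θ ω)
    rw [h1, Real.norm_of_nonneg (by have := hΞ0 ω; positivity)]
    refine (norm_add_le _ _).trans ?_
    have h4 := norm_sub_le (θ ω - η • popGrad F ρ (θ ω) - θ₀)
      (η • ((1 / (k : ℝ)) • ∑ j, grad ρ (x j ω) (θ ω) - popGrad F ρ (θ ω)))
    rw [norm_smul, Real.norm_of_nonneg hη.le] at h4
    have h5 : ‖σ • z t ω‖ = σ * ‖z t ω‖ := by rw [norm_smul, Real.norm_of_nonneg hσ]
    have h6 := mul_le_mul_of_nonneg_left h3 hη.le
    rw [h5]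
    -- The factor κ splits into the population contraction 1 - ητ₁ and the slope ητ₁/2 of the
    -- gradient deviation.
    have h7 : κ * ‖θ ω - θ₀‖ = (1 - η * τ₁) * ‖θ ω - θ₀‖ + η * (τ₁ / 2 * ‖θ ω - θ₀‖) := by
      rw [hκ]; ring
    nlinarith

/-- Linearization of the empirical gradient around the target. -/
theorem norm_grad_remainder_le (h : RegularProblem F ρ Θ θ₀ τ₁ τ₂ W C₁ C₂)
    (hW : 0 ≤ W) {k : ℕ} (hk : 1 ≤ k) {x : Fin k → 𝒳} {M : ℝ} (hM0 : 0 ≤ M)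
    (hM : ∀ v, ‖(1 / (k : ℝ)) • ∑ j, hess ρ (x j) θ₀ v - popHess F ρ θ₀ v‖ ≤ M * ‖v‖) (θ : Vec d) :
    ‖(1 / (k : ℝ)) • ∑ j, grad ρ (x j) θ - (1 / (k : ℝ)) • ∑ j, grad ρ (x j) θ₀
      - popHess F ρ θ₀ (θ - θ₀)‖ ≤ 1 / 2 * ‖M‖ ^ 2 + (1 / 2 + W) * ‖θ - θ₀‖ ^ 2 := by
  have hk0 : (0 : ℝ) < k := by exact_mod_cast hk
  have h1 : (1 / (k : ℝ)) • ∑ j, grad ρ (x j) θ - (1 / (k : ℝ)) • ∑ j, grad ρ (x j) θ₀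
      - popHess F ρ θ₀ (θ - θ₀)
      = (1 / (k : ℝ)) • ∑ j, (grad ρ (x j) θ - grad ρ (x j) θ₀ - hess ρ (x j) θ₀ (θ - θ₀))
        + ((1 / (k : ℝ)) • ∑ j, hess ρ (x j) θ₀ (θ - θ₀) - popHess F ρ θ₀ (θ - θ₀)) := by
    simp only [Finset.sum_sub_distrib, smul_sub]
    abel
  have h2 : ‖∑ j, (grad ρ (x j) θ - grad ρ (x j) θ₀ - hess ρ (x j) θ₀ (θ - θ₀))‖
      ≤ k * (W * ‖θ - θ₀‖ ^ 2) :=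
    (norm_sum_le_of_le _ fun j _ => h.norm_grad_sub_hess_le hW (x j) θ θ₀).trans (by simp)
  have h3 := hM (θ - θ₀)
  rw [h1]
  refine (norm_add_le _ _).trans ?_
  rw [norm_smul, Real.norm_of_nonneg (by positivity)]
  have h4 : 1 / (k : ℝ) * ‖∑ j, (grad ρ (x j) θ - grad ρ (x j) θ₀ - hess ρ (x j) θ₀ (θ - θ₀))‖
      ≤ W * ‖θ - θ₀‖ ^ 2 := by
    calc _ ≤ 1 / (k : ℝ) * (k * (W * ‖θ - θ₀‖ ^ 2)) := by gcongr
      _ = _ := by field_simp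
  rw [Real.norm_of_nonneg hM0]
  nlinarith [sq_nonneg (M - ‖θ - θ₀‖)]

end RegularProblem

end Iterates

theorem measurable_linRec {d : ℕ} {Ω : Type*} [MeasurableSpace Ω] (A : Vec d →L[ℝ] Vec d)
    {u : ℕ → Ω → Vec d} (hu : ∀ t, Measurable (u t)) (t : ℕ) :
    Measurable fun ω => linRec A (fun t => u t ω) t := by
  induction t with
  | zero => exact measurable_const
  | succ t ih => exact (A.measurable.comp ih).add (hu t)

/-! ### Client weights -/

section Weights

variable {m : ℕ} {n : Fin m → ℕ}

theorem totalSize_pos (hm : 1 ≤ m) (hn : ∀ i, 1 ≤ n i) : 1 ≤ totalSize n :=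
  (hn ⟨0, hm⟩).trans (Finset.single_le_sum (f := n) (fun _ _ => Nat.zero_le _)
    (Finset.mem_univ (⟨0, hm⟩ : Fin m)))

theorem sum_weights (hN : 1 ≤ totalSize n) : ∑ i, (n i : ℝ) / totalSize n = 1 := by
  have : (0 : ℝ) < totalSize n := by exact_mod_cast hN
  rw [← Finset.sum_div, ← Nat.cast_sum]
  exact div_self this.ne'

theorem sum_weights_smul_sub {E : Type*} [AddCommGroup E] [Module ℝ E] (hN : 1 ≤ totalSize n)
    (f : Fin m → E) (a : E) :
    ∑ i, ((n i : ℝ) / totalSize n) • f i - a = ∑ i, ((n i : ℝ) / totalSize n) • (f i - a) := by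
  simp only [smul_sub, Finset.sum_sub_distrib, ← Finset.sum_smul, sum_weights hN, one_smul]

end Weights

namespace IsSample

variable {d m : ℕ} {𝒳 Ω : Type*} [MeasurableSpace 𝒳] [MeasurableSpace Ω] {P : Measure Ω}
  {F : Measure 𝒳} {n : Fin m → ℕ}
  {X : (i : Fin m) → Fin (n i) → Ω → 𝒳} {Z : ℕ → Fin m → ℕ → Ω → Vec d}

theorem indep_client (hS : IsSample P F X Z) (i : Fin m) : iIndepFun (X i) P :=
  hS.indep_data.precomp (g := fun j => (⟨i, j⟩ : (i : Fin m) × Fin (n i)))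
    fun _ _ hij => by simpa using hij

end IsSample

/-! ### Propagation of the quadratic remainder -/

section Remainder

variable {Ω : Type*} [MeasurableSpace Ω] {P : Measure Ω} {E : Type*} [NormedAddCommGroup E]

/-- Squaring turns L⁴ bounds into L² bounds. In the application x = κ^t, and x² ≤ x keeps the source
decaying like κ^t. -/
theorem lpLe_weighted_quadratic {ι : Type*} [Fintype ι] {w : ι → ℝ} (hw0 : ∀ i, 0 ≤ w i)
    (hw1 : ∑ i, w i = 1) {W : ℝ} (hW : 0 ≤ W) {x e : ℝ} (hx0 : 0 ≤ x) (hx1 : x ≤ 1) (he : 0 ≤ e)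
    {b c : ι → ℝ} (hb : ∀ i, 0 ≤ b i) (hc : ∀ i, 0 ≤ c i) {M : ι → Ω → ℝ} {Δ : ι → Ω → E}
    (hM : ∀ i, LpLe P 2 (fun ω => ‖M i ω‖ ^ 2) (c i))
    (hΔ : ∀ i, LpLe P 4 (Δ i) (x * e + b i)) :
    LpLe P 2 (fun ω => ∑ i, w i • (1 / 2 * ‖M i ω‖ ^ 2 + (1 / 2 + W) * ‖Δ i ω‖ ^ 2))
      ((1 + 2 * W) * (x * e ^ 2 + ∑ i, w i * (b i ^ 2 + c i))) := by
  have hi : ∀ i, LpLe P 2 (fun ω => w i • (1 / 2 * ‖M i ω‖ ^ 2 + (1 / 2 + W) * ‖Δ i ω‖ ^ 2))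
      (|w i| * (1 / 2 * c i + (1 / 2 + W) * (x * e + b i) ^ 2)) := by
    intro i
    have h1 := (hM i).const_mul (c := 1 / 2) (by norm_num)
    have h2 := ((hΔ i).sq (add_nonneg (by positivity) (hb i))).const_mul (c := 1 / 2 + W)
      (by positivity)
    exact (h1.add h2 (by norm_num) (mul_nonneg (by norm_num) (hc i)) (by positivity)).const_smul _
  have h1 := LpLe.sum (P := P) (p := 2) (s := Finset.univ) (by norm_num) (fun i _ => hi i)
    (fun i _ => mul_nonneg (abs_nonneg _)
      (add_nonneg (mul_nonneg (by norm_num) (hc i)) (by positivity)))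
  refine h1.mono ?_
  have h2 : ∀ i, |w i| * (1 / 2 * c i + (1 / 2 + W) * (x * e + b i) ^ 2)
      ≤ (1 + 2 * W) * (w i * (x * e ^ 2) + w i * (b i ^ 2 + c i)) := by
    intro i
    rw [abs_of_nonneg (hw0 i)]
    have h3 : (x * e + b i) ^ 2 ≤ 2 * (x * e ^ 2) + 2 * b i ^ 2 := by
      have h4 : (x * e) ^ 2 ≤ x * e ^ 2 := by
        rw [mul_pow]
        have : x ^ 2 ≤ x := by nlinarith
        gcongr
      nlinarith [sq_nonneg (x * e - b i)]
    have h6 : 1 / 2 * c i + (1 / 2 + W) * (x * e + b i) ^ 2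
        ≤ (1 + 2 * W) * (x * e ^ 2 + (b i ^ 2 + c i)) := by
      have h7 := mul_le_mul_of_nonneg_left h3 (show 0 ≤ 1 / 2 + W by positivity)
      nlinarith [mul_nonneg hW (hc i), hc i]
    calc _ ≤ w i * ((1 + 2 * W) * (x * e ^ 2 + (b i ^ 2 + c i))) :=
          mul_le_mul_of_nonneg_left h6 (hw0 i)
      _ = _ := by ring
  refine (Finset.sum_le_sum fun i _ => h2 i).trans (le_of_eq ?_)
  rw [← Finset.mul_sum, Finset.sum_add_distrib, ← Finset.sum_mul, hw1, one_mul]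

/-- The homogeneous factor satisfies 1 - ητ ≤ κ², so it decays faster than the source, which decays
like κ^t down to the floor β. The gap κ(1 - κ) ≥ ητ/4 absorbs the source, whence the constant 1 +
4c/τ. -/
theorem lpLe_remainder {Rm : ℕ → Ω → E} {q : ℕ → Ω → ℝ} {η τ c e β : ℝ} (hτ : 0 < τ)
    (hη : 0 < η) (hητ : η * τ ≤ 1) (hc : 0 ≤ c) (he : 0 ≤ e) (hβ : 0 ≤ β)
    (hm : ∀ t, AEStronglyMeasurable (Rm t) P) (h0 : LpLe P 2 (Rm 0) e)
    (hq : ∀ t, LpLe P 2 (q t) (c * ((1 - η * τ / 2) ^ t * e ^ 2 + β))) (hq0 : ∀ t ω, 0 ≤ q t ω)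
    (hstep : ∀ t ω, ‖Rm (t + 1) ω‖ ≤ (1 - η * τ) * ‖Rm t ω‖ + η * q t ω) (t : ℕ) :
    LpLe P 2 (Rm t) ((1 + 4 * c / τ) * ((1 - η * τ / 2) ^ t * (e + e ^ 2) + β)) := by
  have hητ0 : 0 < η * τ := by positivity
  have hA0 : 0 ≤ 1 - η * τ := by linarith
  set κ : ℝ := 1 - η * τ / 2 with hκ
  have hκ0 : 1 / 2 ≤ κ := by rw [hκ]; linarith
  have hκ1 : κ < 1 := by rw [hκ]; linarith
  have hκp : 0 < κ := by linarith
  set Cr : ℝ := 1 + 4 * c / τ with hCr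
  have hCr1 : 1 ≤ Cr := by
    rw [hCr]
    have : 0 ≤ 4 * c / τ := by positivity
    linarith
  have hCr0 : 0 < Cr := by linarith
  induction t with
  | zero =>
    refine h0.mono ?_
    rw [pow_zero, one_mul]
    have h3 : 0 ≤ e ^ 2 := by positivity
    nlinarith
  | succ t ih =>
    have h1 := (ih.norm.const_mul hA0).add ((hq t).const_mul hη.le) (by norm_num)
      (by positivity) (by positivity)
    refine (h1.of_norm_le (hm (t + 1)) (Filter.Eventually.of_forall fun ω => ?_)).mono ?_
    · have := hq0 t ω
      rw [Real.norm_of_nonneg (by positivity)]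
      exact hstep t ω
    · have h2 : 1 - η * τ ≤ κ * κ := by rw [hκ]; nlinarith [sq_nonneg (η * τ)]
      have h3 : η * c ≤ Cr * (κ * (1 - κ)) := by
        have h4 : 4 * c / τ ≤ Cr := by rw [hCr]; linarith
        have h5 : 1 / 2 * (η * τ / 2) ≤ κ * (1 - κ) := by
          have : 1 - κ = η * τ / 2 := by rw [hκ]; ring
          rw [this]
          gcongr
        calc η * c = 4 * c / τ * (1 / 2 * (η * τ / 2)) := by field_simp; ring
          _ ≤ _ := by gcongr
      have hx : 0 ≤ κ ^ t * e ^ 2 := by positivity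
      have hy : 0 ≤ κ ^ t * e := by positivity
      calc (1 - η * τ) * (Cr * (κ ^ t * (e + e ^ 2) + β)) + η * (c * (κ ^ t * e ^ 2 + β))
          ≤ (κ * κ) * (Cr * (κ ^ t * (e + e ^ 2) + β))
            + Cr * (κ * (1 - κ)) * (κ ^ t * e ^ 2 + β) := by
            rw [← mul_assoc η]
            gcongr
        _ = Cr * (κ * κ * (κ ^ t * e) + κ * (κ ^ t * e ^ 2) + (κ * κ + κ * (1 - κ)) * β) := by
            ring
        _ ≤ Cr * (κ * (κ ^ t * e) + κ * (κ ^ t * e ^ 2) + 1 * β) := by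
            have h8 : κ * κ ≤ κ := by nlinarith
            have h9 : κ * κ + κ * (1 - κ) ≤ 1 := by linarith
            gcongr
        _ = Cr * (κ ^ (t + 1) * (e + e ^ 2) + β) := by ring

end Remainder

/-! ### Error of the server's parameter -/

namespace RegularProblem

variable {d : ℕ} {𝒳 Ω : Type*} [MeasurableSpace 𝒳] [MeasurableSpace Ω] {P : Measure Ω}
  [IsProbabilityMeasure P] {F : Measure 𝒳} [IsProbabilityMeasure F]
  {ρ : 𝒳 → Vec d → ℝ} {Θ : Set (Vec d)} {θ₀ : Vec d} {τ₁ τ₂ W C₁ C₂ : ℝ}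
  {m : ℕ} {n : Fin m → ℕ} {X : (i : Fin m) → Fin (n i) → Ω → 𝒳}
  {Z : ℕ → Fin m → ℕ → Ω → Vec d}

/-- Fourth-moment control of the server's parameter after any number of rounds. -/
theorem lpLe_four_fedAvg (h : RegularProblem F ρ Θ θ₀ τ₁ τ₂ W C₁ C₂) (hS : IsSample P F X Z)
    (hd : 1 ≤ d) (hτ₁ : 0 < τ₁) (hC₁ : 0 < C₁) {η : ℝ} (hη : 0 < η)
    (hητ : η * τ₂ ≤ 1) (hN : 1 ≤ totalSize n) (K : ℕ)
    {σ : Fin m → ℝ} (hσ : ∀ i, 0 ≤ σ i) {Ξ : Fin m → Ω → ℝ} (hΞ0 : ∀ i ω, 0 ≤ Ξ i ω)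
    (hΞ : ∀ i, ∀ᵐ ω ∂P, ∀ θ, ‖(1 / (n i : ℝ)) • ∑ j, grad ρ (X i j ω) θ - popGrad F ρ θ‖
        ≤ τ₁ / 2 * ‖θ - θ₀‖ + Ξ i ω)
    {g b : Fin m → ℝ} (hg : ∀ i, 0 ≤ g i) (hΞL : ∀ i, LpLe P 4 (Ξ i) (g i))
    (hb : ∀ i, b i = (η * g i + σ i * (4 * Real.sqrt d)) * (2 / (η * τ₁))) {e₀ : ℝ}
    (he₀ : ‖θ₀‖ ≤ e₀) (r : ℕ) :
    LpLe P 4 (fun ω => fedAvg ρ η K σ (fun i j => X i j ω) (fun r i t => Z r i t ω) r - θ₀)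
      (e₀ + ∑ i, (n i : ℝ) / totalSize n * b i) := by
  have hητ₁ : η * τ₁ ≤ 1 := (mul_le_mul_of_nonneg_left (h.tau_le hd) hη.le).trans hητ
  have hb0 : ∀ i, 0 ≤ b i := fun i => by
    rw [hb]; have := hg i; have := hσ i; positivity
  have hw0 : ∀ i, 0 ≤ (n i : ℝ) / totalSize n := fun i => by positivity
  have hs0 : 0 ≤ ∑ i, (n i : ℝ) / totalSize n * b i :=
    Finset.sum_nonneg fun i _ => mul_nonneg (hw0 i) (hb0 i)
  have he0 : 0 ≤ e₀ := (norm_nonneg _).trans he₀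
  have hn1 := sum_weights hN
  set w : Fin m → ℝ := fun i => (n i : ℝ) / totalSize n with hw
  induction r with
  | zero =>
    simp only [fedAvg, zero_sub]
    refine (LpLe.const (by norm_num) (-θ₀)).mono ?_
    rw [norm_neg]
    linarith
  | succ r ih =>
    set e : ℝ := e₀ + ∑ i, w i * b i with he
    have he0' : 0 ≤ e := by positivity
    have hϑ := h.measurable_fedAvg η K σ hS.measurable_data hS.measurable_noise r
    set κ : ℝ := 1 - η * τ₁ / 2 with hκ
    have hκ0 : 0 ≤ κ := by rw [hκ]; linarith
    have hκ1 : κ ≤ 1 := by rw [hκ]; nlinarith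
    have hκK : κ ^ K ≤ 1 := pow_le_one₀ hκ0 hκ1
    have hloc : ∀ i, LpLe P 4 (fun ω => localIter ρ η (σ i) (fun j => X i j ω)
        (fun t => Z r i t ω) (fedAvg ρ η K σ (fun i j => X i j ω) (fun r i t => Z r i t ω) r) K - θ₀)
        (κ ^ K * e + (1 - κ ^ K) * b i) := by
      intro i
      rw [hb i]
      exact h.lpLe_localIter hd hτ₁ hC₁ hη hητ (hσ i) (hS.measurable_data i)
        (hS.measurable_noise r i) hϑ (hΞ0 i) (hΞ i) (hg i) (by positivity) he0' (hΞL i)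
        (hS.lpLe_noise r i) ih K
    simp only [fedAvg, sum_weights_smul_sub hN]
    have h1 := LpLe.sum (P := P) (p := 4) (s := Finset.univ) (by norm_num)
      (fun i _ => (hloc i).const_smul (w i)) (fun i _ => by
        have := hb0 i
        exact mul_nonneg (abs_nonneg _) (add_nonneg (by positivity)
          (mul_nonneg (by linarith) this)))
    -- The new bound is a convex combination of e and the weighted mean of the b i, which is at most
    -- e. The bound thus reproduces itself and does not grow with the number of rounds.
    refine h1.mono ?_
    have h2 : ∑ i, w i * (κ ^ K * e + (1 - κ ^ K) * b i)
        = κ ^ K * e + (1 - κ ^ K) * ∑ i, w i * b i := by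
      simp only [mul_add, Finset.sum_add_distrib, ← Finset.sum_mul, hn1, one_mul, Finset.mul_sum]
      congr 1
      exact Finset.sum_congr rfl fun i _ => by ring
    have h3 : (∑ i, |w i| * (κ ^ K * e + (1 - κ ^ K) * b i))
        = ∑ i, w i * (κ ^ K * e + (1 - κ ^ K) * b i) :=
      Finset.sum_congr rfl fun i _ => by rw [abs_of_nonneg (hw0 i)]
    have h4 : κ ^ K * e + (1 - κ ^ K) * ∑ i, w i * b i ≤ e := by
      have : (1 - κ ^ K) * ∑ i, w i * b i ≤ (1 - κ ^ K) * e := by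
        gcongr
        · linarith
      linarith
    exact (le_of_eq (h3.trans h2)).trans h4

/-- Second-moment error decomposition of one round: sampling error, noise, and a remainder that
is quadratic in the errors of the clients. -/
theorem lpLe_two_fedAvg_succ (h : RegularProblem F ρ Θ θ₀ τ₁ τ₂ W C₁ C₂) (hS : IsSample P F X Z)
    (hd : 1 ≤ d) (hτ₁ : 0 < τ₁) (hτ₂ : 0 < τ₂) (hW : 0 < W) (hC₁ : 0 < C₁) {η : ℝ} (hη : 0 < η)
    (hητ : η * τ₂ ≤ 1) (hm : 1 ≤ m) (hn : ∀ i, 1 ≤ n i) (K : ℕ)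
    {σ : Fin m → ℝ} (hσ : ∀ i, 0 ≤ σ i) {b : Fin m → ℝ}
    (hb : ∀ i, b i = (η * (gradConst τ₁ τ₂ C₁ * Real.sqrt (d / n i)) + σ i * (4 * Real.sqrt d))
      * (2 / (η * τ₁))) {e₀ e β : ℝ}
    (he₀ : ‖θ₀‖ ≤ e₀) (he : e = e₀ + ∑ i, (n i : ℝ) / totalSize n * b i)
    (hβ : β = ∑ i, (n i : ℝ) / totalSize n * (b i ^ 2 + 9 * τ₂ ^ 2 * (d / n i))) (r : ℕ) :
    LpLe P 2 (fun ω => fedAvg ρ η K σ (fun i j => X i j ω) (fun r i t => Z r i t ω) (r + 1) - θ₀)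
      (1 / τ₁ * Real.sqrt ((gradCov F ρ θ₀).trace / totalSize n)
        + Real.sqrt (16 * d * (∑ i, ((n i : ℝ) / totalSize n * σ i) ^ 2) / (η * τ₁))
        + (1 + 4 * (1 + 2 * W) / τ₁) * ((1 - η * τ₁ / 2) ^ K * (e + e ^ 2) + β)) := by
  have hN := totalSize_pos hm hn
  have hN0 : (0 : ℝ) < totalSize n := by exact_mod_cast hN
  have hn0 : ∀ i, (0 : ℝ) < n i := fun i => by exact_mod_cast hn i
  have hητ₁ : η * τ₁ ≤ 1 := (mul_le_mul_of_nonneg_left (h.tau_le hd) hη.le).trans hητ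
  have hητ0 : 0 < η * τ₁ := by positivity
  have : ∀ i, Nonempty (Fin (n i)) := fun i => ⟨⟨0, hn i⟩⟩
  choose Ξ hΞ0 hΞL hΞ using fun i => h.exists_grad_bound (P := P) hd hτ₁ hτ₂ hC₁
    (hS.measurable_data i) (hS.law_data i) (hS.indep_client i)
  choose M hM0 hML hM using fun i => h.exists_hess_bound (P := P) hd hτ₁ hτ₂
    (hS.measurable_data i) (hS.law_data i) (hS.indep_client i) θ₀
  simp only [Fintype.card_fin] at hΞL hΞ hML hM
  set g : Fin m → ℝ := fun i => gradConst τ₁ τ₂ C₁ * Real.sqrt (d / n i) with hg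
  have hg0 : ∀ i, 0 ≤ g i := fun i => by simp only [hg, gradConst]; positivity
  have hb0 : ∀ i, 0 ≤ b i := fun i => by
    rw [hb]; have := hg0 i; have := hσ i; positivity
  set w : Fin m → ℝ := fun i => (n i : ℝ) / totalSize n with hw
  have hw0 : ∀ i, 0 ≤ w i := fun i => by positivity
  have hw1 : ∑ i, w i = 1 := sum_weights hN
  have he0 : 0 ≤ e := by
    rw [he]
    exact add_nonneg ((norm_nonneg _).trans he₀)
      (Finset.sum_nonneg fun i _ => mul_nonneg (hw0 i) (hb0 i))
  have hβ0 : 0 ≤ β := by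
    rw [hβ]
    exact Finset.sum_nonneg fun i _ => mul_nonneg (hw0 i) (by positivity)
  set κ : ℝ := 1 - η * τ₁ / 2 with hκ
  have hκ0 : 1 / 2 ≤ κ := by rw [hκ]; linarith
  have hκ1 : κ < 1 := by rw [hκ]; linarith
  have hϑL := h.lpLe_four_fedAvg hS hd hτ₁ hC₁ hη hητ hN K hσ hΞ0 hΞ hg0 hΞL hb he₀ r
  rw [← he] at hϑL
  set ϑ : Ω → Vec d := fun ω =>
    fedAvg ρ η K σ (fun i j => X i j ω) (fun r i t => Z r i t ω) r with hϑdef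
  have hϑm : Measurable ϑ := h.measurable_fedAvg η K σ hS.measurable_data hS.measurable_noise r
  set θ : Fin m → ℕ → Ω → Vec d := fun i t ω =>
    localIter ρ η (σ i) (fun j => X i j ω) (fun t => Z r i t ω) (ϑ ω) t with hθ
  have hθm : ∀ i t, Measurable (θ i t) := fun i t =>
    h.measurable_localIter η (σ i) (hS.measurable_data i) (hS.measurable_noise r i) hϑm t
  have hθL : ∀ i t, LpLe P 4 (fun ω => θ i t ω - θ₀) (κ ^ t * e + b i) := by
    intro i t
    have h1 := h.lpLe_localIter hd hτ₁ hC₁ hη hητ (hσ i) (hS.measurable_data i)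
        (hS.measurable_noise r i) hϑm (hΞ0 i) (hΞ i) (hg0 i) (by positivity) he0 (hΞL i)
        (hS.lpLe_noise r i) hϑL t
    rw [← hb i] at h1
    refine h1.mono ?_
    have : 0 ≤ κ ^ t := by positivity
    nlinarith [hb0 i]
  -- A is the same for all clients, so averaging over clients commutes with the linear part of the
  -- recursion.
  set A : Vec d →L[ℝ] Vec d := ContinuousLinearMap.id ℝ (Vec d) - η • popHess F ρ θ₀ with hA
  have hAn : ‖A‖ ≤ 1 - η * τ₁ := h.norm_one_sub_popHess_le hd hτ₁ hη.le hητ θ₀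
  have hA0 : 0 ≤ 1 - η * τ₁ := by linarith
  set γ : Fin m → Ω → Vec d → Vec d := fun i ω θ => (1 / (n i : ℝ)) • ∑ j, grad ρ (X i j ω) θ
    with hγ
  set S : Ω → Vec d := fun ω => ∑ i, w i • γ i ω θ₀ with hSdef
  have hSeq : ∀ ω, S ω = (1 / (totalSize n : ℝ)) •
      ∑ p : (i : Fin m) × Fin (n i), grad ρ (X p.1 p.2 ω) θ₀ := by
    intro ω
    rw [Fintype.sum_sigma, Finset.smul_sum]
    refine Finset.sum_congr rfl fun i _ => ?_
    simp only [hγ, hw, smul_smul]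
    congr 1
    have := (hn0 i).ne'
    field_simp
  have hSL : LpLe P 2 S (Real.sqrt ((gradCov F ρ θ₀).trace / totalSize n)) := by
    have h1 := (h.lpLe_sum_grad_target (P := P) (X := fun p : (i : Fin m) × Fin (n i) => X p.1 p.2)
      hC₁ (fun p => hS.measurable_data p.1 p.2) (fun p => hS.law_data p.1 p.2)
      hS.indep_data).const_smul (1 / (totalSize n : ℝ))
    simp only [← hSeq] at h1
    refine h1.mono (le_of_eq ?_)
    have hc : (Fintype.card ((i : Fin m) × Fin (n i)) : ℝ) = totalSize n := by
      simp [totalSize]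
    rw [hc, abs_of_nonneg (by positivity)]
    generalize (gradCov F ρ θ₀).trace = T
    rw [show T / (totalSize n : ℝ) = (1 / (totalSize n : ℝ)) ^ 2 * (totalSize n * T) by field_simp,
      Real.sqrt_mul (sq_nonneg (1 / (totalSize n : ℝ))), Real.sqrt_sq (by positivity)]
  -- U is the weighted mean error, V its response to the pooled gradient at θ₀, and G its response
  -- to the noise of this round; Rm collects everything else and is driven by the quadratic term Q
  -- alone.
  set U : ℕ → Ω → Vec d := fun t ω => ∑ i, w i • (θ i t ω - θ₀) with hU
  set V : ℕ → Ω → Vec d := fun t ω => linRec A (fun _ => η • (-S ω)) t with hV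
  set G : ℕ → Ω → Vec d := fun t ω => linRec A (fun t => ∑ i, (w i * σ i) • Z r i t ω) t with hG
  set Q : ℕ → Ω → Vec d := fun t ω => ∑ i, w i • (γ i ω (θ i t ω) - γ i ω θ₀
    - popHess F ρ θ₀ (θ i t ω - θ₀)) with hQ
  set Rm : ℕ → Ω → Vec d := fun t ω => U t ω - V t ω - G t ω with hRm
  have hSm : Measurable S := by
    have hS' : S = fun ω => (1 / (totalSize n : ℝ)) •
      ∑ p : (i : Fin m) × Fin (n i), grad ρ (X p.1 p.2 ω) θ₀ := funext hSeq
    rw [hS']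
    have h1 : Measurable fun ω => ∑ p : (i : Fin m) × Fin (n i), grad ρ (X p.1 p.2 ω) θ₀ :=
      Finset.measurable_sum _ fun p _ => (h.measurable_grad θ₀).comp (hS.measurable_data p.1 p.2)
    fun_prop
  have hUm : ∀ t, Measurable (U t) := fun t =>
    Finset.measurable_sum _ fun i _ => by
      have := hθm i t
      fun_prop
  have hVm : ∀ t, Measurable (V t) := fun t =>
    measurable_linRec A (u := fun _ ω => η • (-S ω)) (fun _ => by fun_prop) t
  have hGm : ∀ t, Measurable (G t) := fun t =>
    measurable_linRec A (u := fun t ω => ∑ i, (w i * σ i) • Z r i t ω) (fun t =>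
      Finset.measurable_sum _ fun i _ => by
        have := hS.measurable_noise r i t
        fun_prop) t
  have hRmm : ∀ t, Measurable (Rm t) := fun t => ((hUm t).sub (hVm t)).sub (hGm t)
  have hloc : ∀ i t ω, θ i (t + 1) ω - θ₀ = A (θ i t ω - θ₀) + η • (-γ i ω θ₀)
      + σ i • Z r i t ω - η • (γ i ω (θ i t ω) - γ i ω θ₀ - popHess F ρ θ₀ (θ i t ω - θ₀)) := by
    intro i t ω
    have h1 : θ i (t + 1) ω = θ i t ω - η • γ i ω (θ i t ω) + σ i • Z r i t ω := by
      simp only [hθ, hγ, localIter, smul_smul, mul_one_div]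
    rw [h1]
    simp only [hA, sub_apply, ContinuousLinearMap.id_apply, smul_apply]
    module
  have hUrec : ∀ t ω, U (t + 1) ω = A (U t ω) + η • (-S ω)
      + ∑ i, (w i * σ i) • Z r i t ω - η • Q t ω := by
    intro t ω
    have h1 : U (t + 1) ω = ∑ i, w i • (A (θ i t ω - θ₀) + η • (-γ i ω θ₀) + σ i • Z r i t ω
        - η • (γ i ω (θ i t ω) - γ i ω θ₀ - popHess F ρ θ₀ (θ i t ω - θ₀))) :=
      Finset.sum_congr rfl fun i _ => by rw [hloc]
    have h2 : A (U t ω) = ∑ i, w i • A (θ i t ω - θ₀) := by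
      simp only [hU, map_sum, map_smul]
    have h3 : η • (-S ω) = ∑ i, w i • (η • (-γ i ω θ₀)) := by
      simp only [hSdef, smul_neg, Finset.sum_neg_distrib, Finset.smul_sum, smul_comm η]
    have h4 : η • Q t ω = ∑ i, w i • (η • (γ i ω (θ i t ω) - γ i ω θ₀
        - popHess F ρ θ₀ (θ i t ω - θ₀))) := by
      simp only [hQ, Finset.smul_sum, smul_comm η]
    rw [h1, h2, h3, h4, ← Finset.sum_add_distrib, ← Finset.sum_add_distrib,
      ← Finset.sum_sub_distrib]
    refine Finset.sum_congr rfl fun i _ => ?_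
    simp only [smul_add, smul_sub, smul_smul]
  have hRrec : ∀ t ω, Rm (t + 1) ω = A (Rm t ω) - η • Q t ω := by
    intro t ω
    simp only [hRm]
    rw [hUrec]
    simp only [hV, hG, linRec, map_sub]
    abel
  have hQle : ∀ t ω, ‖Q t ω‖ ≤ ∑ i, w i • (1 / 2 * ‖M i ω‖ ^ 2
      + (1 / 2 + W) * ‖θ i t ω - θ₀‖ ^ 2) := by
    intro t ω
    refine (norm_sum_le _ _).trans (Finset.sum_le_sum fun i _ => ?_)
    rw [norm_smul, Real.norm_of_nonneg (hw0 i), smul_eq_mul]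
    refine mul_le_mul_of_nonneg_left ?_ (hw0 i)
    exact h.norm_grad_remainder_le hW.le (hn i) (hM0 i ω) (fun v => hM i ω v) _
  have hML2 : ∀ i, LpLe P 2 (fun ω => ‖M i ω‖ ^ 2) (9 * τ₂ ^ 2 * (d / n i)) := by
    intro i
    refine ((hML i).sq (by positivity)).mono (le_of_eq ?_)
    rw [mul_pow, Real.sq_sqrt (by positivity)]
    ring
  have hqL : ∀ t, LpLe P 2 (fun ω => ∑ i, w i • (1 / 2 * ‖M i ω‖ ^ 2
      + (1 / 2 + W) * ‖θ i t ω - θ₀‖ ^ 2)) ((1 + 2 * W) * (κ ^ t * e ^ 2 + β)) := by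
    intro t
    rw [hβ]
    exact lpLe_weighted_quadratic hw0 hw1 hW.le (pow_nonneg (by linarith) t)
      (pow_le_one₀ (by linarith) hκ1.le) he0 hb0 (fun i => by positivity) hML2 (fun i => hθL i t)
  -- V and G start at 0, so Rm inherits the whole error of the previous rounds, including their
  -- noise.
  have hR0 : LpLe P 2 (Rm 0) e := by
    have h1 : Rm 0 = fun ω => ϑ ω - θ₀ := by
      funext ω
      simp only [hRm, hU, hV, hG, linRec, hθ, localIter, sub_zero]
      rw [← Finset.sum_smul, hw1, one_smul]
    rw [h1]
    exact hϑL.of_exponent_le (by norm_num)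
  have hRL : LpLe P 2 (Rm K) ((1 + 4 * (1 + 2 * W) / τ₁) * (κ ^ K * (e + e ^ 2) + β)) := by
    refine lpLe_remainder hτ₁ hη hητ₁ (by positivity) he0 hβ0
      (fun t => (hRmm t).aestronglyMeasurable) hR0 hqL (fun t ω => (norm_nonneg _).trans (hQle t ω))
      (fun t ω => ?_) K
    rw [hRrec]
    refine (norm_sub_le _ _).trans (add_le_add (A.le_of_opNorm_le hAn _) ?_)
    rw [norm_smul, Real.norm_of_nonneg hη.le]
    exact mul_le_mul_of_nonneg_left (hQle t ω) hη.le
  have hVL : LpLe P 2 (V K) (1 / τ₁ * Real.sqrt ((gradCov F ρ θ₀).trace / totalSize n)) := by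
    refine (hSL.norm.const_mul (c := 1 / τ₁) (by positivity)).of_norm_le
      (hVm K).aestronglyMeasurable (Filter.Eventually.of_forall fun ω => ?_)
    rw [Real.norm_of_nonneg (by positivity)]
    have := norm_linRec_const_le hτ₁ hAn hη.le (-S ω) K
    rwa [norm_neg] at this
  have hGL : LpLe P 2 (G K) (Real.sqrt (16 * d * (∑ i, (w i * σ i) ^ 2) / (η * τ₁))) := by
    have := hS.lpLe_linRec_noise (P := P) (by linarith) hAn (fun i => w i * σ i) r K
    rwa [show 1 - (1 - η * τ₁) = η * τ₁ by ring] at this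
  have hfinal := (hVL.add hGL (by norm_num) (by positivity) (by positivity)).add hRL
    (by norm_num) (by positivity) (by positivity)
  refine hfinal.of_norm_le ((h.measurable_fedAvg η K σ hS.measurable_data hS.measurable_noise
    (r + 1)).sub_const θ₀).aestronglyMeasurable (Filter.Eventually.of_forall fun ω => le_of_eq ?_)
  congr 1
  rw [fedAvg, sum_weights_smul_sub hN]
  change U K ω = V K ω + G K ω + (U K ω - V K ω - G K ω)
  abel

end RegularProblem

/-! ### Constants and the size of the remainder -/

section Constants

/-- The factor in front of the `m tr Σ` and noise terms in the bound of the remainder. -/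
def remConst (τ₁ τ₂ W C₁ C_B D c : ℝ) : ℝ :=
  (1 + 4 * (1 + 2 * W) / τ₁) *
    ((1 + 3 * D ^ 2 + 4 * (8 * gradConst τ₁ τ₂ C₁ ^ 2 / τ₁ ^ 2 + 9 * τ₂ ^ 2)) / c
      + 4 * (512 * C_B ^ 2 / τ₁ ^ 2))

/-- The constant of the error bound for federated averaging. -/
def errConst (τ₁ τ₂ W C₁ C_B D c : ℝ) : ℝ :=
  1 + 6 * C_B ^ 2 * τ₁ / τ₂ + 3 * remConst τ₁ τ₂ W C₁ C_B D c ^ 2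
    + 4 * τ₂ * |Real.log (3 * τ₂ / (3 * τ₂ - τ₁))| / τ₁

/-- The number of local steps makes the contraction factor of a round at most `1 / x`. -/
theorem contraction_pow_le {τ₁ τ₂ η C x : ℝ} {K : ℕ} (hτ₁ : 0 < τ₁) (hτ : τ₁ ≤ τ₂)
    (hη : 1 / (2 * τ₂) ≤ η) (hητ : η * τ₁ ≤ 1) (hx : 1 ≤ x)
    (hC : 4 * τ₂ * |Real.log (3 * τ₂ / (3 * τ₂ - τ₁))| / τ₁ ≤ C)
    (hK : C * Real.log x / Real.log (3 * τ₂ / (3 * τ₂ - τ₁)) ≤ K) :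
    (1 - η * τ₁ / 2) ^ K ≤ 1 / x := by
  have hτ₂ : 0 < τ₂ := hτ₁.trans_le hτ
  have hden : 0 < 3 * τ₂ - τ₁ := by linarith
  have hℓ : 0 < Real.log (3 * τ₂ / (3 * τ₂ - τ₁)) :=
    Real.log_pos ((one_lt_div hden).2 (by linarith))
  rw [abs_of_pos hℓ] at hC
  set ℓ := Real.log (3 * τ₂ / (3 * τ₂ - τ₁))
  have hlog : 0 ≤ Real.log x := Real.log_nonneg hx
  -- C contains the logarithm ℓ as a factor, which cancels the division by ℓ in the condition on K.
  have h1 : 4 * τ₂ / τ₁ * Real.log x ≤ K := by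
    refine le_trans ?_ hK
    rw [le_div_iff₀ hℓ]
    calc 4 * τ₂ / τ₁ * Real.log x * ℓ = 4 * τ₂ * ℓ / τ₁ * Real.log x := by ring
      _ ≤ C * Real.log x := by gcongr
  have h2 : τ₁ / (4 * τ₂) ≤ η * τ₁ / 2 := by
    calc τ₁ / (4 * τ₂) = 1 / (2 * τ₂) * τ₁ / 2 := by field_simp; ring
      _ ≤ _ := by gcongr
  have h3 : 1 - η * τ₁ / 2 ≤ Real.exp (-(τ₁ / (4 * τ₂))) := by
    have := Real.add_one_le_exp (-(τ₁ / (4 * τ₂)))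
    linarith
  have h4 : (1 - η * τ₁ / 2) ^ K ≤ Real.exp (-(τ₁ / (4 * τ₂))) ^ K :=
    pow_le_pow_left₀ (by linarith) h3 K
  refine h4.trans ?_
  rw [← Real.exp_nat_mul, one_div, ← Real.exp_log (show 0 < x by linarith), ← Real.exp_neg]
  refine Real.exp_le_exp.2 ?_
  have h5 : Real.log x = τ₁ / (4 * τ₂) * (4 * τ₂ / τ₁ * Real.log x) := by field_simp
  have h6 : τ₁ / (4 * τ₂) * (4 * τ₂ / τ₁ * Real.log x) ≤ τ₁ / (4 * τ₂) * K := by gcongr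
  linarith

theorem add_add_sq_le (x y z : ℝ) : (x + y + z) ^ 2 ≤ 3 * x ^ 2 + 3 * y ^ 2 + 3 * z ^ 2 := by
  nlinarith [sq_nonneg (x - y), sq_nonneg (x - z), sq_nonneg (y - z)]

theorem sq_weighted_sum_le {ι : Type*} [Fintype ι] {w b : ι → ℝ} (hw0 : ∀ i, 0 ≤ w i)
    (hw1 : ∑ i, w i = 1) : (∑ i, w i * b i) ^ 2 ≤ ∑ i, w i * b i ^ 2 := by
  have := (Even.convexOn_pow (𝕜 := ℝ) (n := 2) (by decide)).map_sum_le (t := Finset.univ)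
    (fun i _ => hw0 i) hw1 (p := b) (fun i _ => Set.mem_univ _)
  simpa using this

/-- The remainder term of a round in terms of the sample sizes. -/
theorem remainder_le {τ₂ : ℝ} {m d : ℕ} {n : Fin m → ℕ} (hm : 1 ≤ m) (hn : ∀ i, 1 ≤ n i) (hd : 1 ≤ d)
    {D κK c₁ c₂ e β : ℝ} {b s : Fin m → ℝ}
    (hκ0 : 0 ≤ κK) (hκ : κK ≤ 1 / (d * totalSize n))
    (hb : ∀ i, b i ^ 2 + 9 * τ₂ ^ 2 * (d / n i) ≤ c₁ * (d / n i) + c₂ * (s i / n i))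
    (he : e = D * Real.sqrt d + ∑ i, (n i : ℝ) / totalSize n * b i)
    (hβ : β = ∑ i, (n i : ℝ) / totalSize n * (b i ^ 2 + 9 * τ₂ ^ 2 * (d / n i))) :
    κK * (e + e ^ 2) + β
      ≤ 1 / totalSize n * ((1 + 3 * D ^ 2 + 4 * c₁) * (m * d) + 4 * c₂ * ∑ i, s i) := by
  have hN := totalSize_pos hm hn
  have hN0 : (0 : ℝ) < totalSize n := by exact_mod_cast hN
  have hN1 : (1 : ℝ) ≤ totalSize n := by exact_mod_cast hN
  have hd1 : (1 : ℝ) ≤ d := by exact_mod_cast hd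
  have hm1 : (1 : ℝ) ≤ m := by exact_mod_cast hm
  have hn0 : ∀ i, (0 : ℝ) < n i := fun i => by exact_mod_cast hn i
  have hw0 : ∀ i, 0 ≤ (n i : ℝ) / totalSize n := fun i => by positivity
  have hβ1 : β ≤ 1 / totalSize n * (c₁ * (m * d) + c₂ * ∑ i, s i) := by
    -- The weight nᵢ/N cancels the 1/nᵢ of the squared client error, so a client of any size
    -- contributes (c₁d + c₂sᵢ)/N.
    have h1 : ∀ i, (n i : ℝ) / totalSize n * (b i ^ 2 + 9 * τ₂ ^ 2 * (d / n i))
        ≤ 1 / totalSize n * (c₁ * d + c₂ * s i) := by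
      intro i
      refine (mul_le_mul_of_nonneg_left (hb i) (hw0 i)).trans (le_of_eq ?_)
      have := (hn0 i).ne'
      field_simp
    rw [hβ]
    refine (Finset.sum_le_sum fun i _ => h1 i).trans (le_of_eq ?_)
    rw [← Finset.mul_sum, Finset.sum_add_distrib, ← Finset.mul_sum Finset.univ s c₂]
    simp only [Finset.sum_const, Finset.card_univ, Fintype.card_fin, nsmul_eq_mul]
    ring
  have hBβ : (∑ i, (n i : ℝ) / totalSize n * b i) ^ 2 ≤ β := by
    refine (sq_weighted_sum_le hw0 (sum_weights hN)).trans ?_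
    rw [hβ]
    refine Finset.sum_le_sum fun i _ => mul_le_mul_of_nonneg_left ?_ (hw0 i)
    have : 0 ≤ 9 * τ₂ ^ 2 * ((d : ℝ) / n i) := by positivity
    linarith
  have hβ0 : 0 ≤ β := (sq_nonneg _).trans hBβ
  have he2 : e ^ 2 ≤ 2 * (D ^ 2 * d) + 2 * β := by
    rw [he]
    have h2 : (D * Real.sqrt d) ^ 2 = D ^ 2 * d := by rw [mul_pow, Real.sq_sqrt (by positivity)]
    nlinarith [sq_nonneg (D * Real.sqrt d - ∑ i, (n i : ℝ) / totalSize n * b i)]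
  -- Uses e ≤ (1 + e²)/2 and 1/2 ≤ d.
  have hee : e + e ^ 2 ≤ (1 + 3 * D ^ 2) * d + 3 * β := by nlinarith [sq_nonneg (e - 1)]
  have hκ1 : κK ≤ 1 := hκ.trans (by
    rw [div_le_one (by positivity)]
    nlinarith)
  have hκd : κK * d ≤ m * d / totalSize n := by
    calc κK * d ≤ 1 / (d * totalSize n) * d := by gcongr
      _ = 1 * 1 / totalSize n := by field_simp
      _ ≤ m * d / totalSize n := by gcongr
  calc κK * (e + e ^ 2) + β ≤ κK * ((1 + 3 * D ^ 2) * d + 3 * β) + β := by gcongr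
    _ = (1 + 3 * D ^ 2) * (κK * d) + 3 * (κK * β) + β := by ring
    _ ≤ (1 + 3 * D ^ 2) * (m * d / totalSize n) + 3 * (1 * β) + β := by gcongr
    _ ≤ (1 + 3 * D ^ 2) * (m * d / totalSize n)
        + 4 * (1 / totalSize n * (c₁ * (m * d) + c₂ * ∑ i, s i)) := by linarith
    _ = _ := by ring

end Constants

end FedAvg

end

/-! ### The error bound -/

set_option maxHeartbeats 1000000 in
theorem theorem3
    (τ₁ τ₂ W C₁ C₂ C_B D c : ℝ) (hτ₁ : 0 < τ₁) (hτ₂ : 0 < τ₂) (hW : 0 < W)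
    (hC₁ : 0 < C₁) (hC₂ : 0 < C₂) (hC_B : 0 < C_B) (hD : 0 < D) (hc : 0 < c) :
    ∃ C : ℝ, 0 < C ∧
      ∀ (d : ℕ), 1 ≤ d →
      ∀ (𝒳 : Type*) [MeasurableSpace 𝒳] (F : Measure 𝒳) [IsProbabilityMeasure F]
        (ρ : 𝒳 → FedAvg.Vec d → ℝ) (Θ : Set (FedAvg.Vec d)) (θ₀ : FedAvg.Vec d),
      FedAvg.RegularProblem F ρ Θ θ₀ τ₁ τ₂ W C₁ C₂ →
      (∀ θ ∈ Θ, ‖θ‖ ≤ D * Real.sqrt d) →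
      c * d ≤ (FedAvg.gradCov F ρ θ₀).trace →
      ∀ (m : ℕ), 1 ≤ m →
      ∀ (n : Fin m → ℕ), (∀ i, 1 ≤ n i) →
      ∀ (R K : ℕ), 1 ≤ R →
      C * Real.log (d * FedAvg.totalSize n) / Real.log (3 * τ₂ / (3 * τ₂ - τ₁)) ≤ K →
      ∀ (μ η : ℝ), 0 < μ → 1 / (2 * τ₂) ≤ η → η ≤ 9 / (10 * τ₂) →
      ∀ (Ω : Type*) [MeasurableSpace Ω] (P : Measure Ω) [IsProbabilityMeasure P]
        (X : (i : Fin m) → Fin (n i) → Ω → 𝒳) (Z : ℕ → Fin m → ℕ → Ω → FedAvg.Vec d),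
      FedAvg.IsSample P F X Z →
      ∀ (θhat : Ω → FedAvg.Vec d),
      θhat = FedAvg.privateFedAvg ρ η (C_B * Real.sqrt (FedAvg.dimLog d n)) μ R K X Z →
      Integrable (fun ω => ‖θhat ω - θ₀‖ ^ 2) P ∧
      ∫ ω, ‖θhat ω - θ₀‖ ^ 2 ∂P ≤
        16 / τ₁ ^ 2 *
          ((FedAvg.gradCov F ρ θ₀).trace / FedAvg.totalSize n
            + 2 * m * C * R * K * d * FedAvg.dimLog d n / (μ ^ 2 * (FedAvg.totalSize n : ℝ) ^ 2))
        + C / (FedAvg.totalSize n : ℝ) ^ 2 *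
          (m * (FedAvg.gradCov F ρ θ₀).trace
            + ∑ i, R * K * d * FedAvg.dimLog d n / (μ ^ 2 * n i)) ^ 2 := by
  have hrem0 : 0 ≤ FedAvg.remConst τ₁ τ₂ W C₁ C_B D c := by
    unfold FedAvg.remConst FedAvg.gradConst; positivity
  -- C is fixed before any problem is given, hence before τ₁ ≤ τ₂ is known; the absolute value of
  -- the logarithm in `errConst` keeps that summand nonnegative regardless.
  have hCpos : 0 < FedAvg.errConst τ₁ τ₂ W C₁ C_B D c := by
    unfold FedAvg.errConst; positivity
  refine ⟨FedAvg.errConst τ₁ τ₂ W C₁ C_B D c, hCpos, ?_⟩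
  intro d hd 𝒳 _ F _ ρ Θ θ₀ h hΘ htr m hm n hn R K hR hK μ η hμ hη1 hη2 Ω _ P _ X Z hS θhat hθ
  obtain ⟨r, rfl⟩ : ∃ r, R = r + 1 := ⟨R - 1, by omega⟩
  have hN := FedAvg.totalSize_pos hm hn
  have hN0 : (0 : ℝ) < FedAvg.totalSize n := by exact_mod_cast hN
  have hN1 : (1 : ℝ) ≤ FedAvg.totalSize n := by exact_mod_cast hN
  have hd1 : (1 : ℝ) ≤ d := by exact_mod_cast hd
  have hn0 : ∀ i, (0 : ℝ) < n i := fun i => by exact_mod_cast hn i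
  have hη0 : 0 < η := lt_of_lt_of_le (by positivity) hη1
  have hητ : η * τ₂ ≤ 1 := by
    calc η * τ₂ ≤ 9 / (10 * τ₂) * τ₂ := by gcongr
      _ = 9 / 10 := by field_simp
      _ ≤ 1 := by norm_num
  have hτ := h.tau_le hd
  have hητ₁ : η * τ₁ ≤ 1 := (mul_le_mul_of_nonneg_left hτ hη0.le).trans hητ
  set L : ℝ := FedAvg.dimLog d n with hL
  have hL0 : 0 ≤ L := by
    rw [hL, FedAvg.dimLog]
    exact le_max_of_le_left (by positivity)
  set N : ℝ := (FedAvg.totalSize n : ℝ) with hNdef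
  set G : ℝ := FedAvg.gradConst τ₁ τ₂ C₁ with hG
  set q : ℝ := ((r + 1 : ℕ) : ℝ) * K with hq
  have hq0 : 0 ≤ q := by positivity
  set σ : Fin m → ℝ := fun i =>
    FedAvg.noiseScale (C_B * Real.sqrt L) η μ (r + 1) K (n i) with hσ
  have hσeq : ∀ i, σ i = 2 * C_B * η / μ * (Real.sqrt L * Real.sqrt q) / n i := by
    intro i
    simp only [hσ, FedAvg.noiseScale, ← hq]
    have := (hn0 i).ne'
    field_simp
  have hσ0 : ∀ i, 0 ≤ σ i := fun i => by rw [hσeq]; positivity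
  have hLq : (Real.sqrt L * Real.sqrt q) ^ 2 = L * q := by
    rw [mul_pow, Real.sq_sqrt hL0, Real.sq_sqrt hq0]
  set b : Fin m → ℝ := fun i =>
    (η * (G * Real.sqrt (d / n i)) + σ i * (4 * Real.sqrt d)) * (2 / (η * τ₁)) with hb
  set s : Fin m → ℝ := fun i => q * d * L / (μ ^ 2 * n i) with hs
  have hb2 : ∀ i, b i ^ 2 + 9 * τ₂ ^ 2 * (d / n i)
      ≤ (8 * G ^ 2 / τ₁ ^ 2 + 9 * τ₂ ^ 2) * (d / n i) + 512 * C_B ^ 2 / τ₁ ^ 2 * (s i / n i) := by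
    intro i
    have hni := (hn0 i).ne'
    -- The noise scale is proportional to η, so η cancels from the client error.
    have h1 : b i = 2 * G / τ₁ * Real.sqrt (d / n i)
        + 16 * C_B / (μ * τ₁ * n i) * (Real.sqrt L * Real.sqrt q) * Real.sqrt d := by
      simp only [hb, hσeq]
      field_simp
      ring
    have h2 : (2 * G / τ₁ * Real.sqrt (d / n i)) ^ 2 = 4 * G ^ 2 / τ₁ ^ 2 * (d / n i) := by
      rw [mul_pow, Real.sq_sqrt (by positivity)]
      ring
    have h3 : (16 * C_B / (μ * τ₁ * n i) * (Real.sqrt L * Real.sqrt q) * Real.sqrt d) ^ 2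
        = 256 * C_B ^ 2 / τ₁ ^ 2 * (s i / n i) := by
      rw [mul_pow, mul_pow, hLq, Real.sq_sqrt (by positivity)]
      simp only [hs]
      field_simp
      ring
    rw [h1]
    refine (add_le_add_left (add_sq_le (a := 2 * G / τ₁ * Real.sqrt (d / n i))) _).trans
      (le_of_eq ?_)
    rw [h2, h3]
    ring
  have hLp := h.lpLe_two_fedAvg_succ (P := P) hS hd hτ₁ hτ₂ hW hC₁ hη0 hητ hm hn K hσ0
    (b := b) (fun i => rfl) (hΘ θ₀ h.target_mem) rfl rfl r
  have hκK := FedAvg.contraction_pow_le hτ₁ hτ hη1 hητ₁ (x := d * N) (by nlinarith)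
    (C := FedAvg.errConst τ₁ τ₂ W C₁ C_B D c)
    (by
      have h1 : 0 ≤ 6 * C_B ^ 2 * τ₁ / τ₂ := by positivity
      have h2 : 0 ≤ 3 * FedAvg.remConst τ₁ τ₂ W C₁ C_B D c ^ 2 := by positivity
      rw [FedAvg.errConst]
      linarith) hK
  have hrem := FedAvg.remainder_le (D := D) hm hn hd
    (pow_nonneg (by linarith : (0 : ℝ) ≤ 1 - η * τ₁ / 2) K) hκK hb2 rfl rfl
  rw [← hNdef] at hrem hLp
  rw [hθ]
  change Integrable (fun ω => ‖FedAvg.fedAvg ρ η K σ (fun i j => X i j ω)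
      (fun r i t => Z r i t ω) (r + 1) - θ₀‖ ^ 2) P ∧
    ∫ ω, ‖FedAvg.fedAvg ρ η K σ (fun i j => X i j ω)
      (fun r i t => Z r i t ω) (r + 1) - θ₀‖ ^ 2 ∂P ≤ _
  generalize (FedAvg.gradCov F ρ θ₀).trace = T at *
  have hT0 : 0 ≤ T := le_trans (by positivity) htr
  set p : ℝ := (1 - η * τ₁ / 2) ^ K
      * ((D * Real.sqrt d + ∑ i, (n i : ℝ) / N * b i)
        + (D * Real.sqrt d + ∑ i, (n i : ℝ) / N * b i) ^ 2)
      + ∑ i, (n i : ℝ) / N * (b i ^ 2 + 9 * τ₂ ^ 2 * (d / n i)) with hp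
  have hβ0 : 0 ≤ ∑ i, (n i : ℝ) / N * (b i ^ 2 + 9 * τ₂ ^ 2 * (d / n i)) :=
    Finset.sum_nonneg fun i _ => by positivity
  have hb0 : ∀ i, 0 ≤ b i := fun i => by
    have := hσ0 i
    have : 0 ≤ G := by rw [hG, FedAvg.gradConst]; positivity
    simp only [hb]
    positivity
  have he0 : 0 ≤ D * Real.sqrt d + ∑ i, (n i : ℝ) / N * b i :=
    add_nonneg (by positivity) (Finset.sum_nonneg fun i _ => mul_nonneg (by positivity) (hb0 i))
  have hκ0 : 0 ≤ (1 - η * τ₁ / 2) ^ K := pow_nonneg (by linarith) K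
  have hp0 : 0 ≤ p := add_nonneg (mul_nonneg hκ0 (add_nonneg he0 (sq_nonneg _))) hβ0
  clear_value p
  refine ⟨hLp.integrable_norm_sq, (hLp.integral_norm_sq_le (by positivity)).trans ?_⟩
  set v : ℝ := 1 / τ₁ * Real.sqrt (T / N) with hv
  set g : ℝ := Real.sqrt (16 * d * (∑ i, ((n i : ℝ) / N * σ i) ^ 2) / (η * τ₁)) with hg
  have hv2 : v ^ 2 = 1 / τ₁ ^ 2 * (T / N) := by
    rw [hv, mul_pow, Real.sq_sqrt (by positivity)]
    ring
  have hg2 : g ^ 2 ≤ 64 * C_B ^ 2 / (τ₁ * τ₂) * (m * q * d * L / (μ ^ 2 * N ^ 2)) := by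
    -- The weighted noise scale does not depend on the client, since σ i is inversely proportional
    -- to n i; the sum over clients is just a factor m.
    have h1 : ∀ i, ((n i : ℝ) / N * σ i) ^ 2 = 4 * C_B ^ 2 * η ^ 2 * (L * q) / (μ ^ 2 * N ^ 2) := by
      intro i
      rw [hσeq, mul_pow, div_pow, div_pow, mul_pow _ (Real.sqrt L * Real.sqrt q), hLq]
      have := (hn0 i).ne'
      field_simp
      ring
    rw [hg, Real.sq_sqrt (by positivity)]
    simp only [h1, Finset.sum_const, Finset.card_univ, Fintype.card_fin, nsmul_eq_mul]
    have h2 : 16 * d * (m * (4 * C_B ^ 2 * η ^ 2 * (L * q) / (μ ^ 2 * N ^ 2))) / (η * τ₁)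
        = η * (64 * C_B ^ 2 / τ₁ * (m * q * d * L / (μ ^ 2 * N ^ 2))) := by
      field_simp
      ring
    have h3 : η ≤ 1 / τ₂ := by rwa [le_div_iff₀ hτ₂]
    rw [h2]
    calc η * (64 * C_B ^ 2 / τ₁ * (m * q * d * L / (μ ^ 2 * N ^ 2)))
        ≤ 1 / τ₂ * (64 * C_B ^ 2 / τ₁ * (m * q * d * L / (μ ^ 2 * N ^ 2))) := by gcongr
      _ = _ := by field_simp
  set Y : ℝ := m * q * d * L / (μ ^ 2 * N ^ 2) with hY
  have hY0 : 0 ≤ Y := by positivity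
  set S : ℝ := ∑ i, s i with hSdef
  have hS0 : 0 ≤ S := Finset.sum_nonneg fun i _ => by simp only [hs]; positivity
  set Cr : ℝ := 1 + 4 * (1 + 2 * W) / τ₁ with hCr
  set c₃ : ℝ := 1 + 3 * D ^ 2 + 4 * (8 * G ^ 2 / τ₁ ^ 2 + 9 * τ₂ ^ 2) with hc₃
  set c₄ : ℝ := 4 * (512 * C_B ^ 2 / τ₁ ^ 2) with hc₄
  have hrc : FedAvg.remConst τ₁ τ₂ W C₁ C_B D c = Cr * (c₃ / c + c₄) := rfl
  have hCr0 : 0 ≤ Cr := by positivity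
  have hp2 : Cr * p ≤ FedAvg.remConst τ₁ τ₂ W C₁ C_B D c * (1 / N * (m * T + S)) := by
    -- Here the lower bound c d on the trace of Σ turns the dimension into the trace.
    have h1 : c₃ * (m * d) ≤ c₃ / c * (m * T) := by
      calc c₃ * (m * d) = c₃ / c * (m * (c * d)) := by field_simp
        _ ≤ _ := by gcongr
    have h2 : c₃ * (m * d) + c₄ * S ≤ (c₃ / c + c₄) * (m * T + S) := by
      have h3 : 0 ≤ c₄ * (m * T) := by positivity
      have h4 : 0 ≤ c₃ / c * S := by positivity
      linarith [h3, h4, h1, (by ring : (c₃ / c + c₄) * (m * T + S)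
        = c₃ / c * (m * T) + c₃ / c * S + c₄ * (m * T) + c₄ * S)]
    rw [hrc]
    calc Cr * p ≤ Cr * (1 / N * (c₃ * (m * d) + c₄ * S)) := by gcongr
      _ ≤ Cr * (1 / N * ((c₃ / c + c₄) * (m * T + S))) := by gcongr
      _ = _ := by ring
  have hp3 : (Cr * p) ^ 2 ≤ FedAvg.remConst τ₁ τ₂ W C₁ C_B D c ^ 2 / N ^ 2 * (m * T + S) ^ 2 := by
    calc (Cr * p) ^ 2 ≤ (FedAvg.remConst τ₁ τ₂ W C₁ C_B D c * (1 / N * (m * T + S))) ^ 2 := by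
          gcongr
      _ = _ := by ring
  have hsum : (v + g + Cr * p) ^ 2 ≤ 3 * v ^ 2 + 3 * g ^ 2 + 3 * (Cr * p) ^ 2 :=
    FedAvg.add_add_sq_le _ _ _
  refine hsum.trans ?_
  have hl : 0 ≤ 4 * τ₂ * |Real.log (3 * τ₂ / (3 * τ₂ - τ₁))| / τ₁ := by positivity
  have hCa : 6 * C_B ^ 2 * τ₁ / τ₂ ≤ FedAvg.errConst τ₁ τ₂ W C₁ C_B D c := by
    have h2 : 0 ≤ 3 * FedAvg.remConst τ₁ τ₂ W C₁ C_B D c ^ 2 := by positivity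
    rw [FedAvg.errConst]
    linarith
  have hCb : 3 * FedAvg.remConst τ₁ τ₂ W C₁ C_B D c ^ 2 ≤ FedAvg.errConst τ₁ τ₂ W C₁ C_B D c := by
    have h2 : 0 ≤ 6 * C_B ^ 2 * τ₁ / τ₂ := by positivity
    rw [FedAvg.errConst]
    linarith
  set C := FedAvg.errConst τ₁ τ₂ W C₁ C_B D c
  set rc := FedAvg.remConst τ₁ τ₂ W C₁ C_B D c
  have e1 : 3 * v ^ 2 ≤ 16 / τ₁ ^ 2 * (T / N) := by
    have : 0 ≤ 1 / τ₁ ^ 2 * (T / N) := by positivity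
    rw [hv2]
    calc 3 * (1 / τ₁ ^ 2 * (T / N)) ≤ 16 * (1 / τ₁ ^ 2 * (T / N)) := by linarith
      _ = _ := by ring
  -- 3·64 = 32·6 is the origin of the summand 6C_B²τ₁/τ₂ of `errConst`.
  have e2 : 3 * g ^ 2 ≤ 16 / τ₁ ^ 2 * (2 * C * Y) := by
    calc 3 * g ^ 2 ≤ 3 * (64 * C_B ^ 2 / (τ₁ * τ₂) * Y) := by linarith
      _ = 32 / τ₁ ^ 2 * (6 * C_B ^ 2 * τ₁ / τ₂) * Y := by field_simp; ring
      _ ≤ 32 / τ₁ ^ 2 * C * Y := by gcongr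
      _ = _ := by ring
  have e3 : 3 * (Cr * p) ^ 2 ≤ C / N ^ 2 * (m * T + S) ^ 2 := by
    calc 3 * (Cr * p) ^ 2 ≤ 3 * (rc ^ 2 / N ^ 2 * (m * T + S) ^ 2) := by linarith
      _ = 3 * rc ^ 2 / N ^ 2 * (m * T + S) ^ 2 := by ring
      _ ≤ _ := by gcongr
  have e4 : 2 * m * C * ((r + 1 : ℕ) : ℝ) * K * d * L / (μ ^ 2 * N ^ 2) = 2 * C * Y := by
    rw [hY, hq]
    ring
  rw [e4, mul_add]
  linarith
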